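/- Let $K$ be an infinite field. For a finite-dimensional $K$-vector space $V$ and an integer $p\ge 0$ let $\mathrm{Gr}(p,V)\subseteq\bigwedge^p V$ be the affine cone over the Grassmannian of $p$-dimensional subspaces of $V$ in its Plücker embedding, i.e. the set of all scalar multiples of pure tensors $v_1\wedge\cdots\wedge v_p$ with $v_1,\dots,v_p\in V$. For subsets $X,Y$ of a finite-dimensional $K$-vector space $W$, their join $X+Y$ is the Zariski closure in $W$ of $\{x+y \mid x\in X,\ y\in Y\}$, where the Zariski-closed subsets of $W$ are the common zero sets in $W$ of sets of polynomials with coefficients in $K$. Let the $k$-th secant variety of $X$ be the iterated join of $k+1$ copies of $X$: the $0$-th one is $X$, and the $(k+1)$-st one is the join of the $k$-th one with $X$. Then for every integer $k\ge 0$ there exists an integer $d\ge 0$ such that, for all integers $p\ge 0$ and all finite-dimensional $K$-vector spaces $V$, the $k$-th secant variety of $\mathrm{Gr}(p,V)$ in $\bigwedge^p V$ is defined set-theoretically by polynomials of degree at most $d$, i.e. it is the common zero set in $\bigwedge^p V$ of a set of polynomials on $\bigwedge^p V$ with coefficients in $K$ and of degree at most $d$. -/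

import Mathlib

universe u v

namespace SecantGrassmann

/-- The value at `w : W` of a polynomial on the `K`-vector space `W`. Polynomials on `W` are
written as polynomial expressions in linear forms on `W`; for finite-dimensional `W` these give
exactly the polynomials in the coordinates with respect to any basis, with the same bounds on the
degree, since every linear form is a linear combination of the coordinates. -/
noncomputable def polyEval {K : Type u} {W : Type v} [Field K] [AddCommGroup W] [Module K W]
    (f : MvPolynomial (Module.Dual K W) K) (w : W) : K :=
  MvPolynomial.eval (fun φ : Module.Dual K W => φ w) f

/-- The common zero set in `W` of a set of polynomials on `W`. -/
def zeroSet {K : Type u} {W : Type v} [Field K] [AddCommGroup W] [Module K W]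
    (F : Set (MvPolynomial (Module.Dual K W) K)) : Set W :=
  {w | ∀ f ∈ F, polyEval f w = 0}

/-- The Zariski closure of a subset `S` of `W`. -/
def zariskiClosure (K : Type u) {W : Type v} [Field K] [AddCommGroup W] [Module K W]
    (S : Set W) : Set W :=
  zeroSet {f : MvPolynomial (Module.Dual K W) K | ∀ s ∈ S, polyEval f s = 0}

/-- `X` is defined set-theoretically by polynomials of degree at most `d`. -/
def DefinedInDegreeLE (K : Type u) {W : Type v} [Field K] [AddCommGroup W] [Module K W]
    (X : Set W) (d : ℕ) : Prop :=
  ∃ F : Set (MvPolynomial (Module.Dual K W) K), (∀ f ∈ F, f.totalDegree ≤ d) ∧ X = zeroSet F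

/-- The join of `X` and `Y`: the Zariski closure of `{x + y | x ∈ X, y ∈ Y}`. -/
def join (K : Type u) {W : Type v} [Field K] [AddCommGroup W] [Module K W]
    (X Y : Set W) : Set W :=
  zariskiClosure K {z | ∃ x ∈ X, ∃ y ∈ Y, z = x + y}

/-- The `k`-th secant variety of `X`: the iterated join of `k + 1` copies of `X`, so that the
first secant variety is the join of `X` with itself. -/
def secantVariety (K : Type u) {W : Type v} [Field K] [AddCommGroup W] [Module K W]
    (X : Set W) : ℕ → Set W
  | 0 => X
  | k + 1 => join K (secantVariety K X k) X

/-- The affine cone over the Grassmannian of `p`-dimensional subspaces of `V` in its Plücker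
embedding: all scalar multiples of the tensors `v₁ ∧ ⋯ ∧ vₚ`. The scalar `c` matters only for
`p = 0`, where the empty wedge product is `1` and the cone is all of `⋀[K]^0 V`. -/
def grassmannCone (K : Type u) (V : Type v) [Field K] [AddCommGroup V] [Module K V]
    (p : ℕ) : Set (⋀[K]^p V) :=
  {ω | ∃ (c : K) (x : Fin p → V), ω = c • exteriorPower.ιMulti K p x}

end SecantGrassmann

/-! Fix `N` covectors α (the frame) and two families β, β' of `m` covectors (the window). For ω of
degree N + 2 the values ⟨ω, α ∧ β_i ∧ β'_j⟩ form an m × m matrix. It has rank at most 2 for pure ω,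
hence at most 2k + 2 on sums of k + 1 pure tensors. For m = 2k + 3 its determinant vanishes on the
secant variety, and the degree of this equation depends only on `k`
(`degreeClosure_subset_windowLocus_detPoly`).

Inside the locus where a fixed nonzero polynomial `f` vanishes on all windows, equations of bounded
degree suffice (`exists_degree_windowLocus`). The induction is on the degree of `f`. Let `h` be a
nonzero Hasse derivative of `f`, of order a power q of the exponential characteristic. If `h`
vanishes on all windows, the degree has dropped. Otherwise a window with h ≠ 0 is made part of a
coordinate system and perturbed. Since `f` still vanishes, the extremal mixed coefficient in the
perturbation parameters expresses h·u^q, for a Plücker coordinate u, by lighter coordinates. Up to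
Frobenius powers and powers of `h`, everything is then a polynomial in the coordinates at low words,
which have at most one letter outside frame and window (`exists_lowWord_polynomial`). Such a word
differs from the frame in few places, so its coordinate is a value of one of finitely many
alternating multilinear forms that depend on `m` only (`exists_index_of_lowWord`).

Closed sets of tuples of such forms on the space of finite sequences, stable under substitutions,
satisfy the descending chain condition (`ClosedFamily.wellFounded_lt`). The proof is the same
elimination: where a Hasse derivative of a relation is nonzero, a form of largest arity is
determined by the other forms and by what arises on fixing arguments at finitely many basis vectors.
The closures of degree d of all secant varieties give one descending chain of such families; the
degree at which it stabilises works for all `N` and all spaces (`polyEval_eq_zero_of_stable`).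
Tensors with frames of different lengths are compared by wedging, contracting and functorial maps.
These preserve pure tensors, hence secant varieties and degree closures. -/

namespace SecantGrassmann

/-! ### Elimination up to Frobenius powers and powers of `h` -/

open MvPolynomial in
/-- The elements `u` of `R` such that some `h ^ k * u ^ p ^ e` lies in `A₀`. -/
def perfLoc {K R : Type*} [Field K] [CommRing R] [Algebra K R] (p : ℕ) [ExpChar R p]
    (A₀ : Subalgebra K R) (h : R) (hh : h ∈ A₀) : Subalgebra K R where
  carrier := {u | ∃ k e : ℕ, h ^ k * u ^ p ^ e ∈ A₀}
  mul_mem' := by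
    rintro a b ⟨k, e, ha⟩ ⟨l, f, hb⟩
    -- Raising the two memberships to the powers `p ^ f` and `p ^ e` gives both the Frobenius
    -- exponent `e + f`.
    refine ⟨k * p ^ f + l * p ^ e, e + f, ?_⟩
    have := A₀.mul_mem (A₀.pow_mem ha (p ^ f)) (A₀.pow_mem hb (p ^ e))
    convert this using 1
    simp only [mul_pow, ← pow_mul, pow_add]
    ring
  add_mem' := by
    rintro a b ⟨k, e, ha⟩ ⟨l, f, hb⟩
    refine ⟨k * p ^ f + l * p ^ e, e + f, ?_⟩
    have h1 := A₀.mul_mem (A₀.pow_mem ha (p ^ f)) (A₀.pow_mem hh (l * p ^ e))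
    have h2 := A₀.mul_mem (A₀.pow_mem hb (p ^ e)) (A₀.pow_mem hh (k * p ^ f))
    convert A₀.add_mem h1 h2 using 1
    rw [add_pow_expChar_pow]
    simp only [mul_pow, ← pow_mul, pow_add]
    ring
  algebraMap_mem' r := ⟨0, 0, by simp⟩

section perfLoc

variable {K R : Type*} [Field K] [CommRing R] [Algebra K R] {p : ℕ} [ExpChar R p]
    {A₀ : Subalgebra K R} {h : R} {hh : h ∈ A₀}

theorem le_perfLoc : A₀ ≤ perfLoc p A₀ h hh := fun u hu => ⟨0, 0, by simpa using hu⟩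

/-- A Frobenius power of the product only increases the exponents of `h` and `u`. This is how a
relation linear in `u ^ q` with leading coefficient `h` brings in a new function. -/
theorem mem_perfLoc_of_mul_pow_mem {u : R} {e : ℕ} (hu : h * u ^ p ^ e ∈ perfLoc p A₀ h hh) :
    u ∈ perfLoc p A₀ h hh := by
  obtain ⟨k, f, hf⟩ := hu
  refine ⟨k + p ^ f, e + f, ?_⟩
  convert hf using 1
  rw [mul_pow, ← pow_mul, pow_add, pow_add]
  ring

end perfLoc

section extraction

variable {ι σ A K R : Type*} [CommRing A] [Field K] [CommRing R] [Algebra K R]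

/-- The polynomials whose coefficients lie in the subalgebra `B`. -/
def coeffIn (ι : Type*) (B : Subalgebra K R) : Subring (MvPolynomial ι R) where
  carrier := {P | ∀ m, P.coeff m ∈ B}
  mul_mem' := by
    classical
    intro P Q hP hQ m
    rw [MvPolynomial.coeff_mul]
    exact B.sum_mem fun x _ => B.mul_mem (hP _) (hQ _)
  one_mem' := by
    classical
    intro m
    rw [MvPolynomial.coeff_one]
    split_ifs
    exacts [B.one_mem, B.zero_mem]
  add_mem' := by
    intro P Q hP hQ m
    rw [MvPolynomial.coeff_add]
    exact B.add_mem (hP _) (hQ _)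
  zero_mem' := by
    intro m
    simp
  neg_mem' := by
    intro P hP m
    rw [MvPolynomial.coeff_neg]
    exact B.neg_mem (hP m)

theorem C_mem_coeffIn {B : Subalgebra K R} {a : R} (ha : a ∈ B) :
    MvPolynomial.C a ∈ coeffIn ι B := by
  classical
  intro m
  rw [MvPolynomial.coeff_C]
  split_ifs
  exacts [ha, B.zero_mem]

theorem X_mem_coeffIn (B : Subalgebra K R) (i : ι) :
    (MvPolynomial.X i : MvPolynomial ι R) ∈ coeffIn ι B := by
  classical
  intro m
  rw [MvPolynomial.coeff_X]
  split_ifs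
  exacts [B.one_mem, B.zero_mem]

/-- The Hasse derivative of order `q` in the variable `y₀` of a polynomial in `y₀ ^ q`. -/
noncomputable def hasse (f : MvPolynomial σ A) (y₀ : σ) (q : ℕ) : MvPolynomial σ A :=
  ∑ m ∈ f.support, MvPolynomial.monomial (m - Finsupp.single y₀ q) (((m y₀ / q : ℕ) : A) * f.coeff m)

/-- No two terms merge: terms without `y₀` get coefficient zero, and in the others the exponent of
`y₀` is at least `q` by divisibility, so the truncated subtraction is injective on them. -/
theorem coeff_hasse (f : MvPolynomial σ A) (y₀ : σ) (q : ℕ)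
    (hq : ∀ m ∈ f.support, q ∣ m y₀) {m : σ →₀ ℕ} (hm : m ∈ f.support) (hm0 : m y₀ ≠ 0) :
    (hasse f y₀ q).coeff (m - Finsupp.single y₀ q) = ((m y₀ / q : ℕ) : A) * f.coeff m := by
  classical
  rw [hasse, MvPolynomial.coeff_sum, Finset.sum_eq_single m]
  · simp
  · intro m' hm' hne
    rw [MvPolynomial.coeff_monomial]
    split_ifs with heq
    · by_cases h0 : m' y₀ = 0
      · simp [h0]
      · exfalso
        apply hne
        ext y
        have hy := DFunLike.congr_fun heq y
        by_cases hyy : y = y₀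
        · subst hyy
          have h1 := Nat.le_of_dvd (Nat.pos_of_ne_zero h0) (hq m' hm')
          have h2 := Nat.le_of_dvd (Nat.pos_of_ne_zero hm0) (hq m hm)
          simp only [Finsupp.tsub_apply, Finsupp.single_eq_same] at hy
          omega
        · simpa [Finsupp.single_apply, Ne.symm hyy, hyy] using hy
    · rfl
  · intro h
    exact absurd hm h

theorem totalDegree_hasse_lt (f : MvPolynomial σ A) (y₀ : σ) (q : ℕ) (hq0 : 0 < q)
    (hq : ∀ m ∈ f.support, q ∣ m y₀) (hd : 0 < f.totalDegree) :
    (hasse f y₀ q).totalDegree < f.totalDegree := by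
  classical
  refine (MvPolynomial.totalDegree_finsetSum _ _).trans_lt ?_
  rw [Finset.sup_lt_iff hd]
  intro m hm
  by_cases h0 : m y₀ = 0
  · simpa [h0] using hd
  · refine (MvPolynomial.totalDegree_monomial_le _ _).trans_lt ?_
    refine lt_of_lt_of_le ?_ (MvPolynomial.le_totalDegree hm)
    have h1 := Nat.le_of_dvd (Nat.pos_of_ne_zero h0) (hq m hm)
    have hle : Finsupp.single y₀ q ≤ m := by simpa using h1
    conv_rhs => rw [← tsub_add_cancel_of_le hle]
    rw [Finsupp.sum_add_index' (by simp) (by simp)]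
    simp only [Finsupp.sum_single_index]
    change (m - Finsupp.single y₀ q).sum (fun _ n => n) < _
    omega

open MvPolynomial in
/-- Substitute for `y₀` a polynomial with a single coefficient `η`, that of the product of all
variables, outside `B`, and for the other variables polynomials over `B`. Then the coefficient of
the `q`-th power of the product of all variables is `h * η ^ q` modulo `B`, where `h` is the
constant coefficient of the substituted Hasse derivative. -/
theorem coeff_eval₂_sub_mem [Fintype ι] [Nonempty ι] (p e : ℕ) [ExpChar R p]
    (B : Subalgebra K R) (θ : A →+* MvPolynomial ι R) (hθ : ∀ a, θ a ∈ coeffIn ι B)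
    (s : σ → MvPolynomial ι R) (y₀ : σ) (f : MvPolynomial σ A)
    (hs : ∀ m ∈ f.support, ∀ y ∈ m.support, y ≠ y₀ → s y ∈ coeffIn ι B)
    (R₀ : MvPolynomial ι R) (hR₀ : R₀ ∈ coeffIn ι B) (η : R)
    (hs₀ : s y₀ = R₀ + monomial (Finsupp.equivFunOnFinite.symm fun _ => 1) η)
    (hq : ∀ m ∈ f.support, p ^ e ∣ m y₀) :
    (eval₂ θ s f).coeff (Finsupp.equivFunOnFinite.symm fun _ => p ^ e)
      - (eval₂ θ s (hasse f y₀ (p ^ e))).coeff 0 * η ^ p ^ e ∈ B := by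
  classical
  have hqpos : 0 < p ^ e := pow_pos (expChar_pos R p) e
  set q := p ^ e with hqdef
  set T : ι →₀ ℕ := Finsupp.equivFunOnFinite.symm fun _ => q with hT
  set U : ι →₀ ℕ := Finsupp.equivFunOnFinite.symm fun _ => 1 with hU
  have hUT : q • U = T := by ext i; simp [hU, hT]
  obtain ⟨i₀⟩ := ‹Nonempty ι›
  have hU0 : U ≠ 0 := fun h => by simpa [hU] using DFunLike.congr_fun h i₀
  -- Terms of degree at least two in the monomial of `η ^ q` are multiples of the monomial `T + T`,
  -- so they contribute nothing at `T`.
  have hTT : ¬ (T + T ≤ T) := fun h => by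
    have := h i₀
    simp [hT] at this
    omega
  have hf : f = ∑ m ∈ f.support, monomial m (f.coeff m) := f.as_sum
  have hexp : eval₂ θ s f = ∑ m ∈ f.support, eval₂ θ s (monomial m (f.coeff m)) := by
    conv_lhs => rw [hf]
    rw [eval₂_sum]
  rw [hexp, hasse, eval₂_sum, coeff_sum, coeff_sum, Finset.sum_mul, ← Finset.sum_sub_distrib]
  refine B.sum_mem fun m hm => ?_
  obtain ⟨k, hk⟩ := hq m hm
  set Q := θ (f.coeff m) * (m.erase y₀).prod fun y n => s y ^ n with hQ
  have hQB : Q ∈ coeffIn ι B := by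
    refine (coeffIn ι B).mul_mem (hθ _) ?_
    refine Subring.prod_mem _ fun y hy => (coeffIn ι B).pow_mem (hs m hm y ?_ ?_) _
    · rw [Finsupp.support_erase] at hy; exact Finset.mem_of_mem_erase hy
    · rw [Finsupp.support_erase] at hy; exact Finset.ne_of_mem_erase hy
  have hprod : ∀ m' : σ →₀ ℕ, m'.prod (fun y n => s y ^ n) =
      s y₀ ^ m' y₀ * (m'.erase y₀).prod fun y n => s y ^ n := fun m' =>
    (Finsupp.mul_prod_erase' m' y₀ (fun y n => s y ^ n) (fun _ => pow_zero _)).symm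
  have herase : (m - Finsupp.single y₀ q).erase y₀ = m.erase y₀ := by
    ext y
    by_cases hy : y = y₀
    · subst hy; simp
    · simp [Finsupp.erase_ne hy, Ne.symm hy]
  have hkq : m y₀ / q = k := by rw [hk, Nat.mul_div_cancel_left _ hqpos]
  have e1 : eval₂ θ s (monomial m (f.coeff m)) = Q * s y₀ ^ (q * k) := by
    rw [eval₂_monomial, hprod, hQ, hk]; ring
  have e2 : eval₂ θ s (monomial (m - Finsupp.single y₀ q) (((m y₀ / q : ℕ) : A) * f.coeff m)) =
      (k : MvPolynomial ι R) * (Q * s y₀ ^ (q * k - q)) := by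
    rw [eval₂_monomial, hprod, herase, hQ, hkq, map_mul, map_natCast]
    simp only [Finsupp.tsub_apply, Finsupp.single_eq_same, hk]
    ring
  rw [e1, e2]
  have hb : (monomial U η : MvPolynomial ι R) ^ q = monomial T (η ^ q) := by
    rw [monomial_pow, hUT]
  -- Frobenius splits the `q`-th power into two summands; the outer exponent `k` is the factor
  -- produced by the Hasse derivative.
  have e3 : s y₀ ^ (q * k) = (R₀ ^ q + monomial T (η ^ q)) ^ k := by
    rw [pow_mul, hs₀, hqdef, add_pow_expChar_pow, ← hqdef, hb]
  obtain ⟨z, hz⟩ := Polynomial.powAddExpansion (R₀ ^ q) (monomial T (η ^ q)) k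
  have hc0 : coeff 0 (s y₀) = coeff 0 R₀ := by
    rw [hs₀, coeff_add, coeff_monomial, if_neg hU0, add_zero]
  have hc1 : (k : MvPolynomial ι R) = C (k : R) := by simp
  -- Only the linear term contributes `η ^ q` at `T`, and its factor is the contribution of this
  -- monomial to the constant coefficient of the Hasse derivative. The rest lies over `B`.
  have e4 : coeff T (Q * s y₀ ^ (q * k)) =
      coeff T (Q * R₀ ^ (q * k)) + (k : R) * coeff 0 (Q * R₀ ^ (q * (k - 1))) * η ^ q := by
    rw [e3, hz]
    have : Q * ((R₀ ^ q) ^ k + (k : MvPolynomial ι R) * (R₀ ^ q) ^ (k - 1) * monomial T (η ^ q) +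
        z * monomial T (η ^ q) ^ 2) = Q * R₀ ^ (q * k) +
        C (k : R) * (Q * R₀ ^ (q * (k - 1))) * monomial T (η ^ q) +
        (Q * z) * monomial (T + T) (η ^ q * η ^ q) := by
      rw [pow_mul, pow_mul, pow_two, monomial_mul, hc1]; ring
    rw [this, coeff_add, coeff_add, coeff_mul_monomial', coeff_mul_monomial', if_pos le_rfl,
      if_neg hTT, tsub_self, coeff_C_mul, add_zero]
  have e5 : coeff 0 ((k : MvPolynomial ι R) * (Q * s y₀ ^ (q * k - q))) =
      (k : R) * coeff 0 (Q * R₀ ^ (q * (k - 1))) := by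
    clear_value Q
    rw [hc1, coeff_C_mul]
    simp only [← constantCoeff_eq] at hc0 ⊢
    rw [map_mul constantCoeff Q, map_mul constantCoeff Q, map_pow constantCoeff,
      map_pow constantCoeff, hc0, Nat.mul_sub_one]
  rw [e4, e5, add_sub_cancel_right]
  exact (coeffIn ι B).mul_mem hQB ((coeffIn ι B).pow_mem hR₀ _) T

end extraction

/-- For a nonempty finite set of exponents not all zero there is a power `q` of the exponential
characteristic dividing all of them, such that one of the quotients is nonzero in `K`. -/
theorem exists_expChar_pow_dvd (K : Type*) [Field K] (p : ℕ) [ExpChar K p] {α : Type*}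
    (s : Finset α) (g : α → ℕ) (hs : ∃ a ∈ s, g a ≠ 0) :
    ∃ e : ℕ, (∀ a ∈ s, p ^ e ∣ g a) ∧ ∃ a ∈ s, g a ≠ 0 ∧ ((g a / p ^ e : ℕ) : K) ≠ 0 := by
  classical
  rcases ‹ExpChar K p› with _ | hp
  · obtain ⟨a, ha, h0⟩ := hs
    exact ⟨0, by simp, a, ha, h0, by simpa using h0⟩
  · have : Fact p.Prime := ⟨hp⟩
    -- In positive characteristic the exponent is the least `p`-adic valuation that occurs among the
    -- nonzero values.
    obtain ⟨a₀, ha₀, hmin⟩ := Finset.exists_min_image (s.filter fun a => g a ≠ 0)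
      (fun a => padicValNat p (g a)) (by
        obtain ⟨a, ha, h0⟩ := hs
        exact ⟨a, Finset.mem_filter.2 ⟨ha, h0⟩⟩)
    rw [Finset.mem_filter] at ha₀
    refine ⟨padicValNat p (g a₀), fun a ha => ?_, a₀, ha₀.1, ha₀.2, ?_⟩
    · by_cases h0 : g a = 0
      · simp [h0]
      · exact (padicValNat_dvd_iff_le h0).2 (hmin a (Finset.mem_filter.2 ⟨ha, h0⟩))
    · rw [Ne, CharP.cast_eq_zero_iff K p]
      intro hdvd
      have h1 : p ^ (padicValNat p (g a₀) + 1) ∣ g a₀ := by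
        rw [pow_succ]
        exact Nat.mul_dvd_of_dvd_div pow_padicValNat_dvd hdvd
      exact pow_succ_padicValNat_not_dvd ha₀.2 h1

theorem prod_elim_mem_coeffIn {K J ι R : Type*} [Field K] [Fintype J] [CommRing R] [Algebra K R] (B : Subalgebra K R)
    (r : J → Option ι) :
    (∏ k, (r k).elim 1 MvPolynomial.X : MvPolynomial ι R) ∈ coeffIn ι B := by
  refine Subring.prod_mem _ fun k _ => ?_
  rcases r k with _ | i
  · exact Subring.one_mem _
  · exact X_mem_coeffIn B i

/-! ### Multilinear forms along parametrised changes of their arguments -/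

section moves

variable {K M J ι T : Type*} [Field K] [AddCommGroup M] [Module K M] [Fintype J] [DecidableEq J]
  [Fintype ι]

/-- The vectors among which `base` and the moves `mv` choose. -/
def moveVec (base : J → M) (mv : J → ι → M) (r : J → Option ι) (k : J) : M :=
  (r k).elim (base k) (mv k)

/-- The value at `base + ∑ i, t i • mv i` of a family of multilinear maps, as a polynomial in `t`
with coefficients functions on the parameter set of the family. -/
noncomputable def movePoly (F : T → MultilinearMap K (fun _ : J => M) K) (base : J → M)
    (mv : J → ι → M) : MvPolynomial ι (T → K) :=
  ∑ r : J → Option ι, MvPolynomial.C (fun x => F x (moveVec base mv r)) *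
    ∏ k, (r k).elim 1 MvPolynomial.X

theorem eval_movePoly (F : T → MultilinearMap K (fun _ : J => M) K) (base : J → M)
    (mv : J → ι → M) (x : T) (t : ι → K) :
    MvPolynomial.eval t (MvPolynomial.map (Pi.evalRingHom (fun _ => K) x) (movePoly F base mv)) =
      F x (fun k => base k + ∑ i, t i • mv k i) := by
  have h1 : (fun k => base k + ∑ i, t i • mv k i) =
      fun k => ∑ o : Option ι, (o.elim 1 t : K) • (o.elim (base k) (mv k) : M) := by
    funext k
    simp [Fintype.sum_option]
  rw [h1, MultilinearMap.map_sum, movePoly, map_sum, map_sum]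
  refine Finset.sum_congr rfl fun r _ => ?_
  rw [MultilinearMap.map_smul_univ, map_mul, map_mul, map_prod, map_prod, MvPolynomial.map_C,
    MvPolynomial.eval_C, mul_comm, smul_eq_mul]
  congr 1
  refine Finset.prod_congr rfl fun k _ => ?_
  rcases r k with _ | i <;> simp

theorem movePoly_mem_coeffIn (F : T → MultilinearMap K (fun _ : J => M) K) (base : J → M)
    (mv : J → ι → M) (B : Subalgebra K (T → K))
    (hB : ∀ r : J → Option ι, (fun x => F x (moveVec base mv r)) ∈ B) :
    movePoly F base mv ∈ coeffIn ι B :=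
  Subring.sum_mem _ fun r _ => Subring.mul_mem _ (C_mem_coeffIn (hB r)) (prod_elim_mem_coeffIn B r)

/-- Splitting off the single term of `movePoly` in which every position is moved by its own
variable. -/
theorem movePoly_eq_add (F : T → MultilinearMap K (fun _ : J => M) K) (base : J → M)
    (mv : J → ι → M) (B : Subalgebra K (T → K)) (r₀ : J → Option ι)
    (hr₀ : (∏ k, (r₀ k).elim 1 MvPolynomial.X : MvPolynomial ι (T → K)) =
      MvPolynomial.monomial (Finsupp.equivFunOnFinite.symm fun _ => 1) 1)
    (hB : ∀ r : J → Option ι, r ≠ r₀ → (fun x => F x (moveVec base mv r)) ∈ B) :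
    ∃ R₀ ∈ coeffIn ι B, movePoly F base mv =
      R₀ + MvPolynomial.monomial (Finsupp.equivFunOnFinite.symm fun _ => 1)
        (fun x => F x (moveVec base mv r₀)) := by
  classical
  refine ⟨∑ r ∈ Finset.univ.erase r₀, MvPolynomial.C (fun x => F x (moveVec base mv r)) *
    ∏ k, (r k).elim 1 MvPolynomial.X, Subring.sum_mem _ fun r hr => Subring.mul_mem _
    (C_mem_coeffIn (hB r (Finset.ne_of_mem_erase hr))) (prod_elim_mem_coeffIn B r), ?_⟩
  rw [movePoly, ← Finset.sum_erase_add _ _ (Finset.mem_univ r₀), hr₀, MvPolynomial.C_mul_monomial,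
    mul_one]

end moves

/-- A polynomial with function coefficients all of whose values vanish is zero. -/
theorem eq_zero_of_eval_map_eq_zero {K ι T : Type*} [Field K] [Infinite K]
    (P : MvPolynomial ι (T → K))
    (h : ∀ x t, MvPolynomial.eval t (MvPolynomial.map (Pi.evalRingHom (fun _ => K) x) P) = 0) :
    P = 0 := by
  ext m x
  have h1 : MvPolynomial.map (Pi.evalRingHom (fun _ => K) x) P = 0 :=
    MvPolynomial.funext fun t => by rw [h x t, map_zero]
  have h2 := congrArg (MvPolynomial.coeff m) h1
  rw [MvPolynomial.coeff_map, MvPolynomial.coeff_zero] at h2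
  simpa using h2

end SecantGrassmann

/-! ### Tuples of alternating forms and closed families -/

namespace SecantGrassmann

/-- A finite list of spaces of multilinear forms on `ℕ →₀ K`, the arguments of which carry
colours. -/
structure Sig (κ : Type) where
  L : Type
  [finL : Fintype L]
  ι : L → Type
  [finι : ∀ l, Fintype (ι l)]
  c : ∀ l, ι l → κ

attribute [instance] Sig.finL Sig.finι

/-- The points: tuples of multilinear forms that are alternating in the arguments of each colour. -/
structure Pt (K : Type u) [Field K] {κ : Type} (P : Sig κ) where
  form : ∀ l, MultilinearMap K (fun _ : P.ι l => ℕ →₀ K) K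
  alt : ∀ l v i j, i ≠ j → P.c l i = P.c l j → v i = v j → form l v = 0

/-- The values of the forms are used as coordinates. -/
abbrev Sig.Idx {κ : Type} (P : Sig κ) (K : Type u) [Field K] : Type u :=
  Σ l, (P.ι l → (ℕ →₀ K))

variable {K : Type u} [Field K] {κ : Type} {P : Sig κ}

namespace Pt

theorem ext' {x y : Pt K P} (h : ∀ l v, x.form l v = y.form l v) : x = y := by
  cases x; cases y
  congr
  funext l
  exact MultilinearMap.ext (h l)

/-- The coordinates of a point. -/
noncomputable def val (x : Pt K P) (i : P.Idx K) : K := x.form i.1 i.2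

/-- Evaluation of polynomials at a point. -/
noncomputable def ev (x : Pt K P) : MvPolynomial (P.Idx K) K →+* K := MvPolynomial.eval x.val

/-- Pulling back a point along linear endomorphisms, one for each colour. -/
noncomputable def comap (φ : κ → (ℕ →₀ K) →ₗ[K] (ℕ →₀ K)) (x : Pt K P) : Pt K P where
  form l := (x.form l).compLinearMap fun i => φ (P.c l i)
  alt l v i j hij hc hv := by
    rw [MultilinearMap.compLinearMap_apply]
    exact x.alt l _ i j hij hc (by simp only [hc, hv])

theorem comap_form (φ : κ → (ℕ →₀ K) →ₗ[K] (ℕ →₀ K)) (x : Pt K P) (l : P.L)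
    (v : P.ι l → (ℕ →₀ K)) : (x.comap φ).form l v = x.form l fun i => φ (P.c l i) (v i) := rfl

theorem ev_comap (φ : κ → (ℕ →₀ K) →ₗ[K] (ℕ →₀ K)) (x : Pt K P) (f : MvPolynomial (P.Idx K) K) :
    (x.comap φ).ev f =
      x.ev (MvPolynomial.rename (fun i : P.Idx K => ⟨i.1, fun j => φ (P.c i.1 j) (i.2 j)⟩) f) := by
  rw [ev, ev, MvPolynomial.eval_rename]
  rfl

theorem comap_id (x : Pt K P) : x.comap (fun _ => LinearMap.id) = x := ext' fun _ _ => rfl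

theorem form_comp_swap (x : Pt K P) {l : P.L} [DecidableEq (P.ι l)] (v : P.ι l → (ℕ →₀ K))
    {i j : P.ι l} (hij : i ≠ j) (hc : P.c l i = P.c l j) :
    x.form l (v ∘ Equiv.swap i j) = -x.form l v := by
  classical
  have h0 : ∀ a, x.form l (Function.update (Function.update v i a) j a) = 0 := fun a =>
    x.alt l _ i j hij hc (by simp [hij])
  have h1 := h0 (v i + v j)
  have hc1 : ∀ a b c, Function.update (Function.update v i (a + b)) j c =
      Function.update (Function.update v j c) i (a + b) := fun a b c =>
    Function.update_comm hij _ _ _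
  rw [MultilinearMap.map_update_add, hc1, hc1, MultilinearMap.map_update_add,
    MultilinearMap.map_update_add, Function.update_comm hij.symm, Function.update_comm hij.symm,
    Function.update_comm hij.symm, Function.update_comm hij.symm, h0, h0] at h1
  have h2 : Function.update (Function.update v i (v i)) j (v j) = v := by simp
  have h3 : Function.update (Function.update v i (v j)) j (v i) = v ∘ Equiv.swap i j := by
    funext k
    by_cases hkj : k = j
    · subst hkj; simp
    · by_cases hki : k = i
      · subst hki; simp [hij]
      · simp [hkj, hki, Equiv.swap_apply_of_ne_of_ne hki hkj]
  rw [h2, h3] at h1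
  linear_combination h1

/-- A permutation preserving colours is a product of transpositions preserving colours, each of
which changes the sign. The factor does not depend on the point, so it can serve as a coefficient of
a polynomial. -/
theorem exists_form_comp_perm (P : Sig κ) (l : P.L) (σ : Equiv.Perm (P.ι l))
    (hσ : ∀ i, P.c l (σ i) = P.c l i) :
    ∃ ε : K, ∀ (x : Pt K P) v, x.form l (v ∘ σ) = ε * x.form l v := by
  classical
  induction hn : σ.support.card using Nat.strong_induction_on generalizing σ with
  | _ n ih =>
    by_cases h1 : σ = 1
    · exact ⟨1, fun x v => by simp [h1]⟩
    · obtain ⟨a, ha⟩ : ∃ a, σ a ≠ a := by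
        by_contra hcon
        push Not at hcon
        exact h1 (Equiv.ext hcon)
      obtain ⟨ε, hε⟩ := ih _ (hn ▸ Equiv.Perm.card_support_swap_mul ha) (Equiv.swap a (σ a) * σ)
        (fun i => by
          rw [Equiv.Perm.mul_apply, ← hσ i]
          by_cases h2 : σ i = a
          · rw [h2, Equiv.swap_apply_left, hσ]
          · by_cases h3 : σ i = σ a
            · rw [h3, Equiv.swap_apply_right, hσ]
            · rw [Equiv.swap_apply_of_ne_of_ne h2 h3]) rfl
      refine ⟨-ε, fun x v => ?_⟩
      have h2 : v ∘ σ = (v ∘ Equiv.swap a (σ a)) ∘ (Equiv.swap a (σ a) * σ : Equiv.Perm _) := by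
        funext k; simp
      rw [h2, hε, form_comp_swap x v (Ne.symm ha) (hσ a).symm]
      ring

end Pt

/-- The sets of points that are closed and stable under linear substitutions. -/
structure ClosedFamily (K : Type u) [Field K] {κ : Type} (P : Sig κ) where
  carrier : Set (Pt K P)
  closed : ∀ x : Pt K P, (∀ f, (∀ y ∈ carrier, y.ev f = 0) → x.ev f = 0) → x ∈ carrier
  comap_mem : ∀ φ, ∀ x ∈ carrier, x.comap φ ∈ carrier

namespace ClosedFamily

theorem carrier_injective : Function.Injective (carrier : ClosedFamily K P → Set (Pt K P)) := by
  rintro ⟨X, _, _⟩ ⟨Y, _, _⟩ rfl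
  rfl

instance : PartialOrder (ClosedFamily K P) := PartialOrder.lift carrier carrier_injective

/-- The closure of a set of points stable under linear substitutions. -/
def closure (S : Set (Pt K P)) (hS : ∀ φ, ∀ x ∈ S, x.comap φ ∈ S) : ClosedFamily K P where
  carrier := {x | ∀ f, (∀ y ∈ S, y.ev f = 0) → x.ev f = 0}
  closed x hx f hf := hx f fun _ hy => hy f hf
  comap_mem φ x hx f hf := by
    rw [Pt.ev_comap]
    exact hx _ fun y hy => by rw [← Pt.ev_comap]; exact hf _ (hS φ y hy)

theorem subset_closure {S : Set (Pt K P)} {hS : ∀ φ, ∀ x ∈ S, x.comap φ ∈ S} :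
    S ⊆ (closure S hS).carrier := fun x hx _ hf => hf x hx

theorem closure_le {S : Set (Pt K P)} {hS : ∀ φ, ∀ x ∈ S, x.comap φ ∈ S} {X : ClosedFamily K P}
    (h : S ⊆ X.carrier) : closure S hS ≤ X :=
  fun x hx => X.closed x fun f hf => hx f fun y hy => hf y (h hy)

/-- Vanishing of a polynomial at all pull-backs cuts out a closed family. -/
def cut (X : ClosedFamily K P) (g : MvPolynomial (P.Idx K) K) : ClosedFamily K P where
  carrier := {x | x ∈ X.carrier ∧ ∀ φ, (x.comap φ).ev g = 0}
  closed x hx := ⟨X.closed x fun f hf => hx f fun y hy => hf y hy.1, fun φ => by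
    rw [Pt.ev_comap]
    exact hx _ fun y hy => by rw [← Pt.ev_comap]; exact hy.2 φ⟩
  comap_mem φ x hx := ⟨X.comap_mem φ x hx.1, fun ψ => by
    exact hx.2 fun c => φ c ∘ₗ ψ c⟩

/-- The ideal of a closed family. -/
def ideal (X : ClosedFamily K P) : Ideal (MvPolynomial (P.Idx K) K) where
  carrier := {f | ∀ y ∈ X.carrier, y.ev f = 0}
  add_mem' ha hb y hy := by rw [map_add, ha y hy, hb y hy, add_zero]
  zero_mem' y _ := map_zero _
  smul_mem' c f hf y hy := by rw [smul_eq_mul, map_mul, hf y hy, mul_zero]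

theorem le_of_ideal_le {X Y : ClosedFamily K P} (h : Y.ideal ≤ X.ideal) : X ≤ Y :=
  fun x hx => Y.closed x fun f hf => h (show f ∈ Y.ideal from hf) x hx

theorem ideal_antitone {X Y : ClosedFamily K P} (h : X ≤ Y) : Y.ideal ≤ X.ideal :=
  fun _ hf y hy => hf y (h hy)

/-- Forms without arguments are scalars; there are finitely many coordinates and Hilbert's basis
theorem applies. This starts the induction on arities. -/
theorem wellFounded_of_isEmpty (hP : ∀ l, IsEmpty (P.ι l)) :
    WellFounded ((· < ·) : ClosedFamily K P → ClosedFamily K P → Prop) := by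
  have : Finite (P.Idx K) := inferInstance
  have hwf : WellFounded ((· > ·) : Ideal (MvPolynomial (P.Idx K) K) → _ → Prop) := wellFounded_gt
  refine Subrelation.wf (r := InvImage (· > ·) ideal) ?_ (InvImage.wf _ hwf)
  intro X Y hXY
  exact lt_of_le_not_ge (ideal_antitone hXY.le) fun h => hXY.not_ge (le_of_ideal_le h)

end ClosedFamily

/-! ### Representatives of words up to permutations within colours -/

section words

/-- The basis vectors spelled by a word. -/
noncomputable def wordVec {α : Type} (w : α → ℕ) (i : α) : ℕ →₀ K := Finsupp.single (w i) 1

/-- Words with distinct coloured letters that are the chosen representative of their set of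
coloured letters. -/
def IsNormal {α : Type} (c : α → κ) (w : α → ℕ) : Prop :=
  Function.Injective (fun i => (c i, w i)) ∧
    @Classical.epsilon _ ⟨w⟩ (fun w' : α → ℕ => Function.Injective (fun i => (c i, w' i)) ∧
      Set.range (fun i => (c i, w' i)) = Set.range (fun i => (c i, w i))) = w

theorem IsNormal.eq_of_range {α : Type} {c : α → κ} {w w' : α → ℕ} (h : IsNormal c w)
    (h' : IsNormal c w')
    (hr : Set.range (fun i => (c i, w i)) = Set.range (fun i => (c i, w' i))) : w = w' := by
  rw [← h.2, ← h'.2, hr]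

/-- Two words with distinct coloured letters and the same set of them differ by a permutation within
colours. Normal words thus suffice as variables, and distinct ones have distinct sets of coloured
letters, which the elimination needs. -/
theorem exists_isNormal_comp {α : Type} [Finite α] (c : α → κ) (w : α → ℕ)
    (hw : Function.Injective (fun i => (c i, w i))) :
    ∃ σ : Equiv.Perm α, (∀ i, c (σ i) = c i) ∧ IsNormal c (w ∘ σ) := by
  have hspec := @Classical.epsilon_spec _
    (fun w' : α → ℕ => Function.Injective (fun i => (c i, w' i)) ∧
      Set.range (fun i => (c i, w' i)) = Set.range (fun i => (c i, w i))) ⟨w, hw, rfl⟩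
  set w' := @Classical.epsilon (α → ℕ) ⟨w⟩
    (fun w' : α → ℕ => Function.Injective (fun i => (c i, w' i)) ∧
      Set.range (fun i => (c i, w' i)) = Set.range (fun i => (c i, w i))) with hw'
  have hex : ∀ i, ∃ j, (c j, w j) = (c i, w' i) := fun i => by
    have : (c i, w' i) ∈ Set.range (fun i => (c i, w i)) := hspec.2 ▸ ⟨i, rfl⟩
    exact this
  choose σ hσ using hex
  have hinj : Function.Injective σ := fun i j hij => hspec.1 (by
    simp only
    rw [← hσ i, ← hσ j, hij])
  refine ⟨Equiv.ofBijective σ (Finite.injective_iff_bijective.1 hinj), fun i => congrArg Prod.fst (hσ i), ?_⟩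
  have h1 : w ∘ (Equiv.ofBijective σ (Finite.injective_iff_bijective.1 hinj)) = w' :=
    funext fun i => congrArg Prod.snd (hσ i)
  rw [h1]
  refine ⟨hspec.1, ?_⟩
  simp only [hspec.2]
  exact hw'.symm

end words

end SecantGrassmann

/-! ### Omitting a form and fixing arguments at basis vectors -/

namespace SecantGrassmann

variable {K : Type u} [Field K] {κ : Type} {P : Sig κ}

open Classical in
/-- Omit one of the forms. -/
noncomputable abbrev Sig.drop (P : Sig κ) (l₀ : P.L) : Sig κ where
  L := {l // l ≠ l₀}
  ι l := P.ι l
  c l := P.c l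

open Classical in
/-- The forms obtained by assigning basis vectors with index less than `n` to some of the
arguments, other than the form `l₀` with no assigned arguments. -/
noncomputable abbrev Sig.shift (P : Sig κ) (l₀ : P.L) (n : ℕ) : Sig κ where
  L := {q : Σ l, (P.ι l → Option (Fin n)) // ¬ (q.1 = l₀ ∧ ∀ i, q.2 i = none)}
  ι q := {i // q.1.2 i = none}
  c q i := P.c q.1.1 i

section vectors

variable (K) in
/-- Shifting the indices of the basis vectors by `n`. -/
noncomputable def sh (n : ℕ) : (ℕ →₀ K) →ₗ[K] (ℕ →₀ K) := Finsupp.lmapDomain K K (· + n)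

variable (K) in
/-- Forgetting the first `n` coordinates and shifting back. -/
noncomputable def tail (n : ℕ) : (ℕ →₀ K) →ₗ[K] (ℕ →₀ K) :=
  Finsupp.lcomapDomain (· + n) (add_left_injective n)

variable (K) in
/-- The projection to the first `n` coordinates. -/
noncomputable def win (n : ℕ) : (ℕ →₀ K) →ₗ[K] (ℕ →₀ K) :=
  ∑ b : Fin n, (Finsupp.lsingle (b : ℕ)).comp (Finsupp.lapply (b : ℕ))

/-- The basis vector of an assigned argument. -/
noncomputable def winVec {n : ℕ} (o : Option (Fin n)) : ℕ →₀ K :=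
  o.elim 0 fun b => Finsupp.single (b : ℕ) 1

theorem win_apply (n : ℕ) (v : ℕ →₀ K) :
    win K n v = ∑ b : Fin n, v b • Finsupp.single (b : ℕ) (1 : K) := by
  simp [win, LinearMap.sum_apply]

theorem win_apply_apply (n : ℕ) (v : ℕ →₀ K) (i : ℕ) :
    win K n v i = if i < n then v i else 0 := by
  rw [win_apply, Finsupp.finsetSum_apply]
  split_ifs with h
  · rw [Finset.sum_eq_single ⟨i, h⟩]
    · simp
    · intro b _ hb
      have : (b : ℕ) ≠ i := fun hbi => hb (Fin.ext hbi)
      simp [this]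
    · simp
  · refine Finset.sum_eq_zero fun b _ => ?_
    have : (b : ℕ) ≠ i := by have := b.2; omega
    simp [this]

theorem tail_apply (n : ℕ) (v : ℕ →₀ K) (i : ℕ) : tail K n v i = v (i + n) := rfl

theorem sh_apply (n : ℕ) (v : ℕ →₀ K) (i : ℕ) : sh K n v (i + n) = v i :=
  Finsupp.mapDomain_apply (add_left_injective n) v i

theorem sh_apply_of_lt (n : ℕ) (v : ℕ →₀ K) {i : ℕ} (h : i < n) : sh K n v i = 0 := by
  refine Finsupp.mapDomain_of_notMem_range v i ?_
  rintro ⟨j, rfl⟩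
  simp at h

theorem win_add_sh_tail (n : ℕ) (v : ℕ →₀ K) : win K n v + sh K n (tail K n v) = v := by
  ext i
  rw [Finsupp.add_apply, win_apply_apply]
  split_ifs with h
  · rw [sh_apply_of_lt n _ h, add_zero]
  · obtain ⟨j, rfl⟩ : ∃ j, i = j + n := ⟨i - n, by omega⟩
    rw [sh_apply, tail_apply, zero_add]

theorem tail_sh (n : ℕ) (v : ℕ →₀ K) : tail K n (sh K n v) = v := by
  ext i
  rw [tail_apply, sh_apply]

theorem win_sh (n : ℕ) (v : ℕ →₀ K) : win K n (sh K n v) = 0 := by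
  ext i
  rw [win_apply_apply]
  split_ifs with h
  · rw [sh_apply_of_lt n _ h, Finsupp.zero_apply]
  · rfl

theorem win_single {n b : ℕ} (h : b < n) :
    win K n (Finsupp.single b 1) = Finsupp.single b 1 := by
  ext i
  rw [win_apply_apply]
  split_ifs with h'
  · rfl
  · have : b ≠ i := by omega
    simp [this]

theorem tail_single {n b : ℕ} (h : b < n) : tail K n (Finsupp.single b 1) = 0 := by
  ext i
  have : b ≠ i + n := by omega
  rw [tail_apply]
  simp [this]

theorem win_winVec {n : ℕ} (o : Option (Fin n)) : win K n (winVec o) = winVec o := by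
  rcases o with _ | b
  · exact map_zero _
  · exact win_single b.2

theorem tail_winVec {n : ℕ} (o : Option (Fin n)) : tail K n (winVec o : ℕ →₀ K) = 0 := by
  rcases o with _ | b
  · exact map_zero _
  · exact tail_single b.2

open Classical in
/-- The arguments of a form with some arguments assigned. -/
noncomputable def joinVec {α : Type} (n : ℕ) (ν : α → Option (Fin n))
    (v : {i // ν i = none} → (ℕ →₀ K)) (i : α) : ℕ →₀ K :=
  if h : ν i = none then sh K n (v ⟨i, h⟩) else winVec (ν i)

end vectors

namespace Pt

/-- Omitting one of the forms of a point. -/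
noncomputable def drop (x : Pt K P) (l₀ : P.L) : Pt K (P.drop l₀) where
  form l := x.form l
  alt l := x.alt l

open Classical in
/-- Assigning basis vectors to some of the arguments. -/
noncomputable def shift (x : Pt K P) (l₀ : P.L) (n : ℕ) : Pt K (P.shift l₀ n) where
  form q := ((x.form q.1.1).domDomRestrict (fun i => q.1.2 i = none)
    (fun i => winVec (q.1.2 i))).compLinearMap fun _ => sh K n
  alt q v i j hij hc hv := by
    rw [MultilinearMap.compLinearMap_apply, MultilinearMap.domDomRestrict_apply]
    refine x.alt q.1.1 _ i j (fun h => hij (Subtype.ext h)) hc ?_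
    rw [dif_pos i.2, dif_pos j.2]
    exact congrArg _ hv

theorem shift_form (x : Pt K P) (l₀ : P.L) (n : ℕ) (q : (P.shift l₀ n).L)
    (v : (P.shift l₀ n).ι q → (ℕ →₀ K)) :
    (x.shift l₀ n).form q v = x.form q.1.1 (joinVec n q.1.2 v) := rfl

-- Each argument is the sum of its first `n` coordinates and its shifted tail; multilinear expansion
-- leaves values with some arguments fixed at basis vectors.
open Classical in
theorem form_eq_sum (x : Pt K P) (n : ℕ) (l : P.L) (v : P.ι l → (ℕ →₀ K)) :
    x.form l v = ∑ ν : P.ι l → Option (Fin n), (∏ i, ((ν i).elim 1 fun b => v i b)) *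
      x.form l (joinVec n ν fun i => tail K n (v i)) := by
  have h1 : v = fun i => ∑ o : Option (Fin n), (o.elim 1 fun b => v i b : K) •
      (o.elim (sh K n (tail K n (v i))) fun b => winVec (some b) : ℕ →₀ K) := by
    funext i
    rw [Fintype.sum_option]
    conv_lhs => rw [← win_add_sh_tail n (v i), win_apply]
    simp [winVec, add_comm]
  conv_lhs => rw [h1, MultilinearMap.map_sum]
  refine Finset.sum_congr rfl fun ν _ => ?_
  rw [MultilinearMap.map_smul_univ, smul_eq_mul]
  congr 2
  funext i
  rw [joinVec]
  by_cases h : ν i = none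
  · simp [h]
  · obtain ⟨b, hb⟩ := Option.ne_none_iff_exists'.1 h
    simp [hb]

end Pt

section step

variable {l₀ : P.L}

/-- Functions on a set of points that are polynomials in the coordinates of the shifted point. -/
noncomputable def shiftAlg (X : Set (Pt K P)) (l₀ : P.L) (n : ℕ) : Subalgebra K (X → K) :=
  (MvPolynomial.aeval fun (i : (P.shift l₀ n).Idx K) (x : X) => (x.1.shift l₀ n).val i).range

theorem aeval_pi_apply {T σ : Type*} (F : σ → T → K) (G : MvPolynomial σ K) (x : T) :
    MvPolynomial.aeval F G x = MvPolynomial.eval (fun i => F i x) G := by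
  induction G using MvPolynomial.induction_on with
  | C a => simp
  | add a b ha hb => simp [ha, hb]
  | mul_X a i ha => simp [ha]

theorem mem_shiftAlg {X : Set (Pt K P)} {n : ℕ} {u : X → K} :
    u ∈ shiftAlg X l₀ n ↔
      ∃ G : MvPolynomial ((P.shift l₀ n).Idx K) K, ∀ x : X, u x = (x.1.shift l₀ n).ev G := by
  rw [shiftAlg, AlgHom.mem_range]
  refine exists_congr fun G => ?_
  rw [funext_iff]
  refine forall_congr' fun x => ?_
  rw [aeval_pi_apply]
  exact eq_comm

/-- In the expansion, the only value that is not a coordinate of the shifted point is that of `l₀`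
with no argument fixed, and a vanishing tail kills it. -/
theorem form_mem_shiftAlg (X : Set (Pt K P)) (n : ℕ) (l : P.L) (v : P.ι l → (ℕ →₀ K))
    (h : l = l₀ → ∃ i, tail K n (v i) = 0) :
    (fun x : X => x.1.form l v) ∈ shiftAlg X l₀ n := by
  classical
  have h1 : (fun x : X => x.1.form l v) = ∑ ν : P.ι l → Option (Fin n),
      algebraMap K (X → K) (∏ i, ((ν i).elim 1 fun b => v i b)) *
      fun x : X => x.1.form l (joinVec n ν fun i => tail K n (v i)) := by
    funext x
    rw [Pt.form_eq_sum x.1 n l v, Finset.sum_apply]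
    rfl
  rw [h1]
  refine Subalgebra.sum_mem _ fun ν _ => Subalgebra.mul_mem _ (Subalgebra.algebraMap_mem _ _) ?_
  by_cases hν : l = l₀ ∧ ∀ i, ν i = none
  · obtain ⟨i, hi⟩ := h hν.1
    convert Subalgebra.zero_mem (shiftAlg X l₀ n) using 1
    funext x
    refine (x.1.form l).map_coord_zero i ?_
    rw [joinVec, dif_pos (hν.2 i), hi, map_zero]
  · rw [mem_shiftAlg]
    refine ⟨MvPolynomial.X ⟨⟨⟨l, ν⟩, hν⟩, fun i => tail K n (v i)⟩, fun x => ?_⟩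
    rw [Pt.ev, MvPolynomial.eval_X]
    rfl

/-- The normal words of arguments of the form `l₀`. -/
abbrev NormalWord (P : Sig κ) (l₀ : P.L) : Type := {w : P.ι l₀ → ℕ // IsNormal (P.c l₀) w}

/-- Polynomials in the coordinates of the form `l₀` at normal words, the coefficients of which
are polynomials in the coordinates of the other forms. -/
abbrev Nested (K : Type u) [Field K] (P : Sig κ) (l₀ : P.L) : Type u :=
  MvPolynomial (NormalWord P l₀) (MvPolynomial ((P.drop l₀).Idx K) K)

namespace Pt

/-- Evaluation of nested polynomials. -/
noncomputable def nev (x : Pt K P) (l₀ : P.L) : Nested K P l₀ →+* K :=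
  MvPolynomial.eval₂Hom (x.drop l₀).ev fun w => x.form l₀ (wordVec w.1)

theorem nev_C (x : Pt K P) (a) : x.nev l₀ (MvPolynomial.C a) = (x.drop l₀).ev a :=
  MvPolynomial.eval₂Hom_C _ _ _

theorem nev_X (x : Pt K P) (w) : x.nev l₀ (MvPolynomial.X w) = x.form l₀ (wordVec w.1) :=
  MvPolynomial.eval₂Hom_X' _ _ _

theorem ev_C (x : Pt K P) (a) : x.ev (MvPolynomial.C a) = a := MvPolynomial.eval_C _

theorem ev_X (x : Pt K P) (i) : x.ev (MvPolynomial.X i) = x.form i.1 i.2 := MvPolynomial.eval_X _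

theorem exists_nev_eq_form_wordVec (P : Sig κ) (l₀ : P.L) (w : P.ι l₀ → ℕ) :
    ∃ f : Nested K P l₀, ∀ x : Pt K P, x.nev l₀ f = x.form l₀ (wordVec w) := by
  by_cases hw : Function.Injective (fun i => (P.c l₀ i, w i))
  · obtain ⟨σ, hσ, hn⟩ := exists_isNormal_comp (P.c l₀) w hw
    obtain ⟨ε, hε⟩ := exists_form_comp_perm (K := K) P l₀ σ⁻¹ fun i => by
      simpa using (hσ (σ⁻¹ i)).symm
    refine ⟨MvPolynomial.C (MvPolynomial.C ε) * MvPolynomial.X ⟨_, hn⟩, fun x => ?_⟩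
    rw [map_mul, nev_C, ev_C, nev_X, ← hε]
    congr 1
    funext i
    simp [wordVec]
  · rw [Function.not_injective_iff] at hw
    obtain ⟨i, j, hij, hne⟩ := hw
    refine ⟨0, fun x => ?_⟩
    rw [map_zero]
    refine (x.alt l₀ _ i j hne (congrArg Prod.fst hij) ?_).symm
    rw [wordVec, wordVec, show w i = w j from congrArg Prod.snd hij]

theorem exists_nev_eq_form (P : Sig κ) (l₀ : P.L) (v : P.ι l₀ → (ℕ →₀ K)) :
    ∃ f : Nested K P l₀, ∀ x : Pt K P, x.nev l₀ f = x.form l₀ v := by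
  classical
  choose F hF using exists_nev_eq_form_wordVec (K := K) P l₀
  refine ⟨∑ r ∈ Fintype.piFinset fun i => (v i).support,
    MvPolynomial.C (MvPolynomial.C (∏ i, v i (r i))) * F r, fun x => ?_⟩
  have h1 : v = fun i => ∑ j ∈ (v i).support, v i j • Finsupp.single j (1 : K) := by
    funext i
    conv_lhs => rw [← Finsupp.sum_single (v i)]
    simp [Finsupp.sum]
  conv_rhs => rw [h1, MultilinearMap.map_sum_finset]
  rw [map_sum]
  refine Finset.sum_congr rfl fun r _ => ?_
  rw [map_mul, nev_C, ev_C, hF, MultilinearMap.map_smul_univ, smul_eq_mul]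
  rfl

/-- Multilinearity reduces the values of `l₀` to words in basis vectors, and alternation reduces
these to normal words, with coefficients independent of the point. -/
theorem exists_nev_eq (l₀ : P.L) (g : MvPolynomial (P.Idx K) K) :
    ∃ f : Nested K P l₀, ∀ x : Pt K P, x.nev l₀ f = x.ev g := by
  induction g using MvPolynomial.induction_on with
  | C a => exact ⟨MvPolynomial.C (MvPolynomial.C a), fun x => by rw [nev_C, ev_C, ev_C]⟩
  | add a b ha hb =>
    obtain ⟨f, hf⟩ := ha
    obtain ⟨g, hg⟩ := hb
    exact ⟨f + g, fun x => by rw [map_add, map_add, hf, hg]⟩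
  | mul_X a i ha =>
    obtain ⟨f, hf⟩ := ha
    obtain ⟨l, v⟩ := i
    by_cases hl : l = l₀
    · subst hl
      obtain ⟨g, hg⟩ := exists_nev_eq_form P l v
      exact ⟨f * g, fun x => by rw [map_mul, map_mul, hf, hg, ev_X]⟩
    · refine ⟨f * MvPolynomial.C (MvPolynomial.X ⟨⟨l, hl⟩, v⟩), fun x => ?_⟩
      rw [map_mul, map_mul, hf, nev_C, ev_X, ev_X]
      rfl

theorem exists_ev_eq_drop (l₀ : P.L) (a : MvPolynomial ((P.drop l₀).Idx K) K) :
    ∃ g : MvPolynomial (P.Idx K) K, ∀ x : Pt K P, x.ev g = (x.drop l₀).ev a := by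
  refine ⟨MvPolynomial.rename (fun i => ⟨i.1.1, i.2⟩) a, fun x => ?_⟩
  rw [ev, MvPolynomial.eval_rename]
  rfl

theorem exists_ev_eq_nev (l₀ : P.L) (f : Nested K P l₀) :
    ∃ g : MvPolynomial (P.Idx K) K, ∀ x : Pt K P, x.ev g = x.nev l₀ f := by
  induction f using MvPolynomial.induction_on with
  | C a =>
    obtain ⟨g, hg⟩ := exists_ev_eq_drop l₀ a
    exact ⟨g, fun x => by rw [nev_C, hg]⟩
  | add a b ha hb =>
    obtain ⟨f, hf⟩ := ha
    obtain ⟨g, hg⟩ := hb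
    exact ⟨f + g, fun x => by rw [map_add, map_add, hf, hg]⟩
  | mul_X a w ha =>
    obtain ⟨f, hf⟩ := ha
    exact ⟨f * MvPolynomial.X ⟨l₀, wordVec w.1⟩, fun x => by rw [map_mul, map_mul, hf, nev_X, ev_X]⟩

/-- A polynomial involves only finitely many basis vectors. -/
theorem exists_ev_comap_congr (g : MvPolynomial (P.Idx K) K) :
    ∃ n : ℕ, ∀ φ ψ : κ → (ℕ →₀ K) →ₗ[K] (ℕ →₀ K),
      (∀ c, ∀ b < n, φ c (Finsupp.single b 1) = ψ c (Finsupp.single b 1)) →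
        ∀ x : Pt K P, (x.comap φ).ev g = (x.comap ψ).ev g := by
  classical
  induction g using MvPolynomial.induction_on with
  | C a => exact ⟨0, fun φ ψ _ x => by rw [ev_C, ev_C]⟩
  | add a b ha hb =>
    obtain ⟨m, hm⟩ := ha
    obtain ⟨n, hn⟩ := hb
    refine ⟨max m n, fun φ ψ h x => ?_⟩
    rw [map_add, map_add, hm φ ψ (fun c b hb => h c b (lt_max_of_lt_left hb)),
      hn φ ψ (fun c b hb => h c b (lt_max_of_lt_right hb))]
  | mul_X a i ha =>
    obtain ⟨m, hm⟩ := ha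
    obtain ⟨l, v⟩ := i
    refine ⟨max m ((Finset.univ.sup fun i => (v i).support.sup id) + 1), fun φ ψ h x => ?_⟩
    rw [map_mul, map_mul, hm φ ψ (fun c b hb => h c b (lt_max_of_lt_left hb)), ev_X, ev_X,
      comap_form, comap_form]
    congr 2
    funext i
    change φ (P.c l i) (v i) = ψ (P.c l i) (v i)
    rw [← Finsupp.sum_single (v i), Finsupp.sum, map_sum, map_sum]
    refine Finset.sum_congr rfl fun b hb => ?_
    have h1 : b < max m ((Finset.univ.sup fun i => (v i).support.sup id) + 1) := by
      refine lt_max_of_lt_right (Nat.lt_succ_of_le ?_)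
      exact (Finset.le_sup (f := id) hb).trans
        (Finset.le_sup (f := fun i => (v i).support.sup id) (Finset.mem_univ i))
    rw [← mul_one (v i b), ← smul_eq_mul, ← Finsupp.smul_single, map_smul, map_smul, h _ b h1]

/-- Basis vectors with index below `n` have zero tail, and `l₀` has at least one argument, so every
variable that occurs survives the shift. -/
theorem nev_mem_shiftAlg (X : Set (Pt K P)) (n : ℕ) [Nonempty (P.ι l₀)] (g : Nested K P l₀)
    (hg : ∀ m ∈ g.support, ∀ w ∈ m.support, ∀ i, w.1 i < n) :
    (fun x : X => x.1.nev l₀ g) ∈ shiftAlg X l₀ n := by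
  have hcoef : ∀ a, (fun x : X => (x.1.drop l₀).ev a) ∈ shiftAlg X l₀ n := fun a => by
    induction a using MvPolynomial.induction_on with
    | C a =>
      simp only [ev_C]
      exact Subalgebra.algebraMap_mem (shiftAlg X l₀ n) a
    | add a b ha hb =>
      simp only [map_add]
      exact Subalgebra.add_mem _ ha hb
    | mul_X a i ha =>
      simp only [map_mul, ev_X]
      exact Subalgebra.mul_mem _ ha (form_mem_shiftAlg X n i.1.1 i.2 fun h => absurd h i.1.2)
  have h1 : (fun x : X => x.1.nev l₀ g) = ∑ m ∈ g.support, (fun x : X => (x.1.drop l₀).ev (g.coeff m)) *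
      ∏ w ∈ m.support, (fun x : X => x.1.form l₀ (wordVec w.1)) ^ m w := by
    funext x
    simp only [Finset.sum_apply, Pi.mul_apply, Finset.prod_apply, Pi.pow_apply]
    exact MvPolynomial.eval₂_eq _ _ _
  rw [h1]
  refine Subalgebra.sum_mem _ fun m hm => Subalgebra.mul_mem _ (hcoef _) ?_
  refine Subalgebra.prod_mem _ fun w hw => Subalgebra.pow_mem _ ?_ _
  refine form_mem_shiftAlg X n l₀ _ fun _ => ⟨Classical.arbitrary _, ?_⟩
  exact tail_single (hg m hm w hw _)

end Pt

end step

end SecantGrassmann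

/-! ### Eliminating a form by transvections -/

namespace SecantGrassmann

variable {K : Type u} [Field K] {κ : Type} {P : Sig κ} {l₀ : P.L}

section elimination

open Classical in
/-- Add to the basis vector of each coloured letter of the word `w` a multiple of a vector. -/
noncomputable def transvection (P : Sig κ) (l₀ : P.L) (w : P.ι l₀ → ℕ) (μ : P.ι l₀ → (ℕ →₀ K))
    (t : P.ι l₀ → K) (c : κ) : (ℕ →₀ K) →ₗ[K] (ℕ →₀ K) :=
  LinearMap.id + ∑ i, if P.c l₀ i = c then t i • (Finsupp.lapply (w i)).smulRight (μ i) else 0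

open Classical in
/-- The effect of a transvection on the arguments of the forms. -/
noncomputable def transvectionMove (w : P.ι l₀ → ℕ) (μ : P.ι l₀ → (ℕ →₀ K)) (l : P.L)
    (v : P.ι l → (ℕ →₀ K)) (i : P.ι l) (j : P.ι l₀) : ℕ →₀ K :=
  if P.c l₀ j = P.c l i then v i (w j) • μ j else 0

theorem transvection_apply (w : P.ι l₀ → ℕ) (μ : P.ι l₀ → (ℕ →₀ K)) (t : P.ι l₀ → K) (l : P.L)
    (v : P.ι l → (ℕ →₀ K)) (i : P.ι l) :
    transvection P l₀ w μ t (P.c l i) (v i) = v i + ∑ j, t j • transvectionMove w μ l v i j := by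
  rw [transvection, LinearMap.add_apply, LinearMap.sum_apply]
  congr 1
  refine Finset.sum_congr rfl fun j _ => ?_
  rw [transvectionMove]
  split_ifs <;> simp

theorem transvection_zero (w : P.ι l₀ → ℕ) (μ : P.ι l₀ → (ℕ →₀ K)) :
    transvection P l₀ w μ 0 = fun _ => LinearMap.id := by
  funext c
  simp [transvection]

open Classical in
/-- Coordinates after a transvection, as polynomials in its parameters. -/
noncomputable def movedCoord (X : Set (Pt K P)) (w : P.ι l₀ → ℕ) (μ : P.ι l₀ → (ℕ →₀ K)) (l : P.L)
    (v : P.ι l → (ℕ →₀ K)) : MvPolynomial (P.ι l₀) (X → K) :=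
  movePoly (fun x : X => x.1.form l) v (transvectionMove w μ l v)

theorem eval_movedCoord (X : Set (Pt K P)) (w : P.ι l₀ → ℕ) (μ : P.ι l₀ → (ℕ →₀ K)) (l : P.L)
    (v : P.ι l → (ℕ →₀ K)) (x : X) (t : P.ι l₀ → K) :
    MvPolynomial.eval t (MvPolynomial.map (Pi.evalRingHom (fun _ => K) x) (movedCoord X w μ l v)) =
      (x.1.comap (transvection P l₀ w μ t)).form l v := by
  classical
  rw [movedCoord, eval_movePoly, Pt.comap_form]
  congr 1
  funext i
  rw [transvection_apply]

/-- The coefficients of nested polynomials after a transvection, as polynomials in its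
parameters. -/
noncomputable def movedCoef (X : Set (Pt K P)) (w : P.ι l₀ → ℕ) (μ : P.ι l₀ → (ℕ →₀ K)) :
    MvPolynomial ((P.drop l₀).Idx K) K →+* MvPolynomial (P.ι l₀) (X → K) :=
  MvPolynomial.eval₂Hom (MvPolynomial.C.comp (algebraMap K (X → K)))
    fun i => movedCoord X w μ i.1.1 i.2

theorem movedCoef_mem_coeffIn (X : Set (Pt K P)) (w : P.ι l₀ → ℕ) (μ : P.ι l₀ → (ℕ →₀ K)) (n : ℕ)
    (a : MvPolynomial ((P.drop l₀).Idx K) K) :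
    movedCoef X w μ a ∈ coeffIn (P.ι l₀) (shiftAlg X l₀ n) := by
  induction a using MvPolynomial.induction_on with
  | C a =>
    simp only [movedCoef, MvPolynomial.coe_eval₂Hom, MvPolynomial.eval₂_C, RingHom.comp_apply]
    exact C_mem_coeffIn (Subalgebra.algebraMap_mem _ a)
  | add a b ha hb =>
    rw [map_add]
    exact Subring.add_mem _ ha hb
  | mul_X a i ha =>
    rw [map_mul]
    refine Subring.mul_mem _ ha ?_
    rw [movedCoef, MvPolynomial.eval₂Hom_X']
    classical
    refine movePoly_mem_coeffIn _ _ _ _ fun r => ?_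
    exact form_mem_shiftAlg X n _ _ fun h => absurd h i.1.2

/-- Nested polynomials after a transvection, as polynomials in its parameters. -/
noncomputable def movedNested (X : Set (Pt K P)) (w : P.ι l₀ → ℕ) (μ : P.ι l₀ → (ℕ →₀ K)) :
    Nested K P l₀ →+* MvPolynomial (P.ι l₀) (X → K) :=
  MvPolynomial.eval₂Hom (movedCoef X w μ) fun w' => movedCoord X w μ l₀ (wordVec w'.1)

theorem movedNested_apply (X : Set (Pt K P)) (w : P.ι l₀ → ℕ) (μ : P.ι l₀ → (ℕ →₀ K))
    (f : Nested K P l₀) : movedNested X w μ f = MvPolynomial.eval₂ (movedCoef X w μ)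
      (fun w' => movedCoord X w μ l₀ (wordVec w'.1)) f := rfl

theorem eval_movedNested (X : Set (Pt K P)) (w : P.ι l₀ → ℕ) (μ : P.ι l₀ → (ℕ →₀ K))
    (f : Nested K P l₀) (x : X) (t : P.ι l₀ → K) :
    MvPolynomial.eval t (MvPolynomial.map (Pi.evalRingHom (fun _ => K) x) (movedNested X w μ f)) =
      (x.1.comap (transvection P l₀ w μ t)).nev l₀ f := by
  have h : ((MvPolynomial.eval t).comp (MvPolynomial.map (Pi.evalRingHom (fun _ => K) x))).comp
      (movedNested X w μ) = (x.1.comap (transvection P l₀ w μ t)).nev l₀ := by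
    refine MvPolynomial.ringHom_ext' ?_ fun w' => ?_
    · refine MvPolynomial.ringHom_ext' ?_ fun i => ?_
      · ext a
        simp [movedNested, movedCoef, Pt.nev_C, Pt.ev_C]
      · simp only [RingHom.comp_apply, movedNested, movedCoef, MvPolynomial.coe_eval₂Hom,
          MvPolynomial.eval₂_C, MvPolynomial.eval₂_X, Pt.nev_C, Pt.ev_X, eval_movedCoord]
        rfl
    · simp only [RingHom.comp_apply, movedNested, MvPolynomial.coe_eval₂Hom,
          MvPolynomial.eval₂_X, Pt.nev_X, eval_movedCoord]
  exact DFunLike.congr_fun h f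

theorem coeff_zero_apply {ι T : Type*} (Q : MvPolynomial ι (T → K)) (x : T) :
    Q.coeff 0 x =
      MvPolynomial.eval 0 (MvPolynomial.map (Pi.evalRingHom (fun _ => K) x) Q) := by
  rw [show MvPolynomial.eval (0 : ι → K) = MvPolynomial.constantCoeff from by ext i <;> simp,
    MvPolynomial.constantCoeff_map, MvPolynomial.constantCoeff_eq]
  rfl

theorem coeff_zero_movedNested (X : Set (Pt K P)) (w : P.ι l₀ → ℕ) (μ : P.ι l₀ → (ℕ →₀ K))
    (f : Nested K P l₀) (x : X) : (movedNested X w μ f).coeff 0 x = x.1.nev l₀ f := by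
  rw [coeff_zero_apply, eval_movedNested, transvection_zero, Pt.comap_id]

theorem prod_X_eq_monomial {ι R : Type*} [Fintype ι] [CommRing R] :
    (∏ k, MvPolynomial.X k : MvPolynomial ι R) =
      MvPolynomial.monomial (Finsupp.equivFunOnFinite.symm fun _ => 1) 1 := by
  rw [MvPolynomial.monomial_eq, Finsupp.prod_fintype _ _ (fun _ => pow_zero _)]
  simp

/-- An argument with nonzero tail must have been moved, and the transvection moves only the coloured
letters of `y₀`. If all arguments are moved, `w` and `y₀` have the same coloured letters, so they
coincide by normality, and injectivity forces each position to use its own parameter. -/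
theorem exists_tail_moveVec_eq_zero {n : ℕ} (y₀ w : NormalWord P l₀) (hw : ∀ i, w.1 i < n)
    (μ : P.ι l₀ → (ℕ →₀ K)) (r : P.ι l₀ → Option (P.ι l₀)) (hr : w = y₀ → r ≠ fun i => some i) :
    ∃ i, tail K n (moveVec (wordVec w.1) (transvectionMove y₀.1 μ l₀ (wordVec w.1)) r i) = 0 := by
  by_contra hcon
  push Not at hcon
  have h1 : ∀ i, ∃ j, r i = some j ∧ P.c l₀ j = P.c l₀ i ∧ w.1 i = y₀.1 j := by
    intro i
    have hi := hcon i
    rw [moveVec] at hi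
    rcases hri : r i with _ | j
    · rw [hri] at hi
      exact absurd (tail_single (hw i)) hi
    · rw [hri] at hi
      simp only [Option.elim_some, transvectionMove, wordVec] at hi
      refine ⟨j, rfl, ?_⟩
      by_contra hj
      apply hi
      split_ifs with hc
      · have : w.1 i ≠ y₀.1 j := fun h => hj ⟨hc, h⟩
        simp [this]
      · exact map_zero _
  choose τ hτ using h1
  have hcol : ∀ i, (P.c l₀ i, w.1 i) = (P.c l₀ (τ i), y₀.1 (τ i)) := fun i =>
    Prod.ext (hτ i).2.1.symm (hτ i).2.2
  have hτi : Function.Injective τ := fun i j hij => w.2.1 (by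
    simp only
    rw [hcol i, hcol j, hij])
  have hτs := Finite.surjective_of_injective hτi
  have hwy : w = y₀ := by
    refine Subtype.ext (w.2.eq_of_range y₀.2 ?_)
    ext z
    constructor
    · rintro ⟨i, rfl⟩
      exact ⟨τ i, (hcol i).symm⟩
    · rintro ⟨i, rfl⟩
      obtain ⟨j, rfl⟩ := hτs i
      exact ⟨j, hcol j⟩
  refine hr hwy (funext fun i => ?_)
  rw [(hτ i).1]
  congr 1
  refine y₀.2.1 ?_
  simp only
  rw [← hcol i, hwy]

/-- The family is stable under transvections, so `f` vanishes identically in their parameters.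
Moving the letters of `y₀` towards `μ` makes the value at `μ` the coefficient of the product of all
parameters; everything else is visible after the shift. The coefficient of the `q`-th power of that
product is the required relation. -/
theorem nev_hasse_mul_form_pow_mem [Infinite K] [Nonempty (P.ι l₀)] (p e n : ℕ) [ExpChar K p]
    (X : ClosedFamily K P) (hX : X.carrier.Nonempty) (f : Nested K P l₀)
    (hf : ∀ x ∈ X.carrier, x.nev l₀ f = 0) (y₀ : NormalWord P l₀) (hy₀ : ∀ i, y₀.1 i < n)
    (hq : ∀ m ∈ f.support, p ^ e ∣ m y₀)
    (hn : ∀ m ∈ f.support, ∀ w ∈ m.support, ∀ i, w.1 i < n) (μ : P.ι l₀ → (ℕ →₀ K)) :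
    (fun x : X.carrier => x.1.nev l₀ (hasse f y₀ (p ^ e)) * x.1.form l₀ μ ^ p ^ e) ∈
      shiftAlg X.carrier l₀ n := by
  classical
  have : Nonempty X.carrier := hX.to_subtype
  have : ExpChar (X.carrier → K) p :=
    expChar_of_injective_algebraMap (algebraMap K (X.carrier → K)).injective p
  have hF0 : movedNested X.carrier y₀.1 μ f = 0 := by
    refine eq_zero_of_eval_map_eq_zero _ fun x t => ?_
    rw [eval_movedNested]
    exact hf _ (X.comap_mem _ _ x.2)
  have hμ : moveVec (wordVec y₀.1) (transvectionMove y₀.1 μ l₀ (wordVec y₀.1)) (fun i => some i) =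
      μ := by
    funext i
    simp [moveVec, transvectionMove, wordVec]
  obtain ⟨R₀, hR₀, hs₀⟩ : ∃ R₀ ∈ coeffIn (P.ι l₀) (shiftAlg X.carrier l₀ n),
      movedCoord X.carrier y₀.1 μ l₀ (wordVec y₀.1) = R₀ +
        MvPolynomial.monomial (Finsupp.equivFunOnFinite.symm fun _ => 1)
          (fun x : X.carrier => x.1.form l₀ μ) := by
    obtain ⟨R₀, hR₀, hs₀⟩ := movePoly_eq_add (fun x : X.carrier => x.1.form l₀) (wordVec y₀.1)
      (transvectionMove y₀.1 μ l₀ (wordVec y₀.1)) (shiftAlg X.carrier l₀ n) (fun i => some i)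
      prod_X_eq_monomial fun r hr => by
        refine form_mem_shiftAlg X.carrier n l₀ _ fun _ =>
          exists_tail_moveVec_eq_zero y₀ y₀ hy₀ μ r fun _ => hr
    rw [hμ] at hs₀
    exact ⟨R₀, hR₀, hs₀⟩
  have hs : ∀ m ∈ f.support, ∀ w ∈ m.support, w ≠ y₀ →
      movedCoord X.carrier y₀.1 μ l₀ (wordVec w.1) ∈
        coeffIn (P.ι l₀) (shiftAlg X.carrier l₀ n) := fun m hm w hw hne =>
    movePoly_mem_coeffIn _ _ _ _ fun r => form_mem_shiftAlg X.carrier n l₀ _ fun _ =>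
      exists_tail_moveVec_eq_zero y₀ w (hn m hm w hw) μ r fun h => absurd h hne
  have key := coeff_eval₂_sub_mem (ι := P.ι l₀) (σ := NormalWord P l₀)
    (A := MvPolynomial ((P.drop l₀).Idx K) K) (K := K) (R := X.carrier → K) p e
    (shiftAlg X.carrier l₀ n)
  replace key := key (movedCoef X.carrier y₀.1 μ) (movedCoef_mem_coeffIn X.carrier y₀.1 μ n)
  replace key := key (fun w' => movedCoord X.carrier y₀.1 μ l₀ (wordVec w'.1)) y₀ f
  replace key := key hs R₀ hR₀
  replace key := key _ hs₀ hq
  rw [← movedNested_apply, ← movedNested_apply, hF0, MvPolynomial.coeff_zero, zero_sub] at key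
  replace key := Subalgebra.neg_mem _ key
  rw [neg_neg] at key
  convert key using 1
  funext x
  rw [Pi.mul_apply, coeff_zero_movedNested]
  rfl

/-- All coordinates lie in `perfLoc`, hence all polynomials do. Where the Hasse derivative is
nonzero, the shifted point therefore decides whether `g` vanishes. -/
theorem exists_pow_mul_ev_pow_eq [Infinite K] [Nonempty (P.ι l₀)] (p e n : ℕ) [ExpChar K p]
    (X : ClosedFamily K P) (hX : X.carrier.Nonempty) (f : Nested K P l₀)
    (hf : ∀ x ∈ X.carrier, x.nev l₀ f = 0) (y₀ : NormalWord P l₀) (hy₀ : ∀ i, y₀.1 i < n)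
    (hq : ∀ m ∈ f.support, p ^ e ∣ m y₀)
    (hn : ∀ m ∈ f.support, ∀ w ∈ m.support, ∀ i, w.1 i < n)
    (hn' : ∀ m ∈ (hasse f y₀ (p ^ e)).support, ∀ w ∈ m.support, ∀ i, w.1 i < n)
    (g : MvPolynomial (P.Idx K) K) :
    ∃ (k e' : ℕ) (G : MvPolynomial ((P.shift l₀ n).Idx K) K), ∀ x ∈ X.carrier,
      x.nev l₀ (hasse f y₀ (p ^ e)) ^ k * x.ev g ^ p ^ e' = (x.shift l₀ n).ev G := by
  have : Nonempty X.carrier := hX.to_subtype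
  have : ExpChar (X.carrier → K) p :=
    expChar_of_injective_algebraMap (algebraMap K (X.carrier → K)).injective p
  have hh := Pt.nev_mem_shiftAlg X.carrier n _ hn'
  have hg : (fun x : X.carrier => x.1.ev g) ∈ perfLoc p (shiftAlg X.carrier l₀ n) _ hh := by
    induction g using MvPolynomial.induction_on with
    | C a =>
      simp only [Pt.ev_C]
      exact Subalgebra.algebraMap_mem _ a
    | add a b ha hb =>
      simp only [map_add]
      exact Subalgebra.add_mem _ ha hb
    | mul_X a i ha =>
      simp only [map_mul, Pt.ev_X]
      refine Subalgebra.mul_mem _ ha ?_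
      obtain ⟨l, v⟩ := i
      by_cases hl : l = l₀
      · subst hl
        exact mem_perfLoc_of_mul_pow_mem (e := e) (le_perfLoc
          (nev_hasse_mul_form_pow_mem p e n X hX f hf y₀ hy₀ hq hn v))
      · exact le_perfLoc (form_mem_shiftAlg X.carrier n l v fun h => absurd h hl)
  obtain ⟨k, e', hke⟩ := hg
  rw [mem_shiftAlg] at hke
  obtain ⟨G, hG⟩ := hke
  exact ⟨k, e', G, fun x hx => hG ⟨x, hx⟩⟩

end elimination

end SecantGrassmann

/-! ### The descending chain condition for closed families -/

namespace SecantGrassmann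

variable {K : Type u} [Field K] {κ : Type} {P : Sig κ}

namespace Pt

/-- Acting by `φ` on the basis vectors with index at least `n`. -/
noncomputable def extend (n : ℕ) (φ : κ → (ℕ →₀ K) →ₗ[K] (ℕ →₀ K)) (c : κ) :
    (ℕ →₀ K) →ₗ[K] (ℕ →₀ K) :=
  win K n + (sh K n).comp ((φ c).comp (tail K n))

theorem shift_comap (φ : κ → (ℕ →₀ K) →ₗ[K] (ℕ →₀ K)) (x : Pt K P) (l₀ : P.L) (n : ℕ) :
    (x.comap (extend n φ)).shift l₀ n = (x.shift l₀ n).comap φ := by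
  refine ext' fun q v => ?_
  rw [shift_form, comap_form, comap_form, shift_form]
  congr 1
  funext i
  rw [joinVec, joinVec]
  split_ifs with h
  · simp [extend, win_sh, tail_sh]
  · simp [extend, win_winVec, tail_winVec]

/-- Acting by `φ` on the first `n` basis vectors and undoing the shift on the others. -/
noncomputable def cover (n : ℕ) (φ : κ → (ℕ →₀ K) →ₗ[K] (ℕ →₀ K)) (c : κ) :
    (ℕ →₀ K) →ₗ[K] (ℕ →₀ K) :=
  (φ c).comp (win K n) + tail K n

/-- The shift lands in the part where `cover n φ` merely undoes it. So a point can be pulled back by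
`φ` on the first `n` basis vectors and still be recovered. -/
theorem comap_cover_comap_sh (n : ℕ) (φ : κ → (ℕ →₀ K) →ₗ[K] (ℕ →₀ K)) (x : Pt K P) :
    (x.comap (cover n φ)).comap (fun _ => sh K n) = x := by
  refine ext' fun l v => ?_
  rw [comap_form, comap_form]
  congr 1
  funext i
  simp [cover, win_sh, tail_sh]

theorem cover_single {n : ℕ} (φ : κ → (ℕ →₀ K) →ₗ[K] (ℕ →₀ K)) (c : κ) {b : ℕ} (hb : b < n) :
    cover n φ c (Finsupp.single b 1) = φ c (Finsupp.single b 1) := by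
  simp [cover, win_single hb, tail_single hb]

end Pt

namespace ClosedFamily

/-- The closure of the set of points of a family without the form `l₀`. -/
noncomputable def proj (X : ClosedFamily K P) (l₀ : P.L) : ClosedFamily K (P.drop l₀) :=
  closure ((fun x => x.drop l₀) '' X.carrier) (by
    rintro φ _ ⟨x, hx, rfl⟩
    exact ⟨x.comap φ, X.comap_mem φ x hx, rfl⟩)

/-- The closure of the set of shifted points of a family. -/
noncomputable def shiftProj (X : ClosedFamily K P) (l₀ : P.L) (n : ℕ) :
    ClosedFamily K (P.shift l₀ n) :=
  closure ((fun x => x.shift l₀ n) '' X.carrier) (by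
    rintro φ _ ⟨x, hx, rfl⟩
    exact ⟨x.comap (Pt.extend n φ), X.comap_mem _ x hx, Pt.shift_comap φ x l₀ n⟩)

theorem closure_mono {S T : Set (Pt K P)} {hS hT} (h : S ⊆ T) : closure S hS ≤ closure T hT :=
  closure_le (h.trans subset_closure)

theorem proj_mono {X Y : ClosedFamily K P} (h : X ≤ Y) (l₀ : P.L) : X.proj l₀ ≤ Y.proj l₀ :=
  closure_mono (Set.image_mono h)

theorem shiftProj_mono {X Y : ClosedFamily K P} (h : X ≤ Y) (l₀ : P.L) (n : ℕ) :
    X.shiftProj l₀ n ≤ Y.shiftProj l₀ n :=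
  closure_mono (Set.image_mono h)

theorem mem_proj {X : ClosedFamily K P} {x : Pt K P} (hx : x ∈ X.carrier) (l₀ : P.L) :
    x.drop l₀ ∈ (X.proj l₀).carrier := subset_closure ⟨x, hx, rfl⟩

theorem mem_shiftProj {X : ClosedFamily K P} {x : Pt K P} (hx : x ∈ X.carrier) (l₀ : P.L)
    (n : ℕ) : x.shift l₀ n ∈ (X.shiftProj l₀ n).carrier := subset_closure ⟨x, hx, rfl⟩

theorem ev_eq_zero_of_mem_proj {X : ClosedFamily K P} {l₀ : P.L} {y : Pt K (P.drop l₀)}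
    (hy : y ∈ (X.proj l₀).carrier) (a : MvPolynomial ((P.drop l₀).Idx K) K)
    (ha : ∀ x ∈ X.carrier, (x.drop l₀).ev a = 0) : y.ev a = 0 :=
  hy a (by rintro _ ⟨x, hx, rfl⟩; exact ha x hx)

theorem ev_eq_zero_of_mem_shiftProj {X : ClosedFamily K P} {l₀ : P.L} {n : ℕ}
    {y : Pt K (P.shift l₀ n)} (hy : y ∈ (X.shiftProj l₀ n).carrier)
    (G : MvPolynomial ((P.shift l₀ n).Idx K) K)
    (hG : ∀ x ∈ X.carrier, (x.shift l₀ n).ev G = 0) : y.ev G = 0 :=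
  hy G (by rintro _ ⟨x, hx, rfl⟩; exact hG x hx)

/-- If the families below `X` are determined by their intersections with `Y` and by their images
under a monotone map to a well-founded order, then `X` is accessible once `Y` is. -/
theorem acc_of_cut {α : Type*} [PartialOrder α] (hα : WellFounded ((· < ·) : α → α → Prop))
    (X : ClosedFamily K P) (c : ClosedFamily K P → ClosedFamily K P) (hc : Monotone c)
    (hX : Acc (· < ·) (c X)) (W : ClosedFamily K P → α) (hW : Monotone W)
    (hinj : ∀ Z₁ Z₂, Z₁ ≤ Z₂ → Z₂ ≤ X → c Z₁ = c Z₂ → W Z₁ = W Z₂ → Z₁ = Z₂) :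
    Acc (· < ·) X := by
  -- A proper step down either decreases the cut or keeps it and decreases the image, so the descent
  -- is lexicographic.
  have h1 : Acc (Prod.Lex (· < ·) (· < ·)) (c X, W X) :=
    Prod.lexAccessible hX (fun b => hα.apply b) _
  suffices H : ∀ q : ClosedFamily K P × α, Acc (Prod.Lex (· < ·) (· < ·)) q →
      ∀ Z ≤ X, q = (c Z, W Z) → Acc (· < ·) Z from H _ h1 X le_rfl rfl
  intro q hq
  induction hq with
  | intro q _ ih =>
    rintro Z hZ rfl
    refine ⟨Z, fun Z' hZ' => ih (c Z', W Z') ?_ Z' (hZ'.le.trans hZ) rfl⟩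
    rcases (hc hZ'.le).lt_or_eq with h | h
    · exact Prod.Lex.left _ _ h
    · rw [h]
      refine Prod.Lex.right _ ((hW hZ'.le).lt_of_ne fun h' => hZ'.ne ?_)
      exact hinj Z' Z hZ'.le hZ h h'

theorem cut_mono (g : MvPolynomial (P.Idx K) K) :
    Monotone fun X : ClosedFamily K P => X.cut g := fun _ _ h _ hx => ⟨h hx.1, hx.2⟩

theorem cut_le (X : ClosedFamily K P) (g : MvPolynomial (P.Idx K) K) : X.cut g ≤ X :=
  fun _ hx => hx.1

section step

variable {l₀ : P.L}

/-- Some nested polynomial of total degree `d` vanishes on `X` but has a coefficient that does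
not. -/
def HasRelation (X : ClosedFamily K P) (l₀ : P.L) (d : ℕ) : Prop :=
  ∃ f : Nested K P l₀, f.totalDegree = d ∧ (∀ x ∈ X.carrier, x.nev l₀ f = 0) ∧
    ∃ m, ∃ x ∈ X.carrier, (x.drop l₀).ev (f.coeff m) ≠ 0

/-- Terms whose coefficients vanish on all of `X` are deleted. Then any coefficient of a Hasse
derivative that comes from a surviving term can be controlled on `X`. -/
theorem HasRelation.exists_reduced {X : ClosedFamily K P} {d : ℕ} (h : X.HasRelation l₀ d) :
    ∃ f : Nested K P l₀, f.totalDegree ≤ d ∧ (∀ x ∈ X.carrier, x.nev l₀ f = 0) ∧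
      f.support.Nonempty ∧
      ∀ m ∈ f.support, ∃ x ∈ X.carrier, (x.drop l₀).ev (f.coeff m) ≠ 0 := by
  classical
  obtain ⟨f, hd, hf, m, hm⟩ := h
  let s := f.support.filter fun m => ∃ x ∈ X.carrier, (x.drop l₀).ev (f.coeff m) ≠ 0
  let g : Nested K P l₀ := ∑ m ∈ s, MvPolynomial.monomial m (f.coeff m)
  have hcoeff : ∀ m, g.coeff m = if m ∈ s then f.coeff m else 0 := fun m => by
    simp only [g, MvPolynomial.coeff_sum, MvPolynomial.coeff_monomial]
    simp
  have hsupp : ∀ m, m ∈ g.support ↔ m ∈ s := fun m => by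
    rw [MvPolynomial.mem_support_iff, hcoeff]
    constructor
    · intro h
      by_contra hcon
      simp [hcon] at h
    · intro h
      rw [if_pos h]
      exact MvPolynomial.mem_support_iff.1 (Finset.mem_filter.1 h).1
  refine ⟨g, ?_, fun x hx => ?_, ⟨m, (hsupp m).2 ?_⟩, fun m hm => ?_⟩
  · rw [← hd]
    refine Finset.sup_mono fun m hm => ?_
    exact (Finset.mem_filter.1 ((hsupp m).1 hm)).1
  · have h1 : x.nev l₀ f = x.nev l₀ g := by
      conv_lhs => rw [f.as_sum, map_sum]
      rw [map_sum]
      refine (Finset.sum_subset (Finset.filter_subset _ _) fun m hm hms => ?_).symm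
      have h2 : (x.drop l₀).ev (f.coeff m) = 0 := by
        by_contra hcon
        exact hms (Finset.mem_filter.2 ⟨hm, x, hx, hcon⟩)
      rw [Pt.nev, MvPolynomial.coe_eval₂Hom, MvPolynomial.eval₂_monomial, h2, zero_mul]
    rw [← h1, hf x hx]
  · refine Finset.mem_filter.2 ⟨MvPolynomial.mem_support_iff.2 fun h0 => ?_, hm⟩
    obtain ⟨x, _, hx⟩ := hm
    rw [h0, map_zero] at hx
    exact hx rfl
  · rw [hsupp] at hm
    rw [hcoeff, if_pos hm]
    exact (Finset.mem_filter.1 hm).2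

theorem exists_bound {α : Type} [Fintype α] {σ A : Type*} [CommRing A] (g : σ → α → ℕ)
    (f : MvPolynomial σ A) :
    ∃ n, ∀ m ∈ f.support, ∀ w ∈ m.support, ∀ i, g w i < n := by
  classical
  refine ⟨(f.vars.sup fun w => Finset.univ.sup fun i => g w i) + 1, fun m hm w hw i => ?_⟩
  refine Nat.lt_succ_of_le ?_
  refine (Finset.le_sup (f := fun i => g w i) (Finset.mem_univ i)).trans ?_
  exact Finset.le_sup (f := fun w => Finset.univ.sup fun i => g w i)
    ((MvPolynomial.mem_vars_iff_mem_support w).2 ⟨m, hm, hw⟩)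

/-- Cutting `X` by the Hasse derivative `h` of a relation either shrinks the projection or keeps it,
and in the second case `h` is a relation of smaller degree. Off the cut, `h` is nonzero on some
pull-back, and there the shifted points determine the family. So `acc_of_cut` applies. -/
theorem acc_of_hasRelation [Infinite K] [Nonempty (P.ι l₀)]
    (hshift : ∀ n, WellFounded
      ((· < ·) : ClosedFamily K (P.shift l₀ n) → ClosedFamily K (P.shift l₀ n) → Prop))
    (X₀ : ClosedFamily K (P.drop l₀))
    (hX₀ : ∀ Z : ClosedFamily K P, Z.proj l₀ < X₀ → Acc (· < ·) Z) (d : ℕ) :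
    ∀ X : ClosedFamily K P, X.proj l₀ = X₀ → X.HasRelation l₀ d → Acc (· < ·) X := by
  classical
  induction d using Nat.strong_induction_on with
  | _ d ih =>
    intro X hX hrel
    obtain ⟨f, hfd, hf0, ⟨m₀, hm₀⟩, hcoeff⟩ := hrel.exists_reduced
    obtain ⟨x₀, hx₀, -⟩ := hcoeff m₀ hm₀
    -- A relation without variables would be a coefficient vanishing on all of `X`, which the
    -- reduction excludes.
    obtain ⟨m₁, hm₁, y₀, hy₀⟩ : ∃ m ∈ f.support, ∃ y, m y ≠ 0 := by
      by_contra hcon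
      push Not at hcon
      have h0 : ∀ m ∈ f.support, m = 0 := fun m hm => Finsupp.ext (hcon m hm)
      have hC : f = MvPolynomial.C (f.coeff 0) := by
        rw [← MvPolynomial.totalDegree_eq_zero_iff_eq_C, MvPolynomial.totalDegree_eq_zero_iff]
        intro m hm x
        rw [h0 m hm, Finsupp.zero_apply]
      obtain ⟨x, hx, hne⟩ := hcoeff m₀ hm₀
      apply hne
      rw [h0 m₀ hm₀, ← Pt.nev_C, ← hC, hf0 x hx]
    obtain ⟨p, hp⟩ := ExpChar.exists K
    obtain ⟨e, hq, m, hm, hmy, hmk⟩ := exists_expChar_pow_dvd K p f.support (fun m => m y₀)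
      ⟨m₁, hm₁, hy₀⟩
    set h := hasse f y₀ (p ^ e) with hh
    have hd : 0 < f.totalDegree := by
      refine Nat.pos_of_ne_zero fun h0 => hy₀ ?_
      exact (MvPolynomial.totalDegree_eq_zero_iff _ f).1 h0 m₁ hm₁ y₀
    have hdeg : h.totalDegree < d :=
      (totalDegree_hasse_lt f y₀ (p ^ e) (pow_pos (expChar_pos K p) e) hq hd).trans_le hfd
    obtain ⟨g, hg⟩ := Pt.exists_ev_eq_nev l₀ h
    obtain ⟨n₁, hn₁⟩ := exists_bound (fun w : NormalWord P l₀ => w.1) f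
    obtain ⟨n₂, hn₂⟩ := exists_bound (fun w : NormalWord P l₀ => w.1) h
    obtain ⟨n₃, hn₃⟩ := Pt.exists_ev_comap_congr g
    -- `n` bounds the letters of `f` and `h` and the indices of the basis vectors that `g` sees.
    set n := max n₁ (max n₂ n₃) with hn
    have hkey := exists_pow_mul_ev_pow_eq p e n X ⟨x₀, hx₀⟩ f hf0 y₀
      (fun i => lt_max_of_lt_left (hn₁ m₁ hm₁ y₀ (Finsupp.mem_support_iff.2 hy₀) i)) hq
      (fun m hm w hw i => lt_max_of_lt_left (hn₁ m hm w hw i))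
      (fun m hm w hw i => lt_max_of_lt_right (lt_max_of_lt_left (hn₂ m hm w hw i)))
    refine acc_of_cut (hshift n) X (fun Z => Z.cut g) (cut_mono g) ?_
      (fun Z => Z.shiftProj l₀ n) (fun _ _ hle => shiftProj_mono hle l₀ n) ?_
    · rcases ((proj_mono (X.cut_le g) l₀).trans_eq hX).lt_or_eq with hlt | heq
      · exact hX₀ _ hlt
      · refine ih h.totalDegree hdeg _ heq ⟨h, rfl, fun x hx => ?_, m - Finsupp.single y₀ (p ^ e), ?_⟩
        · have := hx.2 (fun _ => LinearMap.id)
          rwa [Pt.comap_id, hg] at this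
        -- This coefficient of `h` is a nonzero scalar times a coefficient of `f` that does not
        -- vanish on `X`; the cut has the same projection, so it cannot vanish there.
        · by_contra hcon
          push Not at hcon
          obtain ⟨x, hx, hne⟩ := hcoeff m hm
          have hxm : x.drop l₀ ∈ ((X.cut g).proj l₀).carrier := by
            rw [heq, ← hX]
            exact mem_proj hx l₀
          have := ev_eq_zero_of_mem_proj hxm _ hcon
          rw [hh, coeff_hasse f y₀ (p ^ e) hq hm hmy, map_mul, map_natCast] at this
          exact (mul_ne_zero hmk hne) this
    · intro Z₁ Z₂ h12 h2X hcut hW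
      refine le_antisymm h12 fun x hx => ?_
      by_cases hxc : ∀ φ, (x.comap φ).ev g = 0
      · have : x ∈ (Z₂.cut g).carrier := ⟨hx, hxc⟩
        have hcut' : Z₁.cut g = Z₂.cut g := hcut
        rw [← hcut'] at this
        exact this.1
      · push Not at hxc
        obtain ⟨φ, hφ⟩ := hxc
        -- `cover n φ` agrees with `φ` on the basis vectors that `g` sees, so `h` is nonzero at this
        -- pull-back, and `x` can be recovered from it. It suffices to place the pull-back in `Z₁`.
        have hy : x.comap (Pt.cover n φ) ∈ Z₂.carrier := Z₂.comap_mem _ x hx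
        have hne : (x.comap (Pt.cover n φ)).nev l₀ h ≠ 0 := by
          rw [← hg, hn₃ (Pt.cover n φ) φ (fun c b hb => Pt.cover_single φ c
            (lt_max_of_lt_right (lt_max_of_lt_right hb)))]
          exact hφ
        have hy1 : x.comap (Pt.cover n φ) ∈ Z₁.carrier := by
          refine Z₁.closed _ fun g' hg' => ?_
          obtain ⟨k, e', G, hG⟩ := hkey g'
          -- `G` vanishes on the shifts of `Z₁` because `g'` vanishes on `Z₁`, hence on the closure
          -- shared with `Z₂`.
          have h1 : ((x.comap (Pt.cover n φ)).shift l₀ n).ev G = 0 := by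
            have h2 := mem_shiftProj hy l₀ n
            have hW' : Z₁.shiftProj l₀ n = Z₂.shiftProj l₀ n := hW
            rw [← hW'] at h2
            refine ev_eq_zero_of_mem_shiftProj h2 G fun z hz => ?_
            rw [← hG z (h2X (h12 hz)), hg' z hz,
              zero_pow (pow_pos (expChar_pos K p) e').ne', mul_zero]
          rw [← hG _ (h2X hy)] at h1
          rcases mul_eq_zero.1 h1 with h1 | h1
          · exact absurd h1 (pow_ne_zero k hne)
          · exact pow_eq_zero_iff (pow_pos (expChar_pos K p) e').ne' |>.1 h1
        have := Z₁.comap_mem (fun _ => sh K n) _ hy1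
        rwa [Pt.comap_cover_comap_sh] at this

/-- Take a polynomial vanishing on `Z` but not at some point of `X`. If all its coefficients
vanished on `Z`, they would vanish on the common projection, hence at that point. -/
theorem hasRelation_of_lt {X Z : ClosedFamily K P} (h : Z < X)
    (hproj : Z.proj l₀ = X.proj l₀) : ∃ d, Z.HasRelation l₀ d := by
  have h1 : ∃ x ∈ X.carrier, x ∉ Z.carrier := by
    by_contra hcon
    push Not at hcon
    exact h.not_ge hcon
  obtain ⟨x, hx, hxZ⟩ := h1
  have h2 : ∃ g : MvPolynomial (P.Idx K) K, (∀ y ∈ Z.carrier, y.ev g = 0) ∧ x.ev g ≠ 0 := by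
    by_contra hcon
    push Not at hcon
    exact hxZ (Z.closed x hcon)
  obtain ⟨g, hg, hgx⟩ := h2
  obtain ⟨f, hf⟩ := Pt.exists_nev_eq l₀ g
  refine ⟨f.totalDegree, f, rfl, fun y hy => by rw [hf, hg y hy], ?_⟩
  by_contra hcon
  push Not at hcon
  apply hgx
  rw [← hf, f.as_sum, map_sum]
  refine Finset.sum_eq_zero fun m _ => ?_
  have hxm : x.drop l₀ ∈ (Z.proj l₀).carrier := by
    rw [hproj]
    exact mem_proj hx l₀
  rw [Pt.nev, MvPolynomial.coe_eval₂Hom, MvPolynomial.eval₂_monomial,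
    ev_eq_zero_of_mem_proj hxm _ (hcon m), zero_mul]

theorem wellFounded_of_drop_of_shift [Infinite K] [Nonempty (P.ι l₀)]
    (hdrop : WellFounded
      ((· < ·) : ClosedFamily K (P.drop l₀) → ClosedFamily K (P.drop l₀) → Prop))
    (hshift : ∀ n, WellFounded
      ((· < ·) : ClosedFamily K (P.shift l₀ n) → ClosedFamily K (P.shift l₀ n) → Prop)) :
    WellFounded ((· < ·) : ClosedFamily K P → ClosedFamily K P → Prop) := by
  refine ⟨fun X => ?_⟩
  generalize hX₀ : X.proj l₀ = X₀
  induction X₀ using hdrop.induction generalizing X with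
  | _ X₀ ih =>
    refine ⟨X, fun Z hZ => ?_⟩
    rcases ((proj_mono hZ.le l₀).trans_eq hX₀).lt_or_eq with hlt | heq
    · exact ih _ hlt Z rfl
    · obtain ⟨d, hd⟩ := hasRelation_of_lt hZ (heq.trans hX₀.symm)
      exact acc_of_hasRelation hshift X₀ (fun Z' hZ' => ih _ hZ' Z' rfl) d Z heq hd

end step

open Classical in
/-- Closed families of tuples of multilinear forms satisfy the descending chain condition. -/
theorem wellFounded_lt [Infinite K] (P : Sig κ) :
    WellFounded ((· < ·) : ClosedFamily K P → ClosedFamily K P → Prop) := by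
  -- Induction on a bound `k` for the arities, then on the number `n` of forms of arity exactly `k`.
  suffices H : ∀ (k n : ℕ) (P : Sig κ), (∀ l, Fintype.card (P.ι l) ≤ k) →
      Fintype.card {l // Fintype.card (P.ι l) = k} = n →
      WellFounded ((· < ·) : ClosedFamily K P → ClosedFamily K P → Prop) from
    H (Finset.univ.sup fun l => Fintype.card (P.ι l)) _ P
      (fun l => Finset.le_sup (f := fun l => Fintype.card (P.ι l)) (Finset.mem_univ l)) rfl
  intro k
  induction k with
  | zero =>
    intro n P hP _
    exact wellFounded_of_isEmpty fun l => Fintype.card_eq_zero_iff.1 (Nat.le_zero.1 (hP l))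
  | succ k ihk =>
    intro n
    induction n with
    | zero =>
      intro P hP hn
      refine ihk _ P (fun l => ?_) rfl
      rw [Fintype.card_eq_zero_iff] at hn
      exact Nat.le_of_lt_succ ((hP l).lt_of_ne fun h => hn.false ⟨l, h⟩)
    | succ n ihn =>
      intro P hP hn
      obtain ⟨⟨l₀, hl₀⟩⟩ : Nonempty {l // Fintype.card (P.ι l) = k + 1} := by
        rw [← Fintype.card_pos_iff, hn]
        exact Nat.succ_pos n
      have : Nonempty (P.ι l₀) := by
        rw [← Fintype.card_pos_iff, hl₀]
        exact Nat.succ_pos k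
      have hcard : Fintype.card {l : {l // l ≠ l₀} // Fintype.card (P.ι l) = k + 1} = n := by
        have h1 : Fintype.card {l : {l // Fintype.card (P.ι l) = k + 1} // l ≠ ⟨l₀, hl₀⟩} = n := by
          rw [Fintype.card_subtype_compl, hn]
          simp
        rw [← h1]
        refine Fintype.card_congr ⟨fun l => ⟨⟨l.1.1, l.2⟩, fun h => l.1.2 (congrArg Subtype.val h)⟩,
          fun l => ⟨⟨l.1.1, fun h => l.2 (Subtype.ext h)⟩, l.1.2⟩, fun _ => rfl, fun _ => rfl⟩
      refine wellFounded_of_drop_of_shift (l₀ := l₀) (ihn _ (fun l => hP l.1) hcard) fun m => ?_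
      have hle : ∀ q : (P.shift l₀ m).L, Fintype.card ((P.shift l₀ m).ι q) ≤
          Fintype.card (P.ι q.1.1) := fun q =>
        Fintype.card_le_of_injective (fun i => i.1) Subtype.val_injective
      refine ihn _ (fun q => (hle q).trans (hP _)) ?_
      rw [← hcard]
      -- Fixing an argument lowers the arity, so the forms of top arity after the shift are the
      -- untouched ones other than `l₀`: one fewer than before.
      have hnone : ∀ q : (P.shift l₀ m).L, Fintype.card ((P.shift l₀ m).ι q) = k + 1 →
          ∀ i, q.1.2 i = none := by
        intro q hq
        by_contra hcon
        push Not at hcon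
        obtain ⟨i, hi⟩ := hcon
        have := Fintype.card_subtype_lt (p := fun i => q.1.2 i = none) hi
        have h2 := hP q.1.1
        have h3 : Fintype.card {i // q.1.2 i = none} = k + 1 := by rw [← hq]
        omega
      refine Fintype.card_congr ⟨fun q => ⟨⟨q.1.1.1, fun h => q.1.2 ⟨h, hnone q.1 q.2⟩⟩, ?_⟩,
        fun l => ⟨⟨⟨l.1.1, fun _ => none⟩, fun h => l.1.2 h.1⟩, ?_⟩, fun q => ?_, fun l => rfl⟩
      · exact le_antisymm (hP _) (q.2.symm.le.trans (hle q.1))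
      · exact (Fintype.card_congr (Equiv.subtypeUnivEquiv fun _ => rfl)).trans l.2
      · refine Subtype.ext (Subtype.ext (Sigma.ext rfl (heq_of_eq ?_)))
        exact (funext (hnone q.1 q.2)).symm

end ClosedFamily

end SecantGrassmann

/-! ### Pairing multivectors with covectors -/

namespace SecantGrassmann

open Module exteriorPower

section Pairing

variable {K : Type*} [Field K] {V W : Type*} [AddCommGroup V] [Module K V]
  [AddCommGroup W] [Module K W]

/-- The alternating form `(u₁, …, uₘ) ↦ ⟨ω, u₁ ∧ ⋯ ∧ uₘ⟩` of an `m`-vector `ω`. -/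
noncomputable def pairing {m : ℕ} : ⋀[K]^m V →ₗ[K] (Dual K V) [⋀^Fin m]→ₗ[K] K where
  toFun ω := ((pairingDual K V m).flip ω).compAlternatingMap (ιMulti K m)
  map_add' _ _ := by ext; simp
  map_smul' _ _ := by ext; simp

theorem pairing_ιMulti {m : ℕ} (v : Fin m → V) (u : Fin m → Dual K V) :
    pairing (ιMulti K m v) u = (Matrix.of fun i j => u j (v i)).det := by
  simp [pairing, pairingDual_ιMulti_ιMulti]

/-- `pairing`, with the covectors indexed by a type in bijection with `Fin m`. -/
noncomputable def pairingOn {ι : Type*} {m : ℕ} (e : Fin m ≃ ι) (ω : ⋀[K]^m V) :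
    (Dual K V) [⋀^ι]→ₗ[K] K :=
  (pairing ω).domDomCongr e

theorem pairingOn_apply {ι : Type*} {m : ℕ} (e : Fin m ≃ ι) (ω : ⋀[K]^m V)
    (u : ι → Dual K V) : pairingOn e ω u = pairing ω (u ∘ e) := rfl

theorem pairingOn_ιMulti {ι : Type*} [Fintype ι] [DecidableEq ι] {m : ℕ} (e : Fin m ≃ ι)
    (v : ι → V) (u : ι → Dual K V) :
    pairingOn e (ιMulti K m (v ∘ e)) u = (Matrix.of fun i j => u j (v i)).det := by
  rw [pairingOn_apply, pairing_ιMulti, ← Matrix.det_submatrix_equiv_self e]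
  rfl

/-- The scalar is the sign of the permutation between the two orderings. It frees later
constructions from tracking the order of factors. -/
theorem exists_ne_zero_comp_equiv {ι : Type*} {m : ℕ} (e e' : Fin m ≃ ι) :
    ∃ c : K, c ≠ 0 ∧ ∀ (M N : Type _) [AddCommGroup M] [Module K M] [AddCommGroup N] [Module K N]
      (g : M [⋀^Fin m]→ₗ[K] N) (v : ι → M), g (v ∘ e) = c • g (v ∘ e') := by
  classical
  refine ⟨((Equiv.Perm.sign (e.trans e'.symm) : ℤ) : K), ?_, fun M N _ _ _ _ g v => ?_⟩
  · rcases Int.units_eq_one_or (Equiv.Perm.sign (e.trans e'.symm)) with h | h <;> simp [h]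
  · have := g.map_perm (v ∘ e') (e.trans e'.symm)
    have h2 : (v ∘ e') ∘ (e.trans e'.symm) = v ∘ e := by ext; simp
    rw [h2] at this
    rw [this]
    rcases Int.units_eq_one_or (Equiv.Perm.sign (e.trans e'.symm)) with h | h <;> simp [h]

theorem pairing_map {m : ℕ} (φ : V →ₗ[K] W) (ω : ⋀[K]^m V) (u : Fin m → Dual K W) :
    pairing (exteriorPower.map m φ ω) u = pairing ω fun i => (u i).comp φ := by
  let ev (x : Fin m → Dual K W) : ((Dual K W) [⋀^Fin m]→ₗ[K] K) →ₗ[K] K :=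
    { toFun := fun g => g x, map_add' := fun _ _ => rfl, map_smul' := fun _ _ => rfl }
  let ev' (x : Fin m → Dual K V) : ((Dual K V) [⋀^Fin m]→ₗ[K] K) →ₗ[K] K :=
    { toFun := fun g => g x, map_add' := fun _ _ => rfl, map_smul' := fun _ _ => rfl }
  have h : (ev u ∘ₗ pairing) ∘ₗ exteriorPower.map m φ
      = ev' (fun i => (u i).comp φ) ∘ₗ pairing := by
    refine exteriorPower.linearMap_ext ?_
    ext v
    simp [ev, ev', pairing_ιMulti]
  exact LinearMap.congr_fun h ω

/-- Evaluation of `pairing` at a family of covectors, as a linear form on `m`-vectors. -/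
noncomputable def pairingForm {m : ℕ} (u : Fin m → Dual K V) : Dual K (⋀[K]^m V) where
  toFun ω := pairing ω u
  map_add' _ _ := by simp
  map_smul' _ _ := by simp

@[simp] theorem pairingForm_apply {m : ℕ} (u : Fin m → Dual K V) (ω : ⋀[K]^m V) :
    pairingForm u ω = pairing ω u := rfl

/-- The dual basis of the exterior power of a basis consists of such pairings, so polynomials on
multivectors are polynomials in the coordinates at words. -/
theorem dual_mem_span_pairingForm {Λ : Type*} [Finite Λ] {m : ℕ} (b : Basis Λ K V)
    (φ : Dual K (⋀[K]^m V)) :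
    φ ∈ Submodule.span K (Set.range fun w : Fin m → Λ => pairingForm fun i => b.coord (w i)) := by
  classical
  cases nonempty_fintype Λ
  let e := Fintype.equivFin Λ
  let : LinearOrder Λ := LinearOrder.lift' e e.injective
  let B := b.exteriorPower (n := m)
  have h : φ = ∑ s, φ (B s) • B.coord s := by
    refine B.ext fun s => ?_
    simp
  rw [h]
  refine Submodule.sum_mem _ fun s _ => Submodule.smul_mem _ _ (Submodule.subset_span ?_)
  refine ⟨(Set.powersetCard.ofFinEmbEquiv.symm s), ?_⟩
  rw [exteriorPower.basis_coord]
  ext ω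
  rfl

theorem eq_of_pairing_eq [FiniteDimensional K V] {m : ℕ} {ω ω' : ⋀[K]^m V}
    (h : ∀ u : Fin m → Dual K V, pairing ω u = pairing ω' u) : ω = ω' := by
  have hall : ∀ φ : Dual K (⋀[K]^m V), φ (ω - ω') = 0 := by
    intro φ
    refine Submodule.span_induction ?_ ?_ ?_ ?_
      (dual_mem_span_pairingForm (finBasis K V) φ)
    · rintro _ ⟨w, rfl⟩
      simp [h]
    · simp
    · intro x y _ _ hx hy
      simp [-map_sub, hx, hy]
    · intro a x _ hx
      simp [-map_sub, hx]
  exact sub_eq_zero.1 ((Module.forall_dual_apply_eq_zero_iff K _).1 hall)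

end Pairing

end SecantGrassmann

/-! ### Zariski closures, closures of bounded degree and secant varieties -/

namespace SecantGrassmann

open Module exteriorPower MvPolynomial

section Zariski

variable {K : Type*} [Field K] {V W : Type*} [AddCommGroup V] [Module K V]
  [AddCommGroup W] [Module K W]

/-- The pullback of a polynomial along a linear map. -/
noncomputable def pullback (L : V →ₗ[K] W) (f : MvPolynomial (Dual K W) K) :
    MvPolynomial (Dual K V) K :=
  rename (fun φ => φ.comp L) f

theorem polyEval_pullback (L : V →ₗ[K] W) (f : MvPolynomial (Dual K W) K) (x : V) :
    polyEval (pullback L f) x = polyEval f (L x) := by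
  simp [polyEval, pullback, eval_rename, Function.comp_def]

theorem totalDegree_pullback_le (L : V →ₗ[K] W) (f : MvPolynomial (Dual K W) K) :
    (pullback L f).totalDegree ≤ f.totalDegree :=
  totalDegree_rename_le _ _

theorem subset_zariskiClosure (S : Set V) : S ⊆ zariskiClosure K S :=
  fun _ hs _ hf => hf _ hs

theorem map_mem_zariskiClosure (L : V →ₗ[K] W) {S : Set V} {T : Set W}
    (h : ∀ s ∈ S, L s ∈ zariskiClosure K T) {x : V} (hx : x ∈ zariskiClosure K S) :
    L x ∈ zariskiClosure K T := by
  intro f hf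
  rw [← polyEval_pullback]
  refine hx _ fun s hs => ?_
  rw [polyEval_pullback]
  exact h s hs f hf

theorem zariskiClosure_idem (S : Set V) :
    zariskiClosure K (zariskiClosure K S) = zariskiClosure K S :=
  (subset_zariskiClosure _).antisymm'
    fun _ hx => map_mem_zariskiClosure LinearMap.id (fun _ hs => hs) hx

theorem map_mem_secantVariety (L : V →ₗ[K] W) {X : Set V} {Y : Set W}
    (h : ∀ x ∈ X, L x ∈ Y) (k : ℕ) :
    ∀ x ∈ secantVariety K X k, L x ∈ secantVariety K Y k := by
  induction k with
  | zero => exact h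
  | succ k ih =>
    intro z hz
    refine map_mem_zariskiClosure L ?_ hz
    rintro _ ⟨x, hx, y, hy, rfl⟩
    exact subset_zariskiClosure _ ⟨L x, ih x hx, L y, h y hy, map_add _ _ _⟩

/-- The common zero set of the polynomials of degree at most `d` vanishing on `X`. -/
def degreeClosure (K : Type*) {V : Type*} [Field K] [AddCommGroup V] [Module K V]
    (X : Set V) (d : ℕ) : Set V :=
  {w | ∀ f : MvPolynomial (Dual K V) K, f.totalDegree ≤ d → (∀ x ∈ X, polyEval f x = 0) →
    polyEval f w = 0}

theorem degreeClosure_antitone (X : Set V) : Antitone (degreeClosure K X) :=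
  fun _ _ h _ hw f hf => hw f (hf.trans h)

theorem map_mem_degreeClosure (L : V →ₗ[K] W) {X : Set V} {Y : Set W}
    (h : ∀ x ∈ X, L x ∈ Y) {d : ℕ} {x : V} (hx : x ∈ degreeClosure K X d) :
    L x ∈ degreeClosure K Y d := by
  intro f hf hf'
  rw [← polyEval_pullback]
  refine hx _ ((totalDegree_pullback_le L f).trans hf) fun s hs => ?_
  rw [polyEval_pullback]
  exact hf' _ (h s hs)

theorem mem_zariskiClosure_of_forall_degreeClosure {X : Set V} {w : V}
    (h : ∀ d, w ∈ degreeClosure K X d) : w ∈ zariskiClosure K X :=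
  fun f hf => h _ f le_rfl hf

theorem definedInDegreeLE_of_degreeClosure_subset {X : Set V} {d : ℕ}
    (h : degreeClosure K X d ⊆ X) : DefinedInDegreeLE K X d :=
  ⟨{f | f.totalDegree ≤ d ∧ ∀ x ∈ X, polyEval f x = 0}, fun _ hf => hf.1,
    Set.Subset.antisymm (fun x hx _ hf => hf.2 x hx) fun _ hw => h fun f hf hf' => hw f ⟨hf, hf'⟩⟩

end Zariski

section Translate

variable {K : Type*} [Field K] {V : Type*} [AddCommGroup V] [Module K V]

theorem exists_polyEval_add (f : MvPolynomial (Dual K V) K) (y : V) :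
    ∃ g : MvPolynomial (Dual K V) K, ∀ x, polyEval g x = polyEval f (x + y) := by
  refine ⟨aeval (fun φ => X φ + C (φ y)) f, fun x => ?_⟩
  rw [polyEval, polyEval, ← coe_aeval_eq_eval, ← coe_aeval_eq_eval]
  change (aeval _) (aeval _ f) = _
  rw [← AlgHom.comp_apply, comp_aeval]
  simp

/-- Sums of `k + 1` elements of `X`. -/
def iteratedSum {V : Type*} [AddCommGroup V] (X : Set V) : ℕ → Set V
  | 0 => X
  | k + 1 => {z | ∃ x ∈ iteratedSum X k, ∃ y ∈ X, z = x + y}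

/-- The iterated join closes at every stage. Translating `f` by the last summand carries vanishing
through each closure, so it can be tested on actual sums. -/
theorem polyEval_eq_zero_of_secantVariety (X : Set V) (k : ℕ)
    (f : MvPolynomial (Dual K V) K) (hf : ∀ x ∈ iteratedSum X k, polyEval f x = 0) :
    ∀ x ∈ secantVariety K X k, polyEval f x = 0 := by
  induction k generalizing f with
  | zero => exact hf
  | succ k ih =>
    intro z hz
    refine hz f ?_
    rintro _ ⟨x, hx, y, hy, rfl⟩
    obtain ⟨g, hg⟩ := exists_polyEval_add f y
    rw [← hg]
    refine ih g (fun x' hx' => ?_) x hx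
    rw [hg]
    exact hf _ ⟨x', hx', y, hy, rfl⟩

end Translate

/-! ### Wedging and contracting preserve pure tensors -/

section ConePreserving

variable {K : Type*} [Field K] {U V W : Type*} [AddCommGroup U] [Module K U]
  [AddCommGroup V] [Module K V] [AddCommGroup W] [Module K W]

/-- Linear maps between exterior powers that send pure tensors to pure tensors. -/
def ConePreserving {p q : ℕ} (L : ⋀[K]^p V →ₗ[K] ⋀[K]^q W) : Prop :=
  ∀ ω ∈ grassmannCone K V p, L ω ∈ grassmannCone K W q

theorem smul_mem_grassmannCone {p : ℕ} (c : K) {ω : ⋀[K]^p V} (h : ω ∈ grassmannCone K V p) :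
    c • ω ∈ grassmannCone K V p := by
  obtain ⟨c', v, rfl⟩ := h
  exact ⟨c * c', v, smul_smul _ _ _⟩

theorem conePreserving_of_ιMulti {p q : ℕ} {L : ⋀[K]^p V →ₗ[K] ⋀[K]^q W}
    (h : ∀ v, L (ιMulti K p v) ∈ grassmannCone K W q) : ConePreserving L := by
  rintro _ ⟨c, v, rfl⟩
  rw [map_smul]
  exact smul_mem_grassmannCone c (h v)

theorem ConePreserving.comp {p q r : ℕ} {L : ⋀[K]^q V →ₗ[K] ⋀[K]^r W}
    {L' : ⋀[K]^p U →ₗ[K] ⋀[K]^q V} (h : ConePreserving L) (h' : ConePreserving L') :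
    ConePreserving (L ∘ₗ L') :=
  fun ω hω => h _ (h' ω hω)

theorem ConePreserving.smul {p q : ℕ} {L : ⋀[K]^p V →ₗ[K] ⋀[K]^q W} (h : ConePreserving L)
    (c : K) : ConePreserving (c • L) :=
  fun ω hω => smul_mem_grassmannCone c (h ω hω)

theorem conePreserving_map (p : ℕ) (φ : V →ₗ[K] W) :
    ConePreserving (exteriorPower.map p φ) :=
  conePreserving_of_ιMulti fun v => ⟨1, φ ∘ v, by simp⟩

/-- Wedging with a vector on the left. -/
noncomputable def wedge (p : ℕ) (a : V) : ⋀[K]^p V →ₗ[K] ⋀[K]^(p + 1) V :=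
  alternatingMapLinearEquiv ((ιMulti K (p + 1)).curryLeft a)

theorem wedge_ιMulti (p : ℕ) (a : V) (v : Fin p → V) :
    wedge p a (ιMulti K p v) = ιMulti K (p + 1) (Matrix.vecCons a v) := by
  simp [wedge]

/-- Adjoining a new first element to `Fin m` and to the first summand. -/
def consEquiv {N p m : ℕ} (e : Fin m ≃ Fin N ⊕ Fin p) : Fin (m + 1) ≃ Fin (N + 1) ⊕ Fin p where
  toFun := Fin.cases (Sum.inl 0) fun i => (e i).map Fin.succ id
  invFun := Sum.elim (Fin.cases 0 fun i => (e.symm (Sum.inl i)).succ)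
    fun i => (e.symm (Sum.inr i)).succ
  left_inv i := by
    refine Fin.cases ?_ (fun i => ?_) i
    · simp
    · obtain ⟨j, rfl⟩ := e.symm.surjective i
      rcases j with j | j <;> simp
  right_inv j := by
    rcases j with j | j
    · refine Fin.cases ?_ (fun j => ?_) j <;> simp
    · simp

theorem exists_wedge (N : ℕ) : ∀ (p m : ℕ) (e : Fin m ≃ Fin N ⊕ Fin p) (a : Fin N → V),
    ∃ L : ⋀[K]^p V →ₗ[K] ⋀[K]^m V, ConePreserving L ∧
      ∀ v, L (ιMulti K p v) = ιMulti K m (Sum.elim a v ∘ e) := by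
  suffices H : ∀ (p m : ℕ) (_ : Fin m ≃ Fin N ⊕ Fin p) (a : Fin N → V),
      ∃ (L : ⋀[K]^p V →ₗ[K] ⋀[K]^m V) (e' : Fin m ≃ Fin N ⊕ Fin p),
        ∀ v, L (ιMulti K p v) = ιMulti K m (Sum.elim a v ∘ e') by
    intro p m e a
    obtain ⟨L, e', hL⟩ := H p m e a
    obtain ⟨c, -, hc⟩ := exists_ne_zero_comp_equiv (K := K) e e'
    have hL' : ∀ v, (c • L) (ιMulti K p v) = ιMulti K m (Sum.elim a v ∘ e) := by
      intro v
      rw [hc, LinearMap.smul_apply, hL]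
    exact ⟨c • L, conePreserving_of_ιMulti fun v => ⟨1, _, by rw [hL', one_smul]⟩, hL'⟩
  induction N with
  | zero =>
    intro p m e a
    have h : m = p := by simpa using Fintype.card_congr e
    subst h
    exact ⟨LinearMap.id, (Equiv.emptySum _ _).symm, fun v => rfl⟩
  | succ N ih =>
    intro p m e a
    have h : m = N + p + 1 := by have := Fintype.card_congr e; simp at this; omega
    subst h
    obtain ⟨L, e', hL⟩ := ih p (N + p) finSumFinEquiv.symm (Fin.tail a)
    refine ⟨wedge _ (a 0) ∘ₗ L, consEquiv e',
      fun v => ?_⟩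
    rw [LinearMap.comp_apply, hL, wedge_ιMulti]
    congr 1
    ext i
    refine Fin.cases ?_ (fun i => ?_) i
    · simp [consEquiv]
    · rcases h : e' i with j | j <;> simp [Fin.tail, consEquiv, h]

/-- Contraction with a covector. -/
noncomputable def contract (p : ℕ) (ξ : Dual K V) : ⋀[K]^(p + 1) V →ₗ[K] ⋀[K]^p V :=
  alternatingMapLinearEquiv (AlternatingMap.alternatizeUncurryFin (ξ.smulRight (ιMulti K p)))

theorem contract_ιMulti (p : ℕ) (ξ : Dual K V) (v : Fin (p + 1) → V) :
    contract p ξ (ιMulti K (p + 1) v)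
      = ∑ i : Fin (p + 1), (-1) ^ (i : ℕ) • ξ (v i) • ιMulti K p (i.removeNth v) := by
  simp [contract, AlternatingMap.alternatizeUncurryFin_apply]

/-- Laplace expansion of the determinant along the column of `ξ`. -/
theorem pairing_contract (p : ℕ) (ξ : Dual K V) (ω : ⋀[K]^(p + 1) V) (u : Fin p → Dual K V) :
    pairing (contract p ξ ω) u = pairing ω (Fin.cons ξ u) := by
  have h : pairingForm u ∘ₗ contract p ξ = pairingForm (Fin.cons ξ u) := by
    refine exteriorPower.linearMap_ext ?_
    ext v
    simp only [LinearMap.compAlternatingMap_apply, LinearMap.comp_apply, contract_ιMulti,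
      pairingForm_apply, pairing_ιMulti]
    rw [← pairingForm_apply, map_sum, Matrix.det_succ_column_zero]
    refine Finset.sum_congr rfl fun i _ => ?_
    have h2 : pairingForm u ((-1) ^ (i : ℕ) • ξ (v i) • ιMulti K p (i.removeNth v))
      = (-1) ^ (i : ℕ) * (ξ (v i) * pairing (ιMulti K p (i.removeNth v)) u) := by
      rcases Nat.even_or_odd (i : ℕ) with h | h <;> simp [h.neg_one_pow]
    rw [h2, pairing_ιMulti, ← mul_assoc]
    rfl
  exact LinearMap.congr_fun h ω

theorem map_add_smul_of_alternating {ι : Type*} [Finite ι] (g : V [⋀^ι]→ₗ[K] W) (v : ι → V)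
    (i₀ : ι) (c : ι → K) (hc : c i₀ = 0) : g (fun i => v i + c i • v i₀) = g v := by
  classical
  cases nonempty_fintype ι
  have := g.toMultilinearMap.map_add_univ v fun i => c i • v i₀
  refine this.trans ?_
  rw [Finset.sum_eq_single Finset.univ]
  · simp
  · intro s _ hs
    obtain ⟨j, hj⟩ : ∃ j, j ∉ s := by
      by_contra! h
      exact hs (Finset.eq_univ_iff_forall.2 h)
    by_cases hi : i₀ ∈ s
    · have hne : i₀ ≠ j := fun h => hj (h ▸ hi)
      have h1 : s.piecewise v (fun i => c i • v i₀)
          = Function.update (s.piecewise v fun i => c i • v i₀) j (c j • v i₀) := by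
        ext i
        by_cases h : i = j
        · subst h; simp [hj]
        · simp [h]
      change g _ = 0
      rw [h1, g.map_update_smul, g.map_eq_zero_of_eq _ _ hne, smul_zero]
      simp [hne, hi]
    · refine g.toMultilinearMap.map_coord_zero i₀ ?_
      simp [hi, hc]
  · simp

/-- If `ξ` is nonzero on some factor, multiples of that factor can be subtracted from the others so
that `ξ` kills them; a single term of the contraction remains. -/
theorem conePreserving_contract (p : ℕ) (ξ : Dual K V) : ConePreserving (contract p ξ) := by
  refine conePreserving_of_ιMulti fun v => ?_
  by_cases h : ∀ i, ξ (v i) = 0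
  · exact ⟨0, 0, by simp [contract_ιMulti, h]⟩
  push Not at h
  obtain ⟨i₀, hi₀⟩ := h
  let c : Fin (p + 1) → K := fun i => if i = i₀ then 0 else -(ξ (v i) / ξ (v i₀))
  have hc : c i₀ = 0 := by simp [c]
  have h1 := map_add_smul_of_alternating (ιMulti K (p + 1)) v i₀ c hc
  rw [← h1, contract_ιMulti, Finset.sum_eq_single i₀]
  · rcases Nat.even_or_odd (i₀ : ℕ) with h | h
    · exact ⟨ξ (v i₀), i₀.removeNth fun i => v i + c i • v i₀, by simp [h.neg_one_pow, hc]⟩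
    · refine ⟨-ξ (v i₀), i₀.removeNth fun i => v i + c i • v i₀, ?_⟩
      simp only [h.neg_one_pow, hc, zero_smul, add_zero, neg_smul, one_smul]
      exact (neg_smul _ _).symm
  · intro i _ hi
    have : ξ (v i + c i • v i₀) = 0 := by
      simp [c, hi, hi₀]
    rw [this, zero_smul, smul_zero]
  · simp

theorem exists_contract (N : ℕ) : ∀ (p m : ℕ) (e : Fin m ≃ Fin N ⊕ Fin p)
    (α : Fin N → Dual K V), ∃ L : ⋀[K]^m V →ₗ[K] ⋀[K]^p V, ConePreserving L ∧
      ∀ ω u, pairing (L ω) u = pairing ω (Sum.elim α u ∘ e) := by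
  suffices H : ∀ (p m : ℕ) (_ : Fin m ≃ Fin N ⊕ Fin p) (α : Fin N → Dual K V),
      ∃ (L : ⋀[K]^m V →ₗ[K] ⋀[K]^p V) (e' : Fin m ≃ Fin N ⊕ Fin p), ConePreserving L ∧
        ∀ ω u, pairing (L ω) u = pairing ω (Sum.elim α u ∘ e') by
    intro p m e α
    obtain ⟨L, e', hL, hL'⟩ := H p m e α
    obtain ⟨c, -, hc⟩ := exists_ne_zero_comp_equiv (K := K) e e'
    refine ⟨c • L, hL.smul c, fun ω u => ?_⟩
    rw [hc, LinearMap.smul_apply, map_smul, AlternatingMap.smul_apply, hL']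
  induction N with
  | zero =>
    intro p m e α
    have h : m = p := by simpa using Fintype.card_congr e
    subst h
    exact ⟨LinearMap.id, (Equiv.emptySum _ _).symm, fun _ h => h, fun ω u => rfl⟩
  | succ N ih =>
    intro p m e α
    have h : m = N + p + 1 := by have := Fintype.card_congr e; simp at this; omega
    subst h
    obtain ⟨L, e', hL, hL'⟩ := ih p (N + p) finSumFinEquiv.symm (Fin.tail α)
    refine ⟨L ∘ₗ contract _ (α 0), consEquiv e',
      hL.comp (conePreserving_contract _ _), fun ω u => ?_⟩
    rw [LinearMap.comp_apply, hL', pairing_contract]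
    congr 1
    ext i : 1
    refine Fin.cases ?_ (fun i => ?_) i
    · simp [consEquiv]
    · rcases h : e' i with j | j <;> simp [Fin.tail, consEquiv, h]

end ConePreserving

end SecantGrassmann

/-! ### Closedness of the cone and the rank bound for windows -/

namespace SecantGrassmann

open Module exteriorPower MvPolynomial

section Closed

variable {K : Type*} [Field K] {V : Type*} [AddCommGroup V] [Module K V]

/-- By Cramer's rule the matrix is a scalar times the adjugate of the matrix of `u` times the matrix
of `u'`. The resulting equations cut out the cone. -/
theorem det_pairing_update {p : ℕ} {ω : ⋀[K]^p V} (hω : ω ∈ grassmannCone K V p) (hp : p ≠ 0)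
    (u u' : Fin p → Dual K V) :
    (Matrix.of fun i j => pairing ω (Function.update u i (u' j))).det
      = pairing ω u ^ (p - 1) * pairing ω u' := by
  obtain ⟨c, v, rfl⟩ := hω
  let M : Matrix (Fin p) (Fin p) K := Matrix.of fun i j => u j (v i)
  let M' : Matrix (Fin p) (Fin p) K := Matrix.of fun i j => u' j (v i)
  have h : (Matrix.of fun i j => pairing (c • ιMulti K p v) (Function.update u i (u' j)))
      = c • (M.adjugate * M') := by
    ext i j
    rw [Matrix.smul_apply, Matrix.of_apply, map_smul, AlternatingMap.smul_apply, pairing_ιMulti]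
    congr 1
    have h1 : (M.adjugate * M') i j = M.cramer (fun r => M' r j) i := by
      rw [Matrix.cramer_eq_adjugate_mulVec]
      rfl
    rw [h1, Matrix.cramer_apply]
    congr 1
    ext r s
    by_cases hs : s = i
    · subst hs; simp [M']
    · simp [M, hs]
  rw [h, Matrix.det_smul, Matrix.det_mul, Matrix.det_adjugate]
  simp only [map_smul, AlternatingMap.smul_apply, pairing_ιMulti, Fintype.card_fin, smul_eq_mul]
  change c ^ p * (M.det ^ (p - 1) * M'.det) = (c * M.det) ^ (p - 1) * (c * M'.det)
  rw [mul_pow]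
  obtain ⟨p, rfl⟩ := Nat.exists_eq_succ_of_ne_zero hp
  simp only [Nat.succ_eq_add_one, Nat.add_sub_cancel]
  ring

/-- The equations of `det_pairing_update` persist on the closure. At a nonzero ω they exhibit it as
a multiple of the wedge of the vectors obtained by freeing one covector of `u` at a time. -/
theorem zariskiClosure_grassmannCone_subset [FiniteDimensional K V] (p : ℕ) :
    zariskiClosure K (grassmannCone K V p) ⊆ grassmannCone K V p := by
  intro ω hω
  rcases eq_or_ne p 0 with rfl | hp
  · refine ⟨zeroEquiv K V ω, 0, (zeroEquiv K V).injective ?_⟩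
    simp
  by_cases h0 : ω = 0
  · exact ⟨0, 0, by simp [h0]⟩
  obtain ⟨u, hu⟩ : ∃ u : Fin p → Dual K V, pairing ω u ≠ 0 := by
    by_contra! h
    exact h0 (eq_of_pairing_eq fun u => by simp [h])
  have key (u' : Fin p → Dual K V) :
      (Matrix.of fun i j => pairing ω (Function.update u i (u' j))).det
        = pairing ω u ^ (p - 1) * pairing ω u' := by
    let f : MvPolynomial (Dual K (⋀[K]^p V)) K :=
      (Matrix.of fun i j => (X (pairingForm (Function.update u i (u' j))) :
        MvPolynomial (Dual K (⋀[K]^p V)) K)).det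
      - X (pairingForm u) ^ (p - 1) * X (pairingForm u')
    have hf (η : ⋀[K]^p V) : polyEval f η
        = (Matrix.of fun i j => pairing η (Function.update u i (u' j))).det
          - pairing η u ^ (p - 1) * pairing η u' := by
      simp only [polyEval, f, map_sub, map_mul, map_pow, eval_X, pairingForm_apply]
      rw [RingHom.map_det]
      congr 2
      ext i j
      simp
    rw [← sub_eq_zero, ← hf]
    refine hω f fun η hη => ?_
    rw [hf, sub_eq_zero]
    exact det_pairing_update hη hp u u'
  -- The linear form that sends a covector to the value with the `i`-th entry of `u` replaced by it,
  -- viewed as a vector by reflexivity.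
  let w : Fin p → V := fun i =>
    (evalEquiv K V).symm ((pairing ω).toMultilinearMap.toLinearMap u i)
  have hw (φ : Dual K V) (i : Fin p) : φ (w i) = pairing ω (Function.update u i φ) := by
    simp [w]
  refine ⟨(pairing ω u ^ (p - 1))⁻¹, w, eq_of_pairing_eq fun u' => ?_⟩
  rw [map_smul, AlternatingMap.smul_apply, pairing_ιMulti]
  simp only [hw, key, smul_eq_mul]
  rw [inv_mul_cancel_left₀ (pow_ne_zero _ hu)]

theorem zariskiClosure_secantVariety_subset [FiniteDimensional K V] (p k : ℕ) :
    zariskiClosure K (secantVariety K (grassmannCone K V p) k)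
      ⊆ secantVariety K (grassmannCone K V p) k := by
  cases k with
  | zero => exact zariskiClosure_grassmannCone_subset p
  | succ k => exact (zariskiClosure_idem _).le

end Closed

section Rank

theorem rank_add_le {K : Type*} [Field K] {m n : Type*} [Fintype n] (A B : Matrix m n K) :
    (A + B).rank ≤ A.rank + B.rank := by
  rw [Matrix.rank, Matrix.rank, Matrix.rank, Matrix.mulVecLin_add]
  refine (Submodule.finrank_mono (LinearMap.range_add_le _ _)).trans ?_
  exact Submodule.finrank_add_le_finrank_add_finrank _ _

variable {K : Type*} [Field K] {V : Type*} [AddCommGroup V] [Module K V]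

/-- The values of an `(N + 2)`-vector at the covectors `α` completed by one of the `β` and one of
the `β'`. -/
noncomputable def windowValues {N m : ℕ} (ω : ⋀[K]^(N + 2) V) (α : Fin N → Dual K V)
    (β β' : Fin m → Dual K V) : Fin m × Fin m → K :=
  fun ij => pairingOn finSumFinEquiv.symm ω (Sum.elim α ![β ij.1, β' ij.2])

/-- Contracting with `α` leaves a pure 2-vector, whose values form a sum of two matrices of rank at
most one. -/
theorem rank_windowValues_le {N m : ℕ} {ω : ⋀[K]^(N + 2) V} (hω : ω ∈ grassmannCone K V (N + 2))
    (α : Fin N → Dual K V) (β β' : Fin m → Dual K V) :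
    (Matrix.of fun i j => windowValues ω α β β' (i, j)).rank ≤ 2 := by
  obtain ⟨L, hL, hL'⟩ := exists_contract N 2 (N + 2) finSumFinEquiv.symm α
  obtain ⟨c, v, hv⟩ := hL ω hω
  have h : (Matrix.of fun i j => windowValues ω α β β' (i, j))
      = Matrix.vecMulVec (fun i => c * β i (v 0)) (fun j => β' j (v 1))
        + Matrix.vecMulVec (fun i => -(c * β i (v 1))) (fun j => β' j (v 0)) := by
    ext i j
    simp only [windowValues, Matrix.of_apply]
    rw [pairingOn_apply, ← hL', hv, map_smul, AlternatingMap.smul_apply, pairing_ιMulti,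
      Matrix.det_fin_two]
    simp [Matrix.vecMulVec_apply]
    ring
  rw [h]
  exact (rank_add_le _ _).trans
    (add_le_add (Matrix.rank_vecMulVec_le _ _) (Matrix.rank_vecMulVec_le _ _))

theorem rank_windowValues_iteratedSum_le {N m k : ℕ} {ω : ⋀[K]^(N + 2) V}
    (hω : ω ∈ iteratedSum (grassmannCone K V (N + 2)) k)
    (α : Fin N → Dual K V) (β β' : Fin m → Dual K V) :
    (Matrix.of fun i j => windowValues ω α β β' (i, j)).rank ≤ 2 * k + 2 := by
  induction k generalizing ω with
  | zero => exact rank_windowValues_le hω α β β'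
  | succ k ih =>
    obtain ⟨x, hx, y, hy, rfl⟩ := hω
    have h : (Matrix.of fun i j => windowValues (x + y) α β β' (i, j))
        = (Matrix.of fun i j => windowValues x α β β' (i, j))
          + (Matrix.of fun i j => windowValues y α β β' (i, j)) := by
      ext i j
      simp [windowValues, pairingOn_apply]
    rw [h]
    have h1 := rank_add_le (Matrix.of fun i j => windowValues x α β β' (i, j))
      (Matrix.of fun i j => windowValues y α β β' (i, j))
    have h2 := ih hx
    have h3 := rank_windowValues_le hy α β β'
    omega

/-- The polynomial on `⋀^(N+2) V` obtained by evaluating `f` at the window values. -/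
noncomputable def windowPoly {N m : ℕ} (f : MvPolynomial (Fin m × Fin m) K)
    (α : Fin N → Dual K V) (β β' : Fin m → Dual K V) :
    MvPolynomial (Dual K (⋀[K]^(N + 2) V)) K :=
  rename (fun ij : Fin m × Fin m =>
    pairingForm (Sum.elim α ![β ij.1, β' ij.2] ∘ finSumFinEquiv.symm)) f

theorem polyEval_windowPoly {N m : ℕ} (f : MvPolynomial (Fin m × Fin m) K)
    (α : Fin N → Dual K V) (β β' : Fin m → Dual K V) (ω : ⋀[K]^(N + 2) V) :
    polyEval (windowPoly f α β β') ω = eval (windowValues ω α β β') f := by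
  rw [polyEval, windowPoly, eval_rename]
  rfl

/-- The `(N + 2)`-vectors all of whose window values are zeros of `f`. -/
def windowLocus {N m : ℕ} (f : MvPolynomial (Fin m × Fin m) K) : Set (⋀[K]^(N + 2) V) :=
  {ω | ∀ (α : Fin N → Dual K V) (β β' : Fin m → Dual K V), eval (windowValues ω α β β') f = 0}

/-- The generic determinant. -/
noncomputable def detPoly (K : Type*) [Field K] (m : ℕ) : MvPolynomial (Fin m × Fin m) K :=
  (Matrix.mvPolynomialX (Fin m) (Fin m) K).det

/-- The rank is at most 2k + 2 on sums of k + 1 pure tensors, so minors of size 2k + 3 vanish there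
and hence on the secant variety. -/
theorem degreeClosure_subset_windowLocus_detPoly {N k d : ℕ}
    (hd : (detPoly K (2 * k + 3)).totalDegree ≤ d) :
    degreeClosure K (secantVariety K (grassmannCone K V (N + 2)) k) d
      ⊆ windowLocus (detPoly K (2 * k + 3)) := by
  intro ω hω α β β'
  rw [← polyEval_windowPoly]
  refine hω _ ((totalDegree_rename_le _ _).trans hd)
    (polyEval_eq_zero_of_secantVariety _ _ _ fun x hx => ?_)
  rw [polyEval_windowPoly, detPoly, RingHom.map_det]
  by_contra hne
  have h1 : ((eval (windowValues x α β β')).mapMatrix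
      (Matrix.mvPolynomialX (Fin (2 * k + 3)) (Fin (2 * k + 3)) K))
      = Matrix.of fun i j => windowValues x α β β' (i, j) := by
    ext i j
    simp [Matrix.mvPolynomialX]
  rw [h1] at hne
  have h2 := Matrix.rank_of_isUnit _ ((Matrix.isUnit_iff_isUnit_det _).2 (isUnit_iff_ne_zero.2 hne))
  have h3 := rank_windowValues_iteratedSum_le hx α β β'
  rw [h2, Fintype.card_fin] at h3
  omega

end Rank

/-! ### Determinants with adjoined vectors and the exchange of frames -/

section BlockDet

variable {K : Type*} [Field K] {V W : Type*} [AddCommGroup V] [Module K V]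
  [AddCommGroup W] [Module K W]
variable {κ ι σ : Type*} [Fintype κ] [DecidableEq κ] [Fintype ι] [DecidableEq ι]
  [Fintype σ] [DecidableEq σ]

/-- The determinant of the values of the covectors `u` at the vectors `y`, alternating in `y`. -/
noncomputable def detForm (u : κ → Dual K V) : V [⋀^κ]→ₗ[K] K :=
  Matrix.detRowAlternating.compLinearMap (LinearMap.pi u)

/-- Fixing some of the arguments of an alternating map. -/
def restrictSum {m : ℕ} (e : Fin m ≃ κ) (g : V [⋀^(κ ⊕ ι)]→ₗ[K] K) (x : ι → V) :
    V [⋀^Fin m]→ₗ[K] K where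
  toFun v := g (Sum.elim (v ∘ e.symm) x)
  map_update_add' v i y z := by
    have h (y : V) : Sum.elim (Function.update v i y ∘ e.symm) x
        = Function.update (Sum.elim (v ∘ e.symm) x) (Sum.inl (e i)) y := by
      rw [Sum.update_elim_inl, Function.update_comp_equiv, Equiv.symm_symm]
    convert g.map_update_add (Sum.elim (v ∘ e.symm) x) (Sum.inl (e i)) y z <;>
    rw [← h]
  map_update_smul' v i c y := by
    have h (y : V) : Sum.elim (Function.update v i y ∘ e.symm) x
        = Function.update (Sum.elim (v ∘ e.symm) x) (Sum.inl (e i)) y := by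
      rw [Sum.update_elim_inl, Function.update_comp_equiv, Equiv.symm_symm]
    convert g.map_update_smul (Sum.elim (v ∘ e.symm) x) (Sum.inl (e i)) c y <;>
    rw [← h]
  map_eq_zero_of_eq' v i j h hij :=
    g.map_eq_zero_of_eq (i := Sum.inl (e i)) (j := Sum.inl (e j)) _ (by simpa using h)
      (by simpa using hij)

/-- The linear extension to `m`-vectors of the determinant of the covectors `u` at the
vectors `v` and `x`, as a function of `v`. -/
noncomputable def blockDet {m : ℕ} (e : Fin m ≃ κ) (x : ι → V) (u : κ ⊕ ι → Dual K V) :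
    Dual K (⋀[K]^m V) :=
  alternatingMapLinearEquiv (restrictSum e (detForm u) x)

theorem blockDet_ιMulti {m : ℕ} (e : Fin m ≃ κ) (x : ι → V) (u : κ ⊕ ι → Dual K V)
    (v : Fin m → V) : blockDet e x u (ιMulti K m v)
      = (Matrix.of fun i j => u j (Sum.elim (v ∘ e.symm) x i)).det := by
  rw [blockDet, alternatingMapLinearEquiv_apply_ιMulti]
  rfl

theorem eq_of_eq_on_ιMulti {m : ℕ} {f g : ⋀[K]^m V →ₗ[K] W}
    (h : ∀ v, f (ιMulti K m v) = g (ιMulti K m v)) : f = g :=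
  exteriorPower.linearMap_ext (by ext v; exact h v)

/-- Wedging with `a` and then contracting with `α` replaces a frame of length `N'` by one of length
`N` while preserving pure tensors. `E` lists the rows in the order used by the determinant. -/
theorem exists_exchange {N N' q : ℕ} (a : Fin N → V) (α : Fin N' → Dual K V) :
    ∃ L : ⋀[K]^(N' + q) V →ₗ[K] ⋀[K]^(N + q) V, ConePreserving L ∧
      ∀ ω (ζ : Fin N → Dual K V) (τ : Fin q → Dual K V),
        pairingOn finSumFinEquiv.symm (L ω) (Sum.elim ζ τ)
          = blockDet finSumFinEquiv.symm a (Sum.elim (Sum.elim α τ) ζ) ω := by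
  let E : Fin (N' + q + N) ≃ (Fin N' ⊕ Fin q) ⊕ Fin N :=
    finSumFinEquiv.symm.trans (Equiv.sumCongr finSumFinEquiv.symm (Equiv.refl _))
  let e₁ : Fin (N' + q + N) ≃ Fin N ⊕ Fin (N' + q) :=
    E.trans ((Equiv.sumComm _ _).trans (Equiv.sumCongr (Equiv.refl _) finSumFinEquiv))
  let e₂ : Fin (N' + q + N) ≃ Fin N' ⊕ Fin (N + q) :=
    E.trans ((Equiv.sumAssoc _ _ _).trans (Equiv.sumCongr (Equiv.refl _)
      ((Equiv.sumComm _ _).trans finSumFinEquiv)))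
  obtain ⟨A, hA, hA'⟩ := exists_wedge (K := K) N (N' + q) _ e₁ a
  obtain ⟨B, hB, hB'⟩ := exists_contract N' (N + q) _ e₂ α
  refine ⟨B ∘ₗ A, hB.comp hA, fun ω ζ τ => ?_⟩
  have h : pairingForm (Sum.elim ζ τ ∘ finSumFinEquiv.symm) ∘ₗ B ∘ₗ A
      = blockDet finSumFinEquiv.symm a (Sum.elim (Sum.elim α τ) ζ) := by
    refine eq_of_eq_on_ιMulti fun v => ?_
    simp only [LinearMap.comp_apply, pairingForm_apply]
    rw [hA', hB', blockDet_ιMulti, ← pairingOn_ιMulti E (Sum.elim (v ∘ finSumFinEquiv.symm.symm) a),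
      pairingOn_apply]
    congr 1
    · congr 1
      congr 1
      ext i
      simp only [e₁, Function.comp_apply, Equiv.trans_apply]
      rcases E i with (j | j) | j <;> simp
    · ext i : 1
      simp only [e₂, Function.comp_apply, Equiv.trans_apply]
      rcases E i with (j | j) | j <;> simp
  exact LinearMap.congr_fun h ω

/-- An adjoined vector dual, up to sign, to the covector at `s i` removes that covector, and `ζ i`
takes its place. So vector arguments encode which covectors are replaced. -/
theorem blockDet_eq_pairingOn_extend {m : ℕ} (e : Fin m ≃ κ) (x : ι → V) (u : κ → Dual K V)
    (ζ : ι → Dual K V) (s : ι → κ) (hs : Function.Injective s)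
    (hu : ∀ i j, u j (x i) = if j = s i then -1 else 0) (hζ : ∀ i j, ζ j (x i) = 0)
    (ω : ⋀[K]^m V) :
    blockDet e x (Sum.elim u ζ) ω = pairingOn e ω (Function.extend s ζ u) := by
  have h : blockDet e x (Sum.elim u ζ) = pairingForm (Function.extend s ζ u ∘ e) := by
    refine eq_of_eq_on_ιMulti fun v => ?_
    rw [blockDet_ιMulti, pairingForm_apply, ← pairingOn_apply]
    have hv : v = (v ∘ e.symm) ∘ e := by ext; simp
    rw [hv, pairingOn_ιMulti, ← hv]
    set y := v ∘ e.symm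
    let U : Matrix κ κ K := Matrix.of fun i j => u j (y i)
    let Z : Matrix κ ι K := Matrix.of fun i j => ζ j (y i)
    let F : Matrix ι κ K := Matrix.of fun i j => if j = s i then 1 else 0
    have hF : F * F.transpose = 1 := by
      ext i j
      simp [F, Matrix.mul_apply, Matrix.one_apply, hs.eq_iff, eq_comm]
    have h1 : (Matrix.of fun i j => (Sum.elim u ζ j) (Sum.elim y x i))
        = Matrix.fromBlocks U Z (-F) 0 := by
      ext i j
      rcases i with i | i <;> rcases j with j | j <;> simp [U, Z, F, hu, hζ]
      split_ifs <;> simp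
    -- Column operations of determinant one produce an identity block, whose Schur complement has
    -- the columns in the range of `s` replaced by those of `ζ`. The `-1` in `hu` makes this come
    -- out without signs.
    have h2 : Matrix.fromBlocks U Z (-F) 0 * Matrix.fromBlocks 1 0 F 1
          * Matrix.fromBlocks 1 (-F.transpose) 0 1
        = Matrix.fromBlocks (U + Z * F) (-(U * F.transpose)) (-F) 1 := by
      rw [Matrix.fromBlocks_multiply, Matrix.fromBlocks_multiply]
      congr 1 <;> simp [hF, Matrix.add_mul, Matrix.mul_assoc]
    have h3 := congrArg Matrix.det h2
    rw [Matrix.det_mul, Matrix.det_mul, Matrix.det_fromBlocks_zero₁₂,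
      Matrix.det_fromBlocks_zero₂₁, Matrix.det_fromBlocks_one₂₂] at h3
    simp only [Matrix.det_one, mul_one] at h3
    rw [h1, h3]
    congr 1
    ext i j
    by_cases hj : ∃ l, s l = j
    · obtain ⟨l, rfl⟩ := hj
      simp [U, Z, F, Matrix.mul_apply, hs.extend_apply, hs.eq_iff]
    · have hj' (l : ι) : j ≠ s l := fun h => hj ⟨l, h.symm⟩
      simp [U, Z, F, Matrix.mul_apply, Function.extend_apply' _ _ _ hj, hj']
  exact LinearMap.congr_fun h ω

theorem det_submatrix_of_unit_columns (M : Matrix (κ ⊕ ι) (κ ⊕ ι) K) (j : σ → ι)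
    (hj : Function.Injective j)
    (h0 : ∀ i l, l ∉ Set.range j → M i (Sum.inr l) = if i = Sum.inr l then 1 else 0) :
    M.det = (M.submatrix (Sum.map id j) (Sum.map id j)).det := by
  classical
  have hinj : Function.Injective (Sum.map id j : κ ⊕ σ → κ ⊕ ι) :=
    Function.injective_id.sumMap hj
  rw [Matrix.twoBlockTriangular_det' M (· ∈ Set.range (Sum.map id j : κ ⊕ σ → κ ⊕ ι))]
  · have h1 : M.toSquareBlockProp (fun i => ¬ i ∈ Set.range (Sum.map id j : κ ⊕ σ → κ ⊕ ι))
        = 1 := by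
      ext ⟨i, hi⟩ ⟨l, hl⟩
      rcases l with l | l
      · exact absurd ⟨Sum.inl l, rfl⟩ hl
      · simp only [Matrix.toSquareBlockProp, Matrix.toBlock_apply, Matrix.one_apply,
          Subtype.mk.injEq]
        refine h0 i l ?_
        rintro ⟨t, rfl⟩
        exact hl ⟨Sum.inr t, rfl⟩
    rw [h1, Matrix.det_one, mul_one]
    let S : Matrix _ _ K := M.toSquareBlockProp (· ∈ Set.range (Sum.map id j : κ ⊕ σ → κ ⊕ ι))
    let F : κ ⊕ σ ≃ {i // i ∈ Set.range (Sum.map id j : κ ⊕ σ → κ ⊕ ι)} := Equiv.ofInjective _ hinj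
    have h2 : M.submatrix (Sum.map id j) (Sum.map id j) = S.submatrix F F := by
      ext a b
      rfl
    rw [h2, Matrix.det_submatrix_equiv_self F S]
    convert rfl
  · intro i hi l hl
    rcases l with l | l
    · exact absurd ⟨Sum.inl l, rfl⟩ hl
    · rw [h0 i l]
      · rw [if_neg]
        rintro rfl
        exact hl hi
      · rintro ⟨t, rfl⟩
        exact hl ⟨Sum.inr t, rfl⟩

end BlockDet

end SecantGrassmann

/-! ### Stability of window loci under linear maps and exchange -/

namespace SecantGrassmann

open Module exteriorPower MvPolynomial

section WindowLocus

variable {K : Type*} [Field K] {V W : Type*} [AddCommGroup V] [Module K V]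
  [AddCommGroup W] [Module K W]
variable {κ ι : Type*} [Fintype κ] [DecidableEq κ] [Fintype ι] [DecidableEq ι]

/-- Schur complement: `R` corrects a covector by a combination of the `ζ` so that it kills the
adjoined vectors. The same `R` serves for all `u`, so windows go to windows. -/
theorem blockDet_eq_det_mul {m : ℕ} (e : Fin m ≃ κ) (x : ι → V) (ζ : ι → Dual K V)
    (hF : (Matrix.of fun i j => ζ j (x i)).det ≠ 0) :
    ∃ R : Dual K V → Dual K V, ∀ (u : κ → Dual K V) (ω : ⋀[K]^m V),
      blockDet e x (Sum.elim u ζ) ω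
        = (Matrix.of fun i j => ζ j (x i)).det * pairingOn e ω (R ∘ u) := by
  set F : Matrix ι ι K := Matrix.of fun i j => ζ j (x i) with hFdef
  refine ⟨fun φ => φ - ∑ k, (∑ i, F⁻¹ k i * φ (x i)) • ζ k, fun u ω => ?_⟩
  set R : Dual K V → Dual K V := fun φ => φ - ∑ k, (∑ i, F⁻¹ k i * φ (x i)) • ζ k
  have h : blockDet e x (Sum.elim u ζ) = F.det • pairingForm (R ∘ u ∘ e) := by
    refine eq_of_eq_on_ιMulti fun v => ?_
    rw [blockDet_ιMulti, LinearMap.smul_apply, pairingForm_apply, ← Function.comp_assoc,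
      ← pairingOn_apply]
    have hv : v = (v ∘ e.symm) ∘ e := by ext; simp
    rw [hv, pairingOn_ιMulti, ← hv]
    set y := v ∘ e.symm
    let := F.invertibleOfIsUnitDet (isUnit_iff_ne_zero.2 hF)
    have h1 : (Matrix.of fun i j => (Sum.elim u ζ j) (Sum.elim y x i))
        = Matrix.fromBlocks (Matrix.of fun i j => u j (y i)) (Matrix.of fun i j => ζ j (y i))
          (Matrix.of fun i j => u j (x i)) F := by
      ext i j
      rcases i with i | i <;> rcases j with j | j <;> simp [F]
    rw [h1, Matrix.det_fromBlocks₂₂, smul_eq_mul]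
    congr 2
    ext i j
    simp only [Matrix.sub_apply, Matrix.of_apply, Matrix.mul_apply, Matrix.invOf_eq_nonsing_inv,
      Function.comp_apply, R, LinearMap.sub_apply, LinearMap.sum_apply, LinearMap.smul_apply,
      smul_eq_mul, Finset.sum_mul]
    rw [Finset.sum_comm]
    congr 1
    refine Finset.sum_congr rfl fun a _ => Finset.sum_congr rfl fun b _ => ?_
    ring
  exact LinearMap.congr_fun h ω

theorem exists_polynomial_blockDet {m : ℕ} (e : Fin m ≃ κ) (x : ι → V)
    (u u' : κ ⊕ ι → Dual K V) (ω : ⋀[K]^m V) :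
    ∃ P : Polynomial K, ∀ t, P.eval t = blockDet e x (fun j => u j + t • u' j) ω := by
  have hω : ω ∈ Submodule.span K (Set.range (ιMulti K m)) := by
    rw [ιMulti_span]; trivial
  induction hω using Submodule.span_induction with
  | mem ω h =>
    obtain ⟨v, rfl⟩ := h
    refine ⟨(Matrix.of fun i j => (Polynomial.C (u j (Sum.elim (v ∘ e.symm) x i))
      + Polynomial.X * Polynomial.C (u' j (Sum.elim (v ∘ e.symm) x i)))).det, fun t => ?_⟩
    rw [blockDet_ιMulti, ← Polynomial.coe_evalRingHom, RingHom.map_det]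
    congr 1
    ext i j
    simp
    exact mul_comm _ _
  | zero => exact ⟨0, by simp⟩
  | add a b _ _ ha hb =>
    obtain ⟨P, hP⟩ := ha
    obtain ⟨Q, hQ⟩ := hb
    exact ⟨P + Q, fun t => by rw [Polynomial.eval_add, hP, hQ, map_add]⟩
  | smul c a _ ha =>
    obtain ⟨P, hP⟩ := ha
    exact ⟨Polynomial.C c * P, fun t => by
      rw [Polynomial.eval_mul, hP, Polynomial.eval_C, map_smul, smul_eq_mul]⟩

theorem map_mem_windowLocus {N m : ℕ} {f : MvPolynomial (Fin m × Fin m) K} (φ : V →ₗ[K] W)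
    {ω : ⋀[K]^(N + 2) V} (hω : ω ∈ windowLocus f) :
    exteriorPower.map (N + 2) φ ω ∈ windowLocus f := by
  intro α β β'
  rw [← hω (fun i => (α i).comp φ) (fun i => (β i).comp φ) (fun i => (β' i).comp φ)]
  congr 2
  ext ij
  rw [windowValues, windowValues, pairingOn_apply, pairingOn_apply, pairing_map]
  congr 1
  ext k : 1
  simp only [Function.comp_apply]
  rcases finSumFinEquiv.symm k with l | l
  · rfl
  · fin_cases l <;> rfl

/-- If the matrix of `ζ` on `a` is invertible, the Schur complement identifies the window values of
`L ω` with window values of ω. In general `ζ` is deformed along the dual family `ξ`. -/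
theorem exchange_mem_windowLocus [Infinite K] {N N' m : ℕ} {f : MvPolynomial (Fin m × Fin m) K}
    (a : Fin N → V) (α' : Fin N' → Dual K V) (ξ : Fin N → Dual K V)
    (hξ : ∀ i j, ξ j (a i) = if i = j then 1 else 0)
    (L : ⋀[K]^(N' + 2) V →ₗ[K] ⋀[K]^(N + 2) V)
    (hL : ∀ ω (ζ : Fin N → Dual K V) (τ : Fin 2 → Dual K V),
        pairingOn finSumFinEquiv.symm (L ω) (Sum.elim ζ τ)
          = blockDet finSumFinEquiv.symm a (Sum.elim (Sum.elim α' τ) ζ) ω)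
    {ω : ⋀[K]^(N' + 2) V} (hω : ω ∈ windowLocus f) : L ω ∈ windowLocus f := by
  intro ζ β β'
  let A : Matrix (Fin N) (Fin N) K := Matrix.of fun i j => ζ j (a i)
  have hpoly (ij : Fin m × Fin m) := exists_polynomial_blockDet finSumFinEquiv.symm a
    (Sum.elim (Sum.elim α' ![β ij.1, β' ij.2]) ζ) (Sum.elim (0 : Fin N' ⊕ Fin 2 → Dual K V) ξ) ω
  choose P hP using hpoly
  have hP' (t : K) (ij : Fin m × Fin m) : (P ij).eval t
      = windowValues (L ω) (fun i => ζ i + t • ξ i) β β' ij := by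
    rw [hP, windowValues, hL]
    congr 2
    ext j : 1
    rcases j with j | j
    · simp
    · simp
  let Q : Polynomial K := aeval P f
  have hQ (t : K) : Q.eval t = eval (windowValues (L ω) (fun i => ζ i + t • ξ i) β β') f := by
    have := congrArg (fun g => eval g f) (funext (hP' t))
    rw [← this, ← Polynomial.coe_evalRingHom]
    simp only [Q, aeval_def]
    rw [hom_eval₂]
    have hid : (Polynomial.evalRingHom t).comp (algebraMap K (Polynomial K)) = RingHom.id K := by
      ext; simp
    rw [hid]
    rfl
  have hdet (t : K) : (-A).charpoly.eval t = (Matrix.of fun i j => (ζ j + t • ξ j) (a i)).det := by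
    rw [Matrix.eval_charpoly]
    congr 1
    ext i j
    simp [A, hξ, Matrix.scalar_apply, Matrix.diagonal_apply, add_comm]
  -- The determinant along the deformation is a monic characteristic polynomial, so it can be
  -- cancelled and `Q` vanishes also at `t = 0`.
  have hzero : Q * (-A).charpoly = 0 := by
    refine Polynomial.funext fun t => ?_
    rw [Polynomial.eval_mul, Polynomial.eval_zero, mul_eq_zero, or_iff_not_imp_right, hdet, hQ]
    intro ht
    obtain ⟨R, hR⟩ := blockDet_eq_det_mul (finSumFinEquiv (m := N') (n := 2)).symm a
      (fun i => ζ i + t • ξ i) ht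
    set D := (Matrix.of fun i j => (ζ j + t • ξ j) (a i)).det
    -- The factor `D` common to all window values is absorbed into the first family of window
    -- covectors.
    rw [← hω (R ∘ α') (fun i => D • R (β i)) (R ∘ β')]
    congr 2
    ext ij
    rw [windowValues, windowValues, hL, hR]
    have h1 : (Sum.elim (R ∘ α') ![D • R (β ij.1), (R ∘ β') ij.2] : Fin N' ⊕ Fin 2 → Dual K V)
        = Function.update (R ∘ Sum.elim α' ![β ij.1, β' ij.2]) (Sum.inr 0)
          (D • R (β ij.1)) := by
      ext k : 1
      rcases k with k | k
      · simp
      · fin_cases k <;> simp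
    rw [h1, AlternatingMap.map_update_smul, smul_eq_mul]
    congr 2
    symm
    exact Function.update_eq_self (Sum.inr 0) (R ∘ Sum.elim α' ![β ij.1, β' ij.2])
  have h0 : Q = 0 := (mul_eq_zero.1 hzero).resolve_right (Matrix.charpoly_monic _).ne_zero
  have := hQ 0
  simpa [h0] using this.symm

end WindowLocus

section BlockDetMultilinear

variable {K : Type*} [Field K] {V : Type*} [AddCommGroup V] [Module K V]
variable {κ ι : Type*} [Fintype κ] [DecidableEq κ] [Fintype ι] [DecidableEq ι]
variable {m : ℕ} (e : Fin m ≃ κ) (ω : ⋀[K]^m V)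

theorem blockDet_update_row_add (x : ι → V) (u : κ ⊕ ι → Dual K V) (i : ι) (y z : V) :
    blockDet e (Function.update x i (y + z)) u ω
      = blockDet e (Function.update x i y) u ω + blockDet e (Function.update x i z) u ω := by
  have h : blockDet e (Function.update x i (y + z)) u
      = blockDet e (Function.update x i y) u + blockDet e (Function.update x i z) u := by
    refine eq_of_eq_on_ιMulti fun v => ?_
    simp only [LinearMap.add_apply, blockDet, alternatingMapLinearEquiv_apply_ιMulti]
    simp only [restrictSum, AlternatingMap.coe_mk, MultilinearMap.coe_mk, ← Sum.update_elim_inr]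
    exact (detForm u).map_update_add _ _ _ _
  rw [h]
  rfl

theorem blockDet_update_row_smul (x : ι → V) (u : κ ⊕ ι → Dual K V) (i : ι) (c : K) (y : V) :
    blockDet e (Function.update x i (c • y)) u ω = c * blockDet e (Function.update x i y) u ω := by
  have h : blockDet e (Function.update x i (c • y)) u
      = c • blockDet e (Function.update x i y) u := by
    refine eq_of_eq_on_ιMulti fun v => ?_
    simp only [LinearMap.smul_apply, blockDet, alternatingMapLinearEquiv_apply_ιMulti]
    simp only [restrictSum, AlternatingMap.coe_mk, MultilinearMap.coe_mk, ← Sum.update_elim_inr]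
    exact (detForm u).map_update_smul _ _ _ _
  rw [h]
  rfl

theorem blockDet_eq_zero_of_row_eq (x : ι → V) (u : κ ⊕ ι → Dual K V) {i j : ι} (hij : i ≠ j)
    (hx : x i = x j) : blockDet e x u ω = 0 := by
  have h : blockDet e x u = 0 := by
    refine eq_of_eq_on_ιMulti fun v => ?_
    rw [blockDet_ιMulti]
    exact Matrix.det_zero_of_row_eq (i := Sum.inr i) (j := Sum.inr j) (by simpa using hij)
      (by ext; simp [hx])
  rw [h]
  rfl

theorem blockDet_update_col_add (x : ι → V) (u : κ ⊕ ι → Dual K V) (j : κ ⊕ ι)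
    (φ ψ : Dual K V) :
    blockDet e x (Function.update u j (φ + ψ)) ω
      = blockDet e x (Function.update u j φ) ω + blockDet e x (Function.update u j ψ) ω := by
  have h : blockDet e x (Function.update u j (φ + ψ))
      = blockDet e x (Function.update u j φ) + blockDet e x (Function.update u j ψ) := by
    refine eq_of_eq_on_ιMulti fun v => ?_
    have h1 (φ : Dual K V) : (Matrix.of fun i l => Function.update u j φ l
          (Sum.elim (v ∘ e.symm) x i))
        = (Matrix.of fun i l => u l (Sum.elim (v ∘ e.symm) x i)).updateCol j
          fun i => φ (Sum.elim (v ∘ e.symm) x i) := by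
      ext i l
      by_cases hl : l = j
      · subst hl; simp
      · simp [hl]
    rw [LinearMap.add_apply, blockDet_ιMulti, blockDet_ιMulti, blockDet_ιMulti, h1, h1, h1,
      ← Matrix.det_updateCol_add]
    rfl
  rw [h]
  rfl

theorem blockDet_update_col_smul (x : ι → V) (u : κ ⊕ ι → Dual K V) (j : κ ⊕ ι) (c : K)
    (φ : Dual K V) :
    blockDet e x (Function.update u j (c • φ)) ω
      = c * blockDet e x (Function.update u j φ) ω := by
  have h : blockDet e x (Function.update u j (c • φ))
      = c • blockDet e x (Function.update u j φ) := by
    refine eq_of_eq_on_ιMulti fun v => ?_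
    have h1 (φ : Dual K V) : (Matrix.of fun i l => Function.update u j φ l
          (Sum.elim (v ∘ e.symm) x i))
        = (Matrix.of fun i l => u l (Sum.elim (v ∘ e.symm) x i)).updateCol j
          fun i => φ (Sum.elim (v ∘ e.symm) x i) := by
      ext i l
      by_cases hl : l = j
      · subst hl; simp
      · simp [hl]
    rw [LinearMap.smul_apply, blockDet_ιMulti, blockDet_ιMulti, h1, h1, smul_eq_mul,
      ← Matrix.det_updateCol_smul]
    rfl
  rw [h]
  rfl

theorem blockDet_eq_zero_of_col_eq (x : ι → V) (u : κ ⊕ ι → Dual K V) {i j : κ ⊕ ι} (hij : i ≠ j)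
    (hu : u i = u j) : blockDet e x u ω = 0 := by
  have h : blockDet e x u = 0 := by
    refine eq_of_eq_on_ιMulti fun v => ?_
    rw [blockDet_ιMulti]
    exact Matrix.det_zero_of_column_eq hij (by intro; simp [hu])
  rw [h]
  rfl

end BlockDetMultilinear

/-! ### Framed tensors and their determinantal forms -/

section Data

variable {K : Type u} [Field K] {m : ℕ}

/-- Labels of the determinantal forms: the number of vector arguments and, for each position,
a window covector or `none` for a covector argument. -/
abbrev FormLabel (m : ℕ) : Type := Σ s : Fin (2 * m + 1), Fin s ⊕ Fin 2 → Option (Fin m ⊕ Fin m)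

/-- The signature of the determinantal forms, with vector arguments (`false`) and covector
arguments (`true`). -/
abbrev formSig (m : ℕ) : Sig Bool where
  L := FormLabel m
  ι l := Fin l.1 ⊕ {k // l.2 k = none}
  c _ := Sum.elim (fun _ => false) fun _ => true

/-- An `(N + 2)`-vector with frame, window, and parametrized vectors and covectors. -/
structure FramedTensor (K : Type u) [Field K] (m : ℕ) where
  N : ℕ
  ι : Type
  ω : ⋀[K]^(N + 2) (ι → K)
  α : Fin N → Dual K (ι → K)
  β : Fin m ⊕ Fin m → Dual K (ι → K)
  γ : (ℕ →₀ K) →ₗ[K] Dual K (ι → K)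
  δ : (ℕ →₀ K) →ₗ[K] (ι → K)

namespace FramedTensor

/-- The covector at a position of a labelled form. -/
noncomputable def covec (D : FramedTensor K m) (l : FormLabel m)
    (v : (formSig m).ι l → (ℕ →₀ K)) (k : Fin l.1 ⊕ Fin 2) : Dual K (D.ι → K) :=
  -- The default `0` is never reached, since `none` is handled by the first branch.
  if h : l.2 k = none then D.γ (v (Sum.inr ⟨k, h⟩)) else (l.2 k).elim 0 D.β

/-- All the covectors of a labelled form. -/
noncomputable def cols (D : FramedTensor K m) (l : FormLabel m)
    (v : (formSig m).ι l → (ℕ →₀ K)) : (Fin D.N ⊕ Fin 2) ⊕ Fin l.1 → Dual K (D.ι → K) :=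
  Sum.elim (Sum.elim D.α fun k => D.covec l v (Sum.inr k)) fun k => D.covec l v (Sum.inl k)

/-- The column that carries the covector at a position. -/
def colPos {N s : ℕ} : Fin s ⊕ Fin 2 → (Fin N ⊕ Fin 2) ⊕ Fin s :=
  Sum.elim Sum.inr fun k => Sum.inl (Sum.inr k)

theorem colPos_injective {N s : ℕ} :
    Function.Injective (colPos : Fin s ⊕ Fin 2 → (Fin N ⊕ Fin 2) ⊕ Fin s) := by
  rintro (a | a) (b | b) h <;> simp_all [colPos]

theorem cols_colPos (D : FramedTensor K m) (l : FormLabel m)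
    (v : (formSig m).ι l → (ℕ →₀ K)) (k : Fin l.1 ⊕ Fin 2) :
    D.cols l v (colPos k) = D.covec l v k := by
  rcases k with k | k <;> rfl

theorem covec_update (D : FramedTensor K m) (l : FormLabel m) [DecidableEq ((formSig m).ι l)]
    (v : (formSig m).ι l → (ℕ →₀ K)) (k : {k // l.2 k = none}) (y : ℕ →₀ K) :
    D.covec l (Function.update v (Sum.inr k) y) = Function.update (D.covec l v) k.1 (D.γ y) := by
  ext j : 1
  by_cases hj : j = k.1
  · subst hj
    simp [covec, k.2]
  · have (h : l.2 j = none) : (⟨j, h⟩ : {k // l.2 k = none}) ≠ k := fun h' => hj (by rw [← h'])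
    rw [Function.update_of_ne hj, covec, covec]
    split_ifs with h
    · rw [Function.update_of_ne]
      simpa using this h
    · rfl

theorem cols_update (D : FramedTensor K m) (l : FormLabel m) [DecidableEq ((formSig m).ι l)]
    (v : (formSig m).ι l → (ℕ →₀ K)) (k : {k // l.2 k = none}) (y : ℕ →₀ K) :
    D.cols l (Function.update v (Sum.inr k) y)
      = Function.update (D.cols l v) (colPos k.1) (D.γ y) := by
  rw [cols, covec_update, cols]
  obtain ⟨k, hk⟩ := k
  ext j : 1
  rcases j with (j | j) | j <;> rcases k with k | k <;>
    simp [colPos, Function.update_apply]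

theorem cols_update_inl (D : FramedTensor K m) (l : FormLabel m) [DecidableEq ((formSig m).ι l)]
    (v : (formSig m).ι l → (ℕ →₀ K)) (i : Fin l.1) (y : ℕ →₀ K) :
    D.cols l (Function.update v (Sum.inl i) y) = D.cols l v := by
  have : D.covec l (Function.update v (Sum.inl i) y) = D.covec l v := by
    ext j : 1
    simp [covec]
  rw [cols, this, cols]

/-- The point whose coordinates are the determinantal forms of a framed tensor. -/
noncomputable def pt (D : FramedTensor K m) : Pt K (formSig m) where
  form l :=
    { toFun := fun v => blockDet finSumFinEquiv.symm (fun i => D.δ (v (Sum.inl i))) (D.cols l v) D.ω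
      map_update_add' := by
        intro _ v i y z
        rcases i with i | k
        · have hc (y : ℕ →₀ K) : D.cols l (Function.update v (Sum.inl i) y) = D.cols l v :=
            D.cols_update_inl l v i y
          have h (y : ℕ →₀ K) : (fun j => D.δ (Function.update v (Sum.inl i) y (Sum.inl j)))
              = Function.update (fun j => D.δ (v (Sum.inl j))) i (D.δ y) := by
            ext j : 1
            by_cases hj : j = i
            · subst hj; simp
            · simp [hj]
          simp only [hc, h, map_add, blockDet_update_row_add]
        · have hc (y : ℕ →₀ K) : D.cols l (Function.update v (Sum.inr k) y)
              = Function.update (D.cols l v) (colPos k.1) (D.γ y) := D.cols_update l v k y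
          have h (y : ℕ →₀ K) : (fun j => D.δ (Function.update v (Sum.inr k) y (Sum.inl j)))
              = fun j => D.δ (v (Sum.inl j)) := by
            ext j : 1
            simp
          simp only [hc, h, map_add, blockDet_update_col_add]
      map_update_smul' := by
        intro _ v i c y
        rcases i with i | k
        · have hc (y : ℕ →₀ K) : D.cols l (Function.update v (Sum.inl i) y) = D.cols l v :=
            D.cols_update_inl l v i y
          have h (y : ℕ →₀ K) : (fun j => D.δ (Function.update v (Sum.inl i) y (Sum.inl j)))
              = Function.update (fun j => D.δ (v (Sum.inl j))) i (D.δ y) := by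
            ext j : 1
            by_cases hj : j = i
            · subst hj; simp
            · simp [hj]
          simp only [hc, h, map_smul, blockDet_update_row_smul, smul_eq_mul]
        · have hc (y : ℕ →₀ K) : D.cols l (Function.update v (Sum.inr k) y)
              = Function.update (D.cols l v) (colPos k.1) (D.γ y) := D.cols_update l v k y
          have h (y : ℕ →₀ K) : (fun j => D.δ (Function.update v (Sum.inr k) y (Sum.inl j)))
              = fun j => D.δ (v (Sum.inl j)) := by
            ext j : 1
            simp
          simp only [hc, h, map_smul, blockDet_update_col_smul, smul_eq_mul] }
  alt l v i j hij hc hv := by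
    rcases i with i | i <;> rcases j with j | j
    · exact blockDet_eq_zero_of_row_eq _ _ _ _ (by simpa using hij) (by simp [hv])
    · simp at hc
    · simp at hc
    · have hne : i.1 ≠ j.1 := fun h => hij (by rw [Subtype.ext h])
      refine blockDet_eq_zero_of_col_eq _ _ _ _ (colPos_injective.ne hne) ?_
      rw [cols_colPos, cols_colPos, covec, covec, dif_pos i.2, dif_pos j.2]
      exact congrArg D.γ hv

theorem pt_form (D : FramedTensor K m) (l : FormLabel m) (v : (formSig m).ι l → (ℕ →₀ K)) :
    D.pt.form l v = blockDet finSumFinEquiv.symm (fun i => D.δ (v (Sum.inl i))) (D.cols l v) D.ω :=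
  rfl

/-- Precomposing the parametrizations with linear maps. -/
noncomputable def comap (φ : Bool → (ℕ →₀ K) →ₗ[K] (ℕ →₀ K)) (D : FramedTensor K m) :
    FramedTensor K m :=
  { D with γ := D.γ ∘ₗ φ true, δ := D.δ ∘ₗ φ false }

theorem comap_pt (φ : Bool → (ℕ →₀ K) →ₗ[K] (ℕ →₀ K)) (D : FramedTensor K m) :
    (D.comap φ).pt = D.pt.comap φ :=
  Pt.ext' fun _ _ => rfl

end FramedTensor

end Data

end SecantGrassmann

/-! ### Words and the reduction to low words -/

namespace SecantGrassmann

open Module exteriorPower MvPolynomial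

section Words

variable {N m n : ℕ}

/-- Coordinates: frame letters, window letters, and further letters. -/
abbrev Letter (N m n : ℕ) : Type := Fin N ⊕ ((Fin m ⊕ Fin m) ⊕ Fin n)

/-- Words of length `N + 2`. -/
abbrev Word (N m n : ℕ) : Type := Fin N ⊕ Fin 2 → Letter N m n

/-- The word formed by the frame and two window letters. -/
def baseWord (n : ℕ) (ij : Fin m × Fin m) : Word N m n :=
  Sum.elim Sum.inl ![Sum.inr (Sum.inl (Sum.inl ij.1)), Sum.inr (Sum.inl (Sum.inr ij.2))]

/-- The weight of a letter. -/
def letterWeight : Letter N m n → ℕ := Sum.elim 0 (Sum.elim 1 2)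

/-- The weight of a word. -/
def wordWeight (w : Word N m n) : ℕ := ∑ k, letterWeight (w k)

/-- Words in which no frame letter is out of place. -/
structure SortedWord (w : Word N m n) : Prop where
  injective : Function.Injective w
  frame : ∀ i j, w (Sum.inl i) = Sum.inl j → j = i
  tail : ∀ k j, w (Sum.inr k) ≠ Sum.inl j

/-- Sorted words with at most one letter outside the frame and the window. -/
structure LowWord (w : Word N m n) : Prop extends SortedWord w where
  unique : ∀ k k', letterWeight (w k) = 2 → letterWeight (w k') = 2 → k = k'

theorem lowWord_baseWord (ij : Fin m × Fin m) : LowWord (baseWord n ij : Word N m n) where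
  injective := by
    rintro (a | a) (b | b) h
    · simpa [baseWord] using h
    · fin_cases b <;> simp [baseWord] at h
    · fin_cases a <;> simp [baseWord] at h
    · fin_cases a <;> fin_cases b <;> simp [baseWord] at h ⊢
  frame i j h := by simpa [baseWord, eq_comm] using h
  tail k j := by fin_cases k <;> simp [baseWord]
  unique k k' h := by
    rcases k with k | k
    · simp [baseWord, letterWeight] at h
    · fin_cases k <;> simp [baseWord, letterWeight] at h

/-- Sending `p₁`, `p₂` to the last two positions and each other frame letter to its own position is
a partial injection, which extends to a permutation. -/
theorem exists_sortedWord_comp (w : Word N m n) (hw : Function.Injective w)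
    {p₁ p₂ : Fin N ⊕ Fin 2} (hp : p₁ ≠ p₂) (h₁ : ∀ j, w p₁ ≠ Sum.inl j)
    (h₂ : ∀ j, w p₂ ≠ Sum.inl j) :
    ∃ σ : Equiv.Perm (Fin N ⊕ Fin 2), SortedWord (w ∘ σ) ∧ σ (Sum.inr 0) = p₁ ∧
      σ (Sum.inr 1) = p₂ := by
  classical
  let g : Fin N ⊕ Fin 2 → Fin N ⊕ Fin 2 := fun p =>
    if p = p₁ then Sum.inr 0 else if p = p₂ then Sum.inr 1 else
      (w p).elim Sum.inl fun _ => Sum.inr 0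
  let s : Set (Fin N ⊕ Fin 2) := {p | p = p₁ ∨ p = p₂ ∨ ∃ j, w p = Sum.inl j}
  have hg₁ : g p₁ = Sum.inr 0 := by simp [g]
  have hg₂ : g p₂ = Sum.inr 1 := by simp [g, hp.symm]
  have hg (p j) (h : w p = Sum.inl j) : g p = Sum.inl j := by
    have e1 : p ≠ p₁ := by rintro rfl; exact h₁ j h
    have e2 : p ≠ p₂ := by rintro rfl; exact h₂ j h
    simp [g, e1, e2, h]
  have hinj : Set.InjOn g s := by
    rintro p (rfl | rfl | ⟨j, hj⟩) p' (rfl | rfl | ⟨j', hj'⟩) h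
    · rfl
    · simp [hg₁, hg₂] at h
    · simp [hg₁, hg _ _ hj'] at h
    · simp [hg₁, hg₂] at h
    · rfl
    · simp [hg₂, hg _ _ hj'] at h
    · simp [hg₁, hg _ _ hj] at h
    · simp [hg₂, hg _ _ hj] at h
    · rw [hg _ _ hj, hg _ _ hj'] at h
      exact hw (by rw [hj, hj', Sum.inl_injective h])
  obtain ⟨G, hG⟩ := Set.MapsTo.exists_equiv_extend_of_card_eq (t := Finset.univ)
    (by simp) (fun p _ => by simp) hinj
  let τ : Equiv.Perm (Fin N ⊕ Fin 2) := G.trans (Equiv.subtypeUnivEquiv fun p => by simp)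
  have hτ (p) (h : p ∈ s) : τ p = g p := hG p h
  have hσ₁ : τ.symm (Sum.inr 0) = p₁ := by
    rw [Equiv.symm_apply_eq, hτ _ (Or.inl rfl), hg₁]
  have hσ₂ : τ.symm (Sum.inr 1) = p₂ := by
    rw [Equiv.symm_apply_eq, hτ _ (Or.inr (Or.inl rfl)), hg₂]
  refine ⟨τ.symm, ⟨hw.comp τ.symm.injective, fun i j h => ?_, fun k j => ?_⟩, hσ₁, hσ₂⟩
  · have h1 : τ (τ.symm (Sum.inl i)) = Sum.inl j := by
      rw [hτ _ (Or.inr (Or.inr ⟨j, h⟩)), hg _ _ h]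
    rw [Equiv.apply_symm_apply] at h1
    exact (Sum.inl_injective h1).symm
  · fin_cases k
    · exact fun h => h₁ j (by rw [← hσ₁]; exact h)
    · exact fun h => h₂ j (by rw [← hσ₂]; exact h)

theorem exists_two_tail_letters (w : Word N m n) (hw : Function.Injective w) :
    ∃ p₁ p₂, p₁ ≠ p₂ ∧ (∀ j, w p₁ ≠ Sum.inl j) ∧ ∀ j, w p₂ ≠ Sum.inl j := by
  classical
  by_contra! hcon
  let S : Finset (Fin N ⊕ Fin 2) := Finset.univ.filter fun p => ∃ j, w p = Sum.inl j
  have hS : S.card ≤ N := by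
    rw [← Finset.card_image_of_injective S hw]
    refine (Finset.card_le_card (t := Finset.univ.image Sum.inl) fun x hx => ?_).trans
      (Finset.card_image_le.trans (by simp))
    obtain ⟨p, hp, rfl⟩ := Finset.mem_image.1 hx
    obtain ⟨j, hj⟩ := (Finset.mem_filter.1 hp).2
    exact Finset.mem_image.2 ⟨j, Finset.mem_univ _, hj.symm⟩
  have hSc : Sᶜ.card ≤ 1 := by
    refine Finset.card_le_one.2 fun a ha b hb => ?_
    by_contra hab
    simp only [S, Finset.mem_compl, Finset.mem_filter, Finset.mem_univ, true_and,
      not_exists] at ha hb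
    obtain ⟨j, hj⟩ := hcon a b hab ha
    exact hb j hj
  have := Finset.card_add_card_compl S
  rw [Fintype.card_sum, Fintype.card_fin, Fintype.card_fin] at this
  omega

end Words

section Elimination

variable {K : Type u} [Field K] {N m n : ℕ}

/-- The coordinate forms at the letters of a word. -/
def coordWord (K : Type u) [Field K] (w : Word N m n) (k : Fin N ⊕ Fin 2) :
    Dual K (Letter N m n → K) :=
  LinearMap.proj (w k)

/-- The locus of `f` in the space of `(N + 2)`-vectors on the coordinate space of the letters. -/
abbrev Locus (N n : ℕ) (f : MvPolynomial (Fin m × Fin m) K) : Type u :=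
  {ω : ⋀[K]^(N + 2) (Letter N m n → K) // ω ∈ windowLocus f}

/-- The coordinate at a word, as a function on the locus of `f`. -/
noncomputable def wordFun (f : MvPolynomial (Fin m × Fin m) K) (w : Word N m n) :
    Locus N n f → K :=
  fun ω => pairingOn finSumFinEquiv.symm ω.1 (coordWord K w)

/-- A polynomial in the window values at the coordinate window, as a function on the locus
of `f`. -/
noncomputable def windowFun (f h : MvPolynomial (Fin m × Fin m) K) :
    Locus N n f → K :=
  fun ω => eval (fun ij => wordFun f (baseWord n ij) ω) h

/-- The functions on the locus of `f` generated by the coordinates at low words. -/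
noncomputable def lowAlg (f : MvPolynomial (Fin m × Fin m) K) :
    Subalgebra K (Locus N n f → K) :=
  Algebra.adjoin K (Set.range fun w : {w : Word N m n // LowWord w} => wordFun f w.1)

theorem windowFun_mem_lowAlg (f h : MvPolynomial (Fin m × Fin m) K) :
    (windowFun f h : Locus N n f → K) ∈ lowAlg f := by
  have h1 : (windowFun f h : Locus N n f → K)
      = aeval (fun ij => wordFun f (baseWord n ij)) h := by
    ext ω
    rw [aeval_pi_apply]
    rfl
  rw [h1]
  have h2 := AlgHom.mem_range_self (aeval fun ij => wordFun (N := N) f (baseWord n ij)) h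
  rw [aeval_range] at h2
  refine Algebra.adjoin_mono ?_ h2
  rintro _ ⟨ij, rfl⟩
  exact ⟨⟨baseWord n ij, lowWord_baseWord ij⟩, rfl⟩

theorem wordFun_comp_perm (f : MvPolynomial (Fin m × Fin m) K) (w : Word N m n)
    (σ : Equiv.Perm (Fin N ⊕ Fin 2)) :
    wordFun f w = ((Equiv.Perm.sign σ : ℤ) : K) • wordFun f (w ∘ σ) := by
  ext ω
  have h : wordFun f (w ∘ σ) ω = Equiv.Perm.sign σ • wordFun f w ω :=
    (pairingOn finSumFinEquiv.symm ω.1).map_perm (coordWord K w) σ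
  rw [Pi.smul_apply, h]
  rcases Int.units_eq_one_or (Equiv.Perm.sign σ) with h | h <;> simp [h]

theorem wordFun_eq_zero (f : MvPolynomial (Fin m × Fin m) K) {w : Word N m n}
    (hw : ¬ Function.Injective w) : wordFun f w = 0 := by
  rw [Function.not_injective_iff] at hw
  obtain ⟨a, b, h, hab⟩ := hw
  ext ω
  exact (pairingOn finSumFinEquiv.symm ω.1).map_eq_zero_of_eq _ (by rw [coordWord, coordWord, h])
    hab

section Step

variable (f : MvPolynomial (Fin m × Fin m) K) (w : Word N m n) (y₀ : Fin m × Fin m)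

/-- The positions that have to be moved to reach a word from the base word. -/
abbrev Move (w : Word N m n) : Type := {i : Fin N // w (Sum.inl i) ≠ Sum.inl i} ⊕ Fin 2

/-- The move assigned to each position. -/
def moveOf (k : Fin N ⊕ Fin 2) : Option (Move w) :=
  k.elim (fun i => if h : w (Sum.inl i) ≠ Sum.inl i then some (Sum.inl ⟨i, h⟩) else none)
    fun k => some (Sum.inr k)

/-- The positions of the base word at `ij` affected by moving the base word at `y₀`. -/
def Movable (ij : Fin m × Fin m) (k : Fin N ⊕ Fin 2) : Prop :=
  k.elim (fun _ => True) ![ij.1 = y₀.1, ij.2 = y₀.2]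

open Classical in
/-- The directions of the moves. -/
noncomputable def moveDir (ij : Fin m × Fin m) (k : Fin N ⊕ Fin 2) (μ : Move w) :
    Dual K (Letter N m n → K) :=
  if moveOf w k = some μ ∧ Movable y₀ ij k then coordWord K w k else 0

theorem prod_moveOf {R : Type*} [CommRing R] :
    (∏ k, (moveOf w k).elim 1 X : MvPolynomial (Move w) R)
      = monomial (Finsupp.equivFunOnFinite.symm fun _ => 1) 1 := by
  rw [← prod_X_eq_monomial, Fintype.prod_sum_type, Fintype.prod_sum_type]
  congr 1
  rw [← Fintype.prod_subtype_mul_prod_subtype fun i : Fin N => w (Sum.inl i) ≠ Sum.inl i]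
  have h1 : ∏ i : {i : Fin N // ¬ w (Sum.inl i) ≠ Sum.inl i},
      ((moveOf w (Sum.inl i.1)).elim 1 X : MvPolynomial (Move w) R) = 1 := by
    refine Finset.prod_eq_one fun i _ => ?_
    rw [moveOf, Sum.elim_inl, dif_neg i.2]
    rfl
  rw [h1, mul_one]
  refine Finset.prod_congr rfl fun i _ => ?_
  rw [moveOf, Sum.elim_inl, dif_pos i.2]
  rfl

/-- The form of an element of the locus of `f`. -/
noncomputable def locusForm
    (ω : Locus N n f) :
    MultilinearMap K (fun _ : Fin N ⊕ Fin 2 => Dual K (Letter N m n → K)) K :=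
  (pairingOn finSumFinEquiv.symm ω.1).toMultilinearMap

theorem locusForm_coordWord (w' : Word N m n)
    (ω : Locus N n f) :
    locusForm f ω (coordWord K w') = wordFun f w' ω := rfl

variable {w}

/-- A term of the expansion is zero or the coordinate at a word no heavier than `w`, since base
letters have weight 0 or 1. Equal weight forces both tail positions to move, hence `ij = y₀`, and
leaves unmoved only frame letters in place. That is exactly `w`; all other words are lighter. -/
theorem locusForm_moveVec_mem (hw : SortedWord w) (hw2 : ∀ k, letterWeight (w (Sum.inr k)) = 2)
    (B : Subalgebra K (Locus N n f → K))
    (ih : ∀ w' : Word N m n, wordWeight w' < wordWeight w → wordFun f w' ∈ B)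
    (ij : Fin m × Fin m) (r : Fin N ⊕ Fin 2 → Option (Move w)) (hr : r = moveOf w → ij ≠ y₀) :
    (fun ω => locusForm f ω (moveVec (coordWord K (baseWord n ij)) (moveDir w y₀ ij) r)) ∈ B := by
  classical
  by_cases hv : ∀ k μ, r k = some μ → moveOf w k = some μ ∧ Movable y₀ ij k
  · let w' : Word N m n := fun k => if r k = none then baseWord n ij k else w k
    have h1 : moveVec (coordWord K (baseWord n ij)) (moveDir w y₀ ij) r = coordWord K w' := by
      ext k : 1
      rcases hk : r k with _ | μ
      · simp [moveVec, hk, coordWord, w']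
      · simp [moveVec, hk, coordWord, w', moveDir, hv k μ hk]
    rw [h1]
    refine ih w' ?_
    by_contra hle
    have hle' : ∀ k, letterWeight (w' k) ≤ letterWeight (w k) := by
      intro k
      by_cases hk : r k = none
      · simp only [w', hk, if_true]
        rcases k with k | k
        · simp [baseWord, letterWeight]
        · rw [hw2]
          fin_cases k <;> simp [baseWord, letterWeight]
      · simp [w', hk]
    have heq : ∀ k, letterWeight (w k) = letterWeight (w' k) := by
      by_contra! hne
      obtain ⟨k, hk⟩ := hne
      exact hle (Finset.sum_lt_sum (fun k _ => hle' k)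
        ⟨k, Finset.mem_univ _, lt_of_le_of_ne (hle' k) hk.symm⟩)
    have hsome (k) (h : r k ≠ none) : r k = moveOf w k ∧ Movable y₀ ij k := by
      obtain ⟨μ, hμ⟩ := Option.ne_none_iff_exists'.1 h
      exact ⟨by rw [hμ, (hv k μ hμ).1], (hv k μ hμ).2⟩
    have htail (k) : r (Sum.inr k) ≠ none := by
      intro h
      have := heq (Sum.inr k)
      rw [hw2] at this
      simp only [w', h, if_true] at this
      fin_cases k <;> simp [baseWord, letterWeight] at this
    refine hr ?_ (Prod.ext (hsome _ (htail 0)).2 (hsome _ (htail 1)).2)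
    ext1 k
    by_cases hk : r k = none
    · rcases k with i | k
      · rw [hk, moveOf, Sum.elim_inl, dif_neg]
        rw [not_not]
        have := heq (Sum.inl i)
        simp only [w', hk, if_true] at this
        rcases hwi : w (Sum.inl i) with j | (j | j)
        · rw [hw.frame i j hwi]
        · simp [hwi, letterWeight, baseWord] at this
        · simp [hwi, letterWeight, baseWord] at this
      · exact absurd hk (htail k)
    · exact (hsome k hk).1
  · push Not at hv
    obtain ⟨k, μ, hk, hne⟩ := hv
    have h0 : (fun ω => locusForm f ω (moveVec (coordWord K (baseWord n ij)) (moveDir w y₀ ij) r))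
        = 0 := by
      ext ω
      refine (locusForm f ω).map_coord_zero k ?_
      simp only [moveVec, hk, Option.elim_some, moveDir]
      exact if_neg fun h => hne h.1 h.2
    rw [h0]
    exact B.zero_mem

variable (w) in
/-- The coordinate at the base word after the moves. -/
noncomputable def movedBase (ij : Fin m × Fin m) : MvPolynomial (Move w)
    (Locus N n f → K) :=
  movePoly (locusForm f) (coordWord K (baseWord n ij)) (moveDir w y₀ ij)

theorem eval_movedBase (g : MvPolynomial (Fin m × Fin m) K)
    (ω : Locus N n f) (t : Move w → K) :
    eval t (MvPolynomial.map (Pi.evalRingHom (fun _ => K) ω)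
      (eval₂ (C.comp (algebraMap K _)) (movedBase f w y₀) g))
      = eval (fun ij => locusForm f ω fun k => coordWord K (baseWord n ij) k
          + ∑ μ, t μ • moveDir w y₀ ij k μ) g := by
  rw [hom_eval₂, hom_eval₂, eval, coe_eval₂Hom]
  congr 1
  · ext a
    simp
  · ext ij
    exact eval_movePoly _ _ _ _ _

/-- The moves change one frame and one window for all `ij` at once: a tail position moves only if it
carries the corresponding covector of `y₀`. So `f` vanishes along the whole perturbation. -/
theorem eval_movedBase_eq_windowValues
    (ω : Locus N n f) (t : Move w → K) :
    ∃ (α : Fin N → Dual K (Letter N m n → K)) (β β' : Fin m → Dual K (Letter N m n → K)),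
      (fun ij => locusForm f ω fun k => coordWord K (baseWord n ij) k
          + ∑ μ, t μ • moveDir w y₀ ij k μ) = windowValues ω.1 α β β' := by
  classical
  refine ⟨fun i => LinearMap.proj (Sum.inl i) + ∑ μ, t μ •
      if moveOf w (Sum.inl i) = some μ then coordWord K w (Sum.inl i) else 0,
    fun i => LinearMap.proj (Sum.inr (Sum.inl (Sum.inl i))) + ∑ μ, t μ •
      if moveOf w (Sum.inr 0) = some μ ∧ i = y₀.1 then coordWord K w (Sum.inr 0) else 0,
    fun i => LinearMap.proj (Sum.inr (Sum.inl (Sum.inr i))) + ∑ μ, t μ •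
      if moveOf w (Sum.inr 1) = some μ ∧ i = y₀.2 then coordWord K w (Sum.inr 1) else 0, ?_⟩
  ext ij
  rw [windowValues, locusForm, AlternatingMap.coe_multilinearMap]
  congr 1
  ext1 k
  rcases k with k | k
  · refine congrArg₂ _ rfl (Finset.sum_congr rfl fun μ _ => congrArg _ ?_)
    exact if_congr (and_iff_left trivial) rfl rfl
  · fin_cases k <;>
    exact congrArg₂ _ rfl (Finset.sum_congr rfl fun μ _ => congrArg _ (if_congr Iff.rfl rfl rfl))

/-- In the perturbed window the coordinate at `w` occurs only in the entry `y₀`, as the coefficient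
of the product of all parameters. The vanishing of `f` then gives `h` times its `q`-th power in
terms of lighter words. -/
theorem wordFun_mem_of_lighter [Infinite K] (p e : ℕ)
    [ExpChar (Locus N n f → K) p]
    (hq : ∀ μ ∈ f.support, p ^ e ∣ μ y₀)
    (hw : SortedWord w) (hw2 : ∀ k, letterWeight (w (Sum.inr k)) = 2)
    (ih : ∀ w' : Word N m n, wordWeight w' < wordWeight w → wordFun f w' ∈
      perfLoc p (lowAlg f) (windowFun f (hasse f y₀ (p ^ e))) (windowFun_mem_lowAlg f _)) :
    wordFun f w ∈
      perfLoc p (lowAlg f) (windowFun f (hasse f y₀ (p ^ e))) (windowFun_mem_lowAlg f _) := by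
  classical
  set B := perfLoc p (lowAlg (N := N) (n := n) f) (windowFun f (hasse f y₀ (p ^ e)))
    (windowFun_mem_lowAlg f _) with hB
  have hmem := locusForm_moveVec_mem f y₀ hw hw2 B ih
  obtain ⟨R₀, hR₀, hs₀⟩ := movePoly_eq_add (locusForm f) (coordWord K (baseWord n y₀))
    (moveDir w y₀ y₀) B (moveOf w) (prod_moveOf w) fun r hr => hmem y₀ r fun h => absurd h hr
  have hη : (fun ω => locusForm f ω (moveVec (coordWord K (baseWord n y₀))
      (moveDir w y₀ y₀) (moveOf w))) = wordFun f w := by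
    ext ω
    rw [← locusForm_coordWord]
    congr 1
    ext1 k
    have hmov : Movable y₀ y₀ k := by
      rcases k with k | k
      · trivial
      · fin_cases k <;> rfl
    rcases hk : moveOf w k with _ | μ
    · rcases k with i | k
      · have hi : w (Sum.inl i) = Sum.inl i := by
          by_contra h
          simp [moveOf, h] at hk
        simp [moveVec, hk, coordWord, baseWord, hi]
      · simp [moveOf] at hk
    · simp [moveVec, hk, moveDir, hmov]
  rw [hη] at hs₀
  have hs : ∀ μ ∈ f.support, ∀ y ∈ μ.support, y ≠ y₀ → movedBase f w y₀ y ∈ coeffIn (Move w) B :=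
    fun _ _ y _ hy => movePoly_mem_coeffIn _ _ _ _ fun r => hmem y r fun _ => hy
  have key := coeff_eval₂_sub_mem (ι := Move w) (σ := Fin m × Fin m) (A := K) (K := K) p e B
    (C.comp (algebraMap K _)) (fun a => C_mem_coeffIn (Subalgebra.algebraMap_mem _ a))
    (movedBase f w y₀) y₀ f hs R₀ hR₀ (wordFun f w) hs₀ hq
  have hzero : eval₂ (C.comp (algebraMap K _)) (movedBase f w y₀) f = 0 := by
    refine eq_zero_of_eval_map_eq_zero _ fun ω t => ?_
    rw [eval_movedBase]
    obtain ⟨α, β, β', h⟩ := eval_movedBase_eq_windowValues f y₀ ω t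
    rw [h]
    exact ω.2 α β β'
  have hcoeff : (eval₂ (C.comp (algebraMap K _)) (movedBase f w y₀) (hasse f y₀ (p ^ e))).coeff 0
      = windowFun f (hasse f y₀ (p ^ e)) := by
    ext ω
    rw [coeff_zero_apply, eval_movedBase, windowFun]
    simp [locusForm_coordWord]
  rw [hzero, hcoeff, coeff_zero, zero_sub] at key
  exact mem_perfLoc_of_mul_pow_mem (neg_mem_iff.1 key)

end Step

/-- Induction on the weight. A word with two letters of weight 2 is sorted with these in the tail
and reduced to lighter words; any other word with distinct letters becomes low after sorting. -/
theorem wordFun_mem_perfLoc [Infinite K] (f : MvPolynomial (Fin m × Fin m) K)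
    (y₀ : Fin m × Fin m) (p e : ℕ)
    [ExpChar (Locus N n f → K) p]
    (hq : ∀ μ ∈ f.support, p ^ e ∣ μ y₀) (w : Word N m n) :
    wordFun f w ∈
      perfLoc p (lowAlg f) (windowFun f (hasse f y₀ (p ^ e))) (windowFun_mem_lowAlg f _) := by
  induction hW : wordWeight w using Nat.strong_induction_on generalizing w with
  | _ W ih =>
    subst hW
    have ih' (w' : Word N m n) (h : wordWeight w' < wordWeight w) := ih _ h w' rfl
    by_cases hinj : Function.Injective w
    swap
    · rw [wordFun_eq_zero f hinj]
      exact Subalgebra.zero_mem _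
    by_cases h2 : ∃ p₁ p₂, p₁ ≠ p₂ ∧ letterWeight (w p₁) = 2 ∧ letterWeight (w p₂) = 2
    · obtain ⟨p₁, p₂, hp, h₁, h₂⟩ := h2
      obtain ⟨σ, hσ, hσ₁, hσ₂⟩ := exists_sortedWord_comp w hinj hp
        (fun j h => by simp [h, letterWeight] at h₁) (fun j h => by simp [h, letterWeight] at h₂)
      have hwt : wordWeight (w ∘ σ) = wordWeight w :=
        Equiv.sum_comp σ fun k => letterWeight (w k)
      rw [wordFun_comp_perm f w σ]
      refine Subalgebra.smul_mem _ (wordFun_mem_of_lighter f y₀ p e hq hσ (fun k => ?_)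
        fun w' hw' => ih' w' (hwt ▸ hw')) _
      fin_cases k
      · simpa [hσ₁] using h₁
      · simpa [hσ₂] using h₂
    · push Not at h2
      obtain ⟨p₁, p₂, hp, h₁, h₂⟩ := exists_two_tail_letters w hinj
      obtain ⟨σ, hσ, -, -⟩ := exists_sortedWord_comp w hinj hp h₁ h₂
      rw [wordFun_comp_perm f w σ]
      have hlow : LowWord (w ∘ σ) := ⟨hσ, fun k k' hk hk' => by
        by_contra hne
        exact h2 _ _ (σ.injective.ne hne) hk hk'⟩
      exact Subalgebra.smul_mem _ (le_perfLoc (show _ ∈ lowAlg f from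
        Algebra.subset_adjoin ⟨⟨w ∘ σ, hlow⟩, rfl⟩)) _

theorem polyEval_mem_of_wordFun_mem (f : MvPolynomial (Fin m × Fin m) K)
    (B : Subalgebra K (Locus N n f → K))
    (hB : ∀ w, wordFun f w ∈ B)
    (g : MvPolynomial (Dual K (⋀[K]^(N + 2) (Letter N m n → K))) K) :
    (fun ω : Locus N n f => polyEval g ω.1) ∈ B := by
  induction g using MvPolynomial.induction_on with
  | C a =>
    simp only [polyEval, eval_C]
    exact B.algebraMap_mem a
  | add a b ha hb =>
    simp only [polyEval, map_add] at ha hb ⊢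
    exact B.add_mem ha hb
  | mul_X a φ ha =>
    simp only [polyEval, map_mul, eval_X] at ha ⊢
    refine B.mul_mem ha ?_
    have hφ := dual_mem_span_pairingForm (Pi.basisFun K (Letter N m n)) φ
    induction hφ using Submodule.span_induction with
    | mem φ h =>
      obtain ⟨v, rfl⟩ := h
      convert hB (v ∘ finSumFinEquiv) using 1
      ext ω
      rw [wordFun, pairingOn_apply, pairingForm_apply]
      congr 1
      ext k : 1
      ext x
      simp [coordWord]
    | zero => exact B.zero_mem
    | add x y _ _ hx hy => exact B.add_mem hx hy
    | smul c x _ hx => exact B.smul_mem hx c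

theorem exists_lowWord_polynomial [Infinite K] (f : MvPolynomial (Fin m × Fin m) K)
    (y₀ : Fin m × Fin m) (p e : ℕ)
    [ExpChar (Locus N n f → K) p]
    (hq : ∀ μ ∈ f.support, p ^ e ∣ μ y₀)
    (g : MvPolynomial (Dual K (⋀[K]^(N + 2) (Letter N m n → K))) K) :
    ∃ (k l : ℕ) (G : MvPolynomial {w : Word N m n // LowWord w} K),
      ∀ ω : Locus N n f,
        eval (fun w => wordFun f w.1 ω) G
          = windowFun f (hasse f y₀ (p ^ e)) ω ^ k * polyEval g ω.1 ^ p ^ l := by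
  obtain ⟨k, l, h⟩ := polyEval_mem_of_wordFun_mem f _ (wordFun_mem_perfLoc f y₀ p e hq) g
  rw [lowAlg, Algebra.adjoin_range_eq_range_aeval] at h
  obtain ⟨G, hG⟩ := h
  refine ⟨k, l, G, fun ω => ?_⟩
  have := congrFun hG ω
  rw [← aeval_pi_apply]
  exact this

end Elimination

end SecantGrassmann

/-! ### Low coordinates as values of determinantal forms -/

namespace SecantGrassmann

open Module exteriorPower MvPolynomial

/-- Covectors that read a new coordinate give unit columns, so rows and columns outside the range of
`j` drop out. Only the replaced frame positions matter, whatever the frame length. -/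
theorem blockDet_map_inl {K V κ ι σ : Type*} [Field K] [AddCommGroup V] [Module K V] [Fintype κ]
    [DecidableEq κ] [Fintype ι] [DecidableEq ι] [Fintype σ] [DecidableEq σ] {M : ℕ}
    (e : Fin M ≃ κ) (x : ι → V) (j : σ → ι) (hj : Function.Injective j)
    (u : κ ⊕ ι → Dual K (V × (ι → K))) (u' : κ ⊕ σ → Dual K V)
    (hu : ∀ k, u (Sum.map id j k) = (u' k).comp (LinearMap.fst K _ _))
    (hu' : ∀ i, i ∉ Set.range j → u (Sum.inr i) = (LinearMap.proj i).comp (LinearMap.snd K _ _))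
    (ω : ⋀[K]^M V) :
    blockDet e (fun i => (x i, Pi.single i 1)) u
      (exteriorPower.map _ (LinearMap.inl K V (ι → K)) ω) = blockDet e (x ∘ j) u' ω := by
  have h : blockDet e (fun i => (x i, Pi.single i 1)) u ∘ₗ
      exteriorPower.map _ (LinearMap.inl K V (ι → K)) = blockDet e (x ∘ j) u' := by
    refine eq_of_eq_on_ιMulti fun y => ?_
    rw [LinearMap.comp_apply, map_apply_ιMulti, blockDet_ιMulti, blockDet_ιMulti,
      det_submatrix_of_unit_columns _ j hj]
    · congr 1
      ext a b
      simp only [Matrix.submatrix_apply, Matrix.of_apply, hu, LinearMap.comp_apply]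
      rcases a with a | a <;> rfl
    · intro i k hk
      rw [Matrix.of_apply, hu' k hk]
      rcases i with i | i
      · simp
      · simp [Pi.single_apply, eq_comm]
  exact LinearMap.congr_fun h ω

section Comparison

variable {K : Type u} [Field K] {m : ℕ}

namespace FramedTensor

/-- The covector of a letter outside the frame. -/
noncomputable def letterCovec {n : ℕ} (D : FramedTensor K m) :
    (Fin m ⊕ Fin m) ⊕ Fin n → Dual K (D.ι → K) :=
  Sum.elim D.β fun c => D.γ (Finsupp.single (c : ℕ) 1)

/-- The parametrized covectors of `home`. -/
noncomputable def homeCovec (K : Type u) [Field K] (N m n : ℕ) :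
    (ℕ →₀ K) →ₗ[K] Dual K (Letter N m n → K) :=
  Finsupp.linearCombination K fun c : ℕ =>
    if h : c < n then LinearMap.proj (Sum.inr (Sum.inr ⟨c, h⟩)) else 0

/-- The parametrized vectors of `home`. -/
noncomputable def homeVec (K : Type u) [Field K] (N m n : ℕ) :
    (ℕ →₀ K) →ₗ[K] (Letter N m n → K) :=
  Finsupp.linearCombination K fun c : ℕ =>
    -- The sign is the one required by `blockDet_eq_pairingOn_extend`.
    if h : c < N then -Pi.single (Sum.inl ⟨c, h⟩) 1 else 0

/-- A tensor on the coordinate space of the letters, framed by the coordinates. -/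
noncomputable def home {N n : ℕ} (ω : ⋀[K]^(N + 2) (Letter N m n → K)) : FramedTensor K m where
  N := N
  ι := Letter N m n
  ω := ω
  α i := LinearMap.proj (Sum.inl i)
  β b := LinearMap.proj (Sum.inr (Sum.inl b))
  γ := homeCovec K N m n
  δ := homeVec K N m n

theorem letterCovec_home {N n : ℕ} (ω : ⋀[K]^(N + 2) (Letter N m n → K))
    (y : (Fin m ⊕ Fin m) ⊕ Fin n) :
    (home ω).letterCovec y = LinearMap.proj (Sum.inr y : Letter N m n) := by
  rcases y with y | y
  · rfl
  · have h : homeCovec K N m n (Finsupp.single (y : ℕ) 1) = LinearMap.proj (Sum.inr (Sum.inr y)) := by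
      simp [homeCovec]
    exact h

theorem homeVec_single {N n : ℕ} (i : Fin N) :
    homeVec K N m n (Finsupp.single (i : ℕ) 1) = -Pi.single (Sum.inl i) 1 := by
  simp [homeVec]

theorem pt_home_form {N n : ℕ} (ω : ⋀[K]^(N + 2) (Letter N m n → K)) (l : FormLabel m)
    (v : (formSig m).ι l → (ℕ →₀ K)) (u : Fin l.1 ⊕ Fin 2 → Dual K (Letter N m n → K))
    (hu : ∀ k, (home ω).covec l v k = u k) :
    (home ω).pt.form l v = blockDet finSumFinEquiv.symm (fun i => homeVec K N m n (v (Sum.inl i)))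
      (Sum.elim (Sum.elim (fun i => LinearMap.proj (Sum.inl i)) fun k => u (Sum.inr k))
        fun k => u (Sum.inl k)) ω := by
  obtain rfl : (home ω).covec l v = u := funext hu
  rfl

/-- The new vectors adjoined to a framed tensor. -/
noncomputable def newVec (D : FramedTensor K m) (N : ℕ) (i : Fin N) : (D.ι → K) × (Fin N → K) :=
  (D.δ (Finsupp.single (i : ℕ) 1), Pi.single i 1)

theorem exists_exchange_newVec (D : FramedTensor K m) (N : ℕ) :
    ∃ L : ⋀[K]^(D.N + 2) ((D.ι → K) × (Fin N → K)) →ₗ[K]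
        ⋀[K]^(N + 2) ((D.ι → K) × (Fin N → K)), ConePreserving L ∧
      ∀ ω (ζ : Fin N → Dual K ((D.ι → K) × (Fin N → K)))
        (τ : Fin 2 → Dual K ((D.ι → K) × (Fin N → K))),
        pairingOn finSumFinEquiv.symm (L ω) (Sum.elim ζ τ)
          = blockDet finSumFinEquiv.symm (D.newVec N) (Sum.elim (Sum.elim
            (fun i => (D.α i).comp (LinearMap.fst K _ _)) τ) ζ) ω :=
  exists_exchange _ _

/-- The coordinates on the enlarged space of a framed tensor. -/
noncomputable def letterMap (D : FramedTensor K m) (N n : ℕ) :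
    ((D.ι → K) × (Fin N → K)) →ₗ[K] (Letter N m n → K) :=
  LinearMap.pi (Sum.elim (fun i => (LinearMap.proj i).comp (LinearMap.snd K _ _))
    fun y => (D.letterCovec y).comp (LinearMap.fst K _ _))

/-- The natural linear map that sends the tensor of `D` to a tensor on the coordinate space of
the letters. -/
noncomputable def toLetters (D : FramedTensor K m) (N n : ℕ) :
    ⋀[K]^(D.N + 2) (D.ι → K) →ₗ[K] ⋀[K]^(N + 2) (Letter N m n → K) :=
  exteriorPower.map _ (D.letterMap N n) ∘ₗ (D.exists_exchange_newVec N).choose ∘ₗ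
    exteriorPower.map _ (LinearMap.inl K _ _)

theorem conePreserving_toLetters (D : FramedTensor K m) (N n : ℕ) :
    ConePreserving (D.toLetters N n) :=
  (conePreserving_map _ _).comp
    ((D.exists_exchange_newVec N).choose_spec.1.comp (conePreserving_map _ _))

theorem toLetters_mem_windowLocus [Infinite K] (D : FramedTensor K m) (N n : ℕ)
    {f : MvPolynomial (Fin m × Fin m) K} (h : D.ω ∈ windowLocus f) :
    D.toLetters N n D.ω ∈ windowLocus f := by
  refine map_mem_windowLocus _ (exchange_mem_windowLocus (D.newVec N) _
    (fun i => (LinearMap.proj i).comp (LinearMap.snd K _ _)) (fun i j => ?_) _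
    (D.exists_exchange_newVec N).choose_spec.2 (map_mem_windowLocus _ h))
  simp [newVec, Pi.single_apply, eq_comm]

theorem pairingOn_toLetters (D : FramedTensor K m) {N n : ℕ} (w : Word N m n)
    (ω : ⋀[K]^(D.N + 2) (D.ι → K)) :
    pairingOn finSumFinEquiv.symm (D.toLetters N n ω) (coordWord K w)
      = blockDet finSumFinEquiv.symm (D.newVec N) (Sum.elim (Sum.elim
            (fun i => (D.α i).comp (LinearMap.fst K _ _))
            fun k => (LinearMap.proj (w (Sum.inr k))).comp (D.letterMap N n))
          fun k => (LinearMap.proj (w (Sum.inl k))).comp (D.letterMap N n))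
        (exteriorPower.map _ (LinearMap.inl K _ _) ω) := by
  rw [← (D.exists_exchange_newVec N).choose_spec.2, pairingOn_apply, pairingOn_apply,
    toLetters, LinearMap.comp_apply, pairing_map]
  congr 1
  ext1 k
  simp only [Function.comp_apply]
  rcases finSumFinEquiv.symm k with l | l <;> rfl

end FramedTensor

open FramedTensor

/-- The label records the misplaced frame positions and the window letters there and in the tail;
the arguments say which frame vectors are removed and what the remaining letter is. One index serves
all framed tensors, so a relation among low coordinates becomes a polynomial on points. -/
theorem exists_index_of_lowWord {N n : ℕ} {w : Word N m n} (hw : LowWord w) :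
    ∃ idx : (formSig m).Idx K,
      (∀ ω, (home ω).pt.val idx = pairingOn finSumFinEquiv.symm ω (coordWord K w)) ∧
      ∀ D : FramedTensor K m, pairingOn finSumFinEquiv.symm (D.toLetters N n D.ω) (coordWord K w)
        = D.pt.val idx := by
  classical
  let S : Finset (Fin N) := Finset.univ.filter fun i => w (Sum.inl i) ≠ Sum.inl i
  let j : Fin S.card → Fin N := S.orderEmbOfFin rfl
  have hj : Function.Injective j := (S.orderEmbOfFin rfl).injective
  have hjS (i) : i ∈ Set.range j ↔ w (Sum.inl i) ≠ Sum.inl i := by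
    rw [show Set.range j = S from Finset.range_orderEmbOfFin S rfl]
    simp [S]
  let pos : Fin S.card ⊕ Fin 2 → Fin N ⊕ Fin 2 := Sum.map j id
  have hpos : Function.Injective pos := hj.sumMap Function.injective_id
  have hY (k) : ∃ y, w (pos k) = Sum.inr y := by
    rcases k with k | k
    · rcases h : w (pos (Sum.inl k)) with l | y
      · have h1 := hw.frame _ _ h
        subst h1
        exact absurd h ((hjS _).1 ⟨k, rfl⟩)
      · exact ⟨y, rfl⟩
    · rcases h : w (pos (Sum.inr k)) with l | y
      · exact absurd h (hw.tail k l)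
      · exact ⟨y, rfl⟩
  choose Y hY using hY
  let τ : Fin S.card ⊕ Fin 2 → Option (Fin m ⊕ Fin m) := fun k => (Y k).elim some fun _ => none
  have hτ : Function.Injective τ := by
    intro a b hab
    apply hpos
    rcases ha : Y a with y | y <;> rcases hb : Y b with z | z
    · simp only [τ, ha, hb, Sum.elim_inl, Option.some.injEq] at hab
      exact hw.injective (by rw [hY, hY, ha, hb, hab])
    · simp [τ, ha, hb] at hab
    · simp [τ, ha, hb] at hab
    · exact hw.unique _ _ (by rw [hY, ha]; rfl) (by rw [hY, hb]; rfl)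
  -- The misplaced and tail positions carry distinct letters, at most one of them outside the
  -- window, so there are at most 2m + 1 such positions.
  have hs : S.card < 2 * m + 1 := by
    have := Fintype.card_le_of_injective τ hτ
    simp at this
    omega
  let l : FormLabel m := ⟨⟨S.card, hs⟩, τ⟩
  let v : (formSig m).ι l → (ℕ →₀ K) := Sum.elim (fun i => Finsupp.single (j i : ℕ) 1)
    fun k => (Y k.1).elim (fun _ => 0) fun c : Fin n => Finsupp.single (c : ℕ) 1
  have hcov (D : FramedTensor K m) (k) : D.covec l v k = D.letterCovec (Y k) := by
    rcases hk : Y k with y | y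
    · have h1 : l.2 k = some y := by simp [l, τ, hk]
      have h2 : l.2 k ≠ none := by simp [h1]
      rw [covec, dif_neg h2, h1]
      rfl
    · have h1 : l.2 k = none := by simp [l, τ, hk]
      rw [covec, dif_pos h1]
      simp [v, hk, letterCovec]
  refine ⟨⟨l, v⟩, fun ω => ?_, fun D => ?_⟩
  · have hproj (k) : (home ω).covec l v k = LinearMap.proj (w (pos k)) := by
      rw [hcov, letterCovec_home, hY]
    have hδ (i) : homeVec K N m n (v (Sum.inl i)) = -Pi.single (Sum.inl (j i)) 1 :=
      homeVec_single (j i)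
    rw [Pt.val, pt_home_form ω l v _ hproj]
    have hzero (i : Fin S.card) (k) : (LinearMap.proj (w (pos k)) : Dual K (Letter N m n → K))
        (-Pi.single (Sum.inl (j i)) 1) = 0 := by
      rw [hY]
      simp
    have hsj : Function.Injective fun i => (Sum.inl (j i) : Fin N ⊕ Fin 2) :=
      Sum.inl_injective.comp hj
    rw [blockDet_eq_pairingOn_extend _ _ _ _ _ hsj]
    · congr 1
      ext1 k
      by_cases hk : ∃ i, (Sum.inl (j i) : Fin N ⊕ Fin 2) = k
      · obtain ⟨i, rfl⟩ := hk
        rw [hsj.extend_apply]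
        rfl
      · rw [Function.extend_apply' _ _ _ hk]
        rcases k with k | k
        · have h2 : w (Sum.inl k) = Sum.inl k := by
            by_contra h
            obtain ⟨i, rfl⟩ := (hjS k).2 h
            exact hk ⟨i, rfl⟩
          rw [coordWord, h2]
          rfl
        · rfl
    · intro i k
      rw [hδ]
      rcases k with k | k
      · by_cases hk : k = j i
        · subst hk
          simp
        · simp [hk]
      · exact (hzero i (Sum.inr k)).trans (if_neg (by simp)).symm
    · intro i k
      rw [hδ]
      exact hzero i (Sum.inl k)
  · rw [Pt.val, pt_form, pairingOn_toLetters]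
    have hcol (k) : (LinearMap.proj (w (pos k))).comp (D.letterMap N n)
        = (D.covec l v k).comp (LinearMap.fst K _ _) := by
      rw [hcov, hY]
      rfl
    refine blockDet_map_inl _ (fun i : Fin N => D.δ (Finsupp.single (i : ℕ) 1)) j hj _ (D.cols l v)
      ?_ ?_ D.ω
    · rintro ((k | k) | k)
      · rfl
      · exact hcol (Sum.inr k)
      · exact hcol (Sum.inl k)
    · intro i hi
      have hwi : w (Sum.inl i) = Sum.inl i := by
        by_contra h
        exact hi ((hjS i).2 h)
      rw [Sum.elim_inr, hwi]
      rfl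

end Comparison

/-! ### Stabilisation of the degree closures -/

section Stabilization

variable {K : Type u} [Field K] {m : ℕ}

/-- The `(N + 2)`-vectors at which all polynomials of degree at most `d` vanish that vanish on
the `k`-th secant variety. -/
abbrev secantDegreeClosure (K : Type*) [Field K] (V : Type*) [AddCommGroup V] [Module K V]
    (p k d : ℕ) : Set (⋀[K]^p V) :=
  degreeClosure K (secantVariety K (grassmannCone K V p) k) d

theorem ConePreserving.map_mem {V W : Type*} [AddCommGroup V] [Module K V] [AddCommGroup W]
    [Module K W] {p q k d : ℕ} {L : ⋀[K]^p V →ₗ[K] ⋀[K]^q W} (hL : ConePreserving L)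
    {ω : ⋀[K]^p V} (hω : ω ∈ secantDegreeClosure K V p k d) :
    L ω ∈ secantDegreeClosure K W q k d :=
  map_mem_degreeClosure L (map_mem_secantVariety L hL k) hω

/-- The points of the framed tensors in a degree closure and in the locus of `f`. -/
def framedPts (f : MvPolynomial (Fin m × Fin m) K) (k d : ℕ) : Set (Pt K (formSig m)) :=
  {z | ∃ D : FramedTensor K m, D.ω ∈ secantDegreeClosure K (D.ι → K) (D.N + 2) k d ∧
    D.ω ∈ windowLocus f ∧ z = D.pt}

theorem comap_mem_framedPts (f : MvPolynomial (Fin m × Fin m) K) (k d : ℕ)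
    (φ : Bool → (ℕ →₀ K) →ₗ[K] (ℕ →₀ K)) : ∀ z ∈ framedPts f k d, z.comap φ ∈ framedPts f k d := by
  rintro _ ⟨D, h₁, h₂, rfl⟩
  exact ⟨D.comap φ, h₁, h₂, (D.comap_pt φ).symm⟩

/-- The closed family generated by `framedPts`. -/
def framedFamily (f : MvPolynomial (Fin m × Fin m) K) (k d : ℕ) : ClosedFamily K (formSig m) :=
  ClosedFamily.closure (framedPts f k d) (comap_mem_framedPts f k d)

theorem framedFamily_antitone (f : MvPolynomial (Fin m × Fin m) K) (k : ℕ) :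
    Antitone (framedFamily f k) := by
  intro d d' h
  refine ClosedFamily.closure_mono ?_
  rintro _ ⟨D, h₁, h₂, rfl⟩
  exact ⟨D, degreeClosure_antitone _ h h₁, h₂, rfl⟩

theorem exists_framedFamily_stable [Infinite K] (f : MvPolynomial (Fin m × Fin m) K) (k : ℕ) :
    ∃ d₀, ∀ d, framedFamily f k d₀ ≤ framedFamily f k d := by
  have := ClosedFamily.wellFounded_lt (K := K) (formSig m)
  obtain ⟨_, ⟨d₀, rfl⟩, hmin⟩ := this.has_min (Set.range (framedFamily f k)) ⟨_, 0, rfl⟩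
  refine ⟨d₀, fun d => ?_⟩
  rcases le_total d d₀ with h | h
  · exact framedFamily_antitone f k h
  · by_contra hne
    exact hmin _ ⟨d, rfl⟩ (lt_of_le_not_ge (framedFamily_antitone f k h) hne)

/-- For `g` vanishing on the secant variety, some h^a · g^(p^b) is a polynomial `G` in low
coordinates. `G` vanishes on the points of framed tensors in the closure of degree `d`, because
`toLetters` carries these to zeros of `g`. By stability it vanishes at ω, where `h` is nonzero. -/
theorem polyEval_eq_zero_of_stable [Infinite K] {N n k d₀ : ℕ}
    (f : MvPolynomial (Fin m × Fin m) K) (hd₀ : ∀ d, framedFamily f k d₀ ≤ framedFamily f k d)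
    (y₀ : Fin m × Fin m) (p e : ℕ) [ExpChar K p]
    (hq : ∀ μ ∈ f.support, p ^ e ∣ μ y₀)
    (ω : ⋀[K]^(N + 2) (Letter N m n → K)) (hω : ω ∈ windowLocus f)
    (hωd : ω ∈ secantDegreeClosure K _ (N + 2) k d₀)
    (hh : windowFun f (hasse f y₀ (p ^ e)) (⟨ω, hω⟩ : Locus N n f) ≠ 0) (d : ℕ) :
    ω ∈ secantDegreeClosure K _ (N + 2) k d := by
  intro g hgd hg
  have : Nonempty (Locus N n f) := ⟨⟨ω, hω⟩⟩
  have := expChar_of_injective_algebraMap (algebraMap K (Locus N n f → K)).injective p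
  obtain ⟨a, b, G, hG⟩ := exists_lowWord_polynomial f y₀ p e hq g
  choose idx hidx₁ hidx₂ using fun w : {w : Word N m n // LowWord w} =>
    exists_index_of_lowWord (K := K) w.2
  have hev (z : Pt K (formSig m)) : z.ev (rename idx G) = eval (fun w => z.val (idx w)) G := by
    rw [Pt.ev, eval_rename]
    rfl
  have hmem : (FramedTensor.home ω).pt ∈ (framedFamily f k d).carrier :=
    hd₀ d (ClosedFamily.subset_closure ⟨_, hωd, hω, rfl⟩)
  have hz : (FramedTensor.home ω).pt.ev (rename idx G) = 0 := by
    refine hmem _ ?_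
    rintro _ ⟨D, hD₁, hD₂, rfl⟩
    have h1 := hG ⟨_, D.toLetters_mem_windowLocus N n hD₂⟩
    have h2 : polyEval g (D.toLetters N n D.ω) = 0 :=
      (D.conePreserving_toLetters N n).map_mem hD₁ g hgd hg
    rw [h2, zero_pow (pow_ne_zero _ (expChar_pos K p).ne'), mul_zero] at h1
    rw [hev, ← h1]
    congr 2
    ext w
    exact (hidx₂ w D).symm
  rw [hev] at hz
  simp only [hidx₁] at hz
  have h1 := hG ⟨ω, hω⟩
  have h2 : eval (fun w : {w : Word N m n // LowWord w} =>
      wordFun f w.1 (⟨ω, hω⟩ : Locus N n f)) G = 0 := hz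
  rw [h2] at h1
  exact pow_eq_zero_iff (pow_ne_zero _ (expChar_pos K p).ne') |>.1
    ((mul_eq_zero.1 h1.symm).resolve_left (pow_ne_zero _ hh))

end Stabilization

end SecantGrassmann

/-! ### Induction on the window polynomial and conclusion -/

namespace SecantGrassmann

open Module exteriorPower MvPolynomial

theorem hasse_ne_zero {σ K : Type*} [Field K] (f : MvPolynomial σ K) (y₀ : σ) (q : ℕ)
    (hq : ∀ μ ∈ f.support, q ∣ μ y₀)
    (h : ∃ μ ∈ f.support, μ y₀ ≠ 0 ∧ ((μ y₀ / q : ℕ) : K) ≠ 0) : hasse f y₀ q ≠ 0 := by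
  obtain ⟨μ, hμ, h0, hne⟩ := h
  intro hz
  have := coeff_hasse f y₀ q hq hμ h0
  rw [hz, coeff_zero] at this
  exact mul_ne_zero hne (mem_support_iff.1 hμ) this.symm

/-- Induction on the degree of `f`. Tensors whose windows are all zeros of the Hasse derivative are
covered by the smaller degree; the others have a window where it is nonzero, which is made a
coordinate window so that stability applies. -/
theorem exists_degree_windowLocus (K : Type u) [Field K] [Infinite K] (k m : ℕ)
    (f : MvPolynomial (Fin m × Fin m) K) (hf : f ≠ 0) :
    ∃ d₀, ∀ (N n : ℕ) (ω : ⋀[K]^(N + 2) (Fin n → K)),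
      ω ∈ secantDegreeClosure K _ (N + 2) k d₀ → ω ∈ windowLocus f →
        ∀ d, ω ∈ secantDegreeClosure K _ (N + 2) k d := by
  induction hD : f.totalDegree using Nat.strong_induction_on generalizing f with
  | _ D ih =>
    subst hD
    rcases Nat.eq_zero_or_pos f.totalDegree with h0 | hpos
    · refine ⟨0, fun N n ω _ hω => ?_⟩
      rw [totalDegree_eq_zero_iff_eq_C] at h0
      have := hω 0 0 0
      rw [h0, eval_C] at this
      rw [h0, this, C_0] at hf
      exact absurd rfl hf
    obtain ⟨y₀, μ, hμ, hμ0⟩ : ∃ y₀, ∃ μ ∈ f.support, μ y₀ ≠ 0 := by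
      by_contra! hcon
      refine hpos.ne' ((totalDegree_eq_zero_iff _ f).2 fun μ hμ y => hcon y μ hμ)
    obtain ⟨p, hp⟩ := ExpChar.exists K
    obtain ⟨e, hq, hne⟩ := exists_expChar_pow_dvd K p f.support (fun μ => μ y₀) ⟨μ, hμ, hμ0⟩
    obtain ⟨d₁, hd₁⟩ := ih _ (totalDegree_hasse_lt f y₀ (p ^ e) (pow_pos (expChar_pos K p) e) hq hpos)
      _ (hasse_ne_zero f y₀ (p ^ e) hq hne) rfl
    obtain ⟨d₂, hd₂⟩ := exists_framedFamily_stable f k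
    refine ⟨max d₁ d₂, fun N n ω hωd hω d => ?_⟩
    by_cases hh : ω ∈ windowLocus (hasse f y₀ (p ^ e))
    · exact hd₁ N n ω (degreeClosure_antitone _ (le_max_left _ _) hωd) hh d
    simp only [windowLocus, Set.mem_ofPred_eq, not_forall] at hh
    obtain ⟨α, β, β', hh⟩ := hh
    -- The chosen frame and window become coordinates; the original ones are kept as further
    -- letters, so `ψ` is a left inverse.
    let φ : (Fin n → K) →ₗ[K] (Letter N m n → K) :=
      LinearMap.pi (Sum.elim α (Sum.elim (Sum.elim β β') LinearMap.proj))
    let ψ : (Letter N m n → K) →ₗ[K] (Fin n → K) :=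
      LinearMap.pi fun i => LinearMap.proj (Sum.inr (Sum.inr i))
    have hψφ : ψ ∘ₗ φ = LinearMap.id := by
      ext i j
      simp [φ, ψ]
    have hback : exteriorPower.map _ ψ (exteriorPower.map _ φ ω) = ω := by
      rw [← LinearMap.comp_apply, ← exteriorPower.map_comp, hψφ, exteriorPower.map_id]
      rfl
    rw [← hback]
    refine (conePreserving_map _ ψ).map_mem (polyEval_eq_zero_of_stable f hd₂ y₀ p e hq _
      (map_mem_windowLocus φ hω)
      ((conePreserving_map _ φ).map_mem (degreeClosure_antitone _ (le_max_right _ _) hωd)) ?_ d)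
    convert hh using 1
    rw [windowFun]
    congr 2
    ext ij
    rw [wordFun, windowValues, pairingOn_apply, pairingOn_apply, pairing_map]
    congr 1
    ext1 l
    simp only [Function.comp_apply]
    rcases finSumFinEquiv.symm l with l | l
    · rfl
    · fin_cases l <;> rfl

/-- Two new coordinates are adjoined; wedging with their basis vectors is undone by contracting with
their coordinate forms. This covers degrees below 2 and reduces to coordinate spaces. -/
theorem exists_conePreserving_retract {K : Type*} {V : Type*} [Field K] [AddCommGroup V]
    [Module K V] [FiniteDimensional K V] (p : ℕ) :
    ∃ (n : ℕ) (E : ⋀[K]^p V →ₗ[K] ⋀[K]^(p + 2) (Fin n → K))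
      (C : ⋀[K]^(p + 2) (Fin n → K) →ₗ[K] ⋀[K]^p V),
      ConePreserving E ∧ ConePreserving C ∧ ∀ ω, C (E ω) = ω := by
  let U := V × (Fin 2 → K)
  let φ : U ≃ₗ[K] (Fin (finrank K U) → K) := (finBasis K U).equivFun
  let e : Fin (p + 2) ≃ Fin 2 ⊕ Fin p :=
    finSumFinEquiv.symm.trans (Equiv.sumComm _ _)
  obtain ⟨A, hA, hA'⟩ := exists_wedge (K := K) (V := U) 2 p (p + 2) e fun i => (0, Pi.single i 1)
  obtain ⟨B, hB, hB'⟩ := exists_contract (K := K) (V := U) 2 p (p + 2) e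
    fun i => (LinearMap.proj i).comp (LinearMap.snd K _ _)
  refine ⟨finrank K U,
    exteriorPower.map _ φ.toLinearMap ∘ₗ A ∘ₗ exteriorPower.map _ (LinearMap.inl K _ _),
    exteriorPower.map _ (LinearMap.fst K _ _) ∘ₗ B ∘ₗ exteriorPower.map _ φ.symm.toLinearMap,
    (conePreserving_map _ _).comp (hA.comp (conePreserving_map _ _)),
    (conePreserving_map _ _).comp (hB.comp (conePreserving_map _ _)), fun ω => ?_⟩
  have hφ (η : ⋀[K]^(p + 2) U) :
      exteriorPower.map _ φ.symm.toLinearMap (exteriorPower.map _ φ.toLinearMap η) = η := by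
    rw [← LinearMap.comp_apply, ← exteriorPower.map_comp, LinearEquiv.symm_comp,
      exteriorPower.map_id]
    rfl
  simp only [LinearMap.comp_apply, hφ]
  refine eq_of_pairing_eq fun u => ?_
  have h : pairingForm u ∘ₗ exteriorPower.map p (LinearMap.fst K V (Fin 2 → K)) ∘ₗ B ∘ₗ A ∘ₗ
      exteriorPower.map p (LinearMap.inl K V (Fin 2 → K)) = pairingForm u := by
    refine eq_of_eq_on_ιMulti fun v => ?_
    simp only [LinearMap.comp_apply, map_apply_ιMulti, pairingForm_apply]
    rw [pairing_map, hB', hA', ← pairingOn_apply, pairingOn_ιMulti, pairing_ιMulti]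
    have h1 : (Matrix.of fun i j =>
        (Sum.elim (fun i => (LinearMap.proj i).comp (LinearMap.snd K V (Fin 2 → K)))
          (fun i => (u i).comp (LinearMap.fst K V (Fin 2 → K))) j)
          (Sum.elim (fun i : Fin 2 => ((0, Pi.single i 1) : U))
            (LinearMap.inl K V (Fin 2 → K) ∘ v) i))
        = Matrix.fromBlocks (1 : Matrix (Fin 2) (Fin 2) K) 0 0 (Matrix.of fun i j => u j (v i)) := by
      ext i j
      rcases i with i | i <;> rcases j with j | j
      · simp [Matrix.one_apply, Pi.single_apply, eq_comm]
      · simp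
      · simp
      · simp
    exact (congrArg Matrix.det h1).trans (by rw [Matrix.det_fromBlocks_zero₂₁, Matrix.det_one, one_mul])
  exact LinearMap.congr_fun h ω

end SecantGrassmann

theorem mainTheorem2 (K : Type u) [Field K] [Infinite K] (k : ℕ) :
    ∃ d : ℕ, ∀ (p : ℕ) (V : Type v) [AddCommGroup V] [Module K V] [FiniteDimensional K V],
      SecantGrassmann.DefinedInDegreeLE K
        (SecantGrassmann.secantVariety K (SecantGrassmann.grassmannCone K V p) k) d := by
  obtain ⟨d₀, hd₀⟩ := SecantGrassmann.exists_degree_windowLocus K k (2 * k + 3)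
    (SecantGrassmann.detPoly K (2 * k + 3)) (Matrix.det_mvPolynomialX_ne_zero _ _)
  -- The determinant degree places the tensor in the window locus, and there degree `d₀` suffices.
  refine ⟨max d₀ (SecantGrassmann.detPoly K (2 * k + 3)).totalDegree, fun p V _ _ _ => ?_⟩
  refine SecantGrassmann.definedInDegreeLE_of_degreeClosure_subset fun ω hω =>
    SecantGrassmann.zariskiClosure_secantVariety_subset p k
      (SecantGrassmann.mem_zariskiClosure_of_forall_degreeClosure fun d => ?_)
  obtain ⟨n, E, C, hE, hC, hCE⟩ := SecantGrassmann.exists_conePreserving_retract (K := K) (V := V) p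
  rw [← hCE ω]
  have hEω := hE.map_mem hω
  exact hC.map_mem (hd₀ p n _ (SecantGrassmann.degreeClosure_antitone _ (le_max_left _ _) hEω)
    (SecantGrassmann.degreeClosure_subset_windowLocus_detPoly (le_max_right _ _) hEω) d)
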